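/- **Setting.** Let $G=(V,E)$ be an undirected (simple) graph with $n=|V|\ge 2$ vertices and $m=|E|$ edges, with positive capacities $c:E\to\mathbb{R}_{>0}$ and positive initial weights $w_0:E\to\mathbb{R}_{>0}$; let $T$ be a spanning tree of $G$ with a root $r$, given by parent pointers, and let $0<\varepsilon\le 1$. For a vertex $v$ let $D(v)$ be the set of descendants of $v$ in $T$ (including $v$), and for $S\subseteq V$ let $\partial S$ be the set of edges with exactly one end point in $S$. A *1-cut* of $T$ is a set $\partial D(s)$ with $s\ne r$. A *2-cut* of $T$ is described by two distinct vertices $s,t\neq r$: it is $\partial(D(s)\cup D(t))$ if neither of $s,t$ is a descendant of the other, $\partial(D(t)\setminus D(s))$ if $s$ is a descendant of $t$, and $\partial(D(s)\setminus D(t))$ if $t$ is a descendant of $s$. The *MWU update* along a cut $C$ multiplies the weight of every $e\in C$ by $\exp(\varepsilon\gamma/c(e))$, where $\gamma=\min_{e\in C}c(e)$, and leaves the other weights unchanged. **Model.** Algorithms run on a RAM with exact real arithmetic (addition, subtraction, multiplication, division, exponential and comparison, but no rounding of reals to integers), with integer words of absolute size at most $n^{O(1)}$, zero-initialized memory, and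 unit cost per operation. **Lemma.** There is a deterministic data structure with the following operations: an initialization with $(G,c,w_0,T,\varepsilon)$; $\mathrm{inc\text{-}cut}(C)$ for any 1-cut or 2-cut $C$ of $T$, passed by its one or two describing vertices; and $\mathrm{flush}()$. Each call to $\mathrm{inc\text{-}cut}$ and $\mathrm{flush}$ returns a list of increments $(e,\delta)$ with $e\in E$ and $\delta>0$. Consider the initialization (which always halts) followed by any finite sequence of calls to $\mathrm{inc\text{-}cut}$ and $\mathrm{flush}$. At any time, let $w(e)$ be the exact weight of $e$, obtained from $w_0(e)$ by the MWU updates along all the cuts passed to $\mathrm{inc\text{-}cut}$ so far, and let $\tilde w(e)$ be $w_0(e)$ plus the sum of all increments $\delta$ returned for $e$ so far. Then, with absolute constants in $O(\cdot)$ and $\Omega(\cdot)$: 1. after each call to $\mathrm{inc\text{-}cut}$, $\tilde w(e)\le w(e)\le(1+O(\varepsilon))\,\tilde w(e)$ for all $e\in E$; 2. after each call to $\mathrm{flush}$, $\tilde w(e)=w(e)$ for all $e\in E$; 3. each call to $\mathrm{inc\text{-}cut}$ takes $O(\log^2 n+I)$ time, where $I$ is the number of increments it returns; 4. each call to $\mathrm{flush}$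 takes $O(m\log^2 n)$ time and returns at most $m$ increments; 5. each increment $(e,\delta)$ returned by $\mathrm{inc\text{-}cut}$ satisfies $\delta\ge\Omega\big((\varepsilon/\log^2 n)\,w(e)\big)$, where $w(e)$ is the exact weight after the call. -/

import Mathlib

/-! ## The machine model: a word/real RAM with structured control flow and a step count -/

namespace RealRAM

/-- The memory of the machine: word registers, real registers, and word arrays and real arrays.
A program mentions only finitely many registers and array names; array cells are addressed by the
content of word registers. -/
structure Store where
  nreg : ℕ → ℕ
  rreg : ℕ → ℝ
  narr : ℕ → ℕ → ℕ
  rarr : ℕ → ℕ → ℝ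

/-- Arithmetic on words (truncated subtraction, integer division and remainder). -/
inductive NOp where
  | add | sub | mul | div | mod

def NOp.eval : NOp → ℕ → ℕ → ℕ
  | .add, a, b => a + b
  | .sub, a, b => a - b
  | .mul, a, b => a * b
  | .div, a, b => a / b
  | .mod, a, b => a % b

/-- Exact arithmetic on reals. -/
inductive ROp where
  | add | sub | mul | div

noncomputable def ROp.eval : ROp → ℝ → ℝ → ℝ
  | .add, a, b => a + b
  | .sub, a, b => a - b
  | .mul, a, b => a * b
  | .div, a, b => a / b

/-- Unit-cost instructions. In each, `d` is the destination register, `a`, `b` are source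
registers, `A` names an array and `i` is the word register that holds the address. Reals enter
only as inputs, as casts of words, or as results of arithmetic; there is no rounding of a real to
a word. -/
inductive Instr where
  | nconst (d k : ℕ)
  | nmove (d a : ℕ)
  | nop (o : NOp) (d a b : ℕ)
  | nload (d A i : ℕ)
  | nstore (A i a : ℕ)
  | rcast (d a : ℕ)
  | rmove (d a : ℕ)
  | rop (o : ROp) (d a b : ℕ)
  | rexp (d a : ℕ)
  | rload (d A i : ℕ)
  | rstore (A i a : ℕ)

namespace Store

def setN (s : Store) (d k : ℕ) : Store :=
  { s with nreg := Function.update s.nreg d k }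

noncomputable def setR (s : Store) (d : ℕ) (x : ℝ) : Store :=
  { s with rreg := Function.update s.rreg d x }

def putN (s : Store) (A i k : ℕ) : Store :=
  { s with narr := Function.update s.narr A (Function.update (s.narr A) i k) }

noncomputable def putR (s : Store) (A i : ℕ) (x : ℝ) : Store :=
  { s with rarr := Function.update s.rarr A (Function.update (s.rarr A) i x) }

end Store

noncomputable def Instr.run : Instr → Store → Store
  | .nconst d k, s => s.setN d k
  | .nmove d a, s => s.setN d (s.nreg a)
  | .nop o d a b, s => s.setN d (o.eval (s.nreg a) (s.nreg b))
  | .nload d A i, s => s.setN d (s.narr A (s.nreg i))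
  | .nstore A i a, s => s.putN A (s.nreg i) (s.nreg a)
  | .rcast d a, s => s.setR d (s.nreg a : ℝ)
  | .rmove d a, s => s.setR d (s.rreg a)
  | .rop o d a b, s => s.setR d (o.eval (s.rreg a) (s.rreg b))
  | .rexp d a, s => s.setR d (Real.exp (s.rreg a))
  | .rload d A i, s => s.setR d (s.rarr A (s.nreg i))
  | .rstore A i a, s => s.putR A (s.nreg i) (s.rreg a)

/-- The words that an instruction creates do not exceed the largest word `B` of the machine. -/
def Instr.Fits (B : ℕ) : Instr → Store → Prop
  | .nconst _ k, _ => k ≤ B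
  | .nop o _ a b, s => o.eval (s.nreg a) (s.nreg b) ≤ B
  | _, _ => True

/-- Comparisons of two word registers, or of two real registers. -/
inductive Test where
  | neq (a b : ℕ)
  | nne (a b : ℕ)
  | nlt (a b : ℕ)
  | nle (a b : ℕ)
  | rlt (a b : ℕ)
  | rle (a b : ℕ)

def Test.Holds : Test → Store → Prop
  | .neq a b, s => s.nreg a = s.nreg b
  | .nne a b, s => s.nreg a ≠ s.nreg b
  | .nlt a b, s => s.nreg a < s.nreg b
  | .nle a b, s => s.nreg a ≤ s.nreg b
  | .rlt a b, s => s.rreg a < s.rreg b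
  | .rle a b, s => s.rreg a ≤ s.rreg b

/-- Programs. -/
inductive Cmd where
  | skip
  | instr (i : Instr)
  | seq (c₁ c₂ : Cmd)
  | cond (b : Test) (c₁ c₂ : Cmd)
  | loop (b : Test) (c : Cmd)

/-- `Exec B c s t s'`: on the machine whose words are the numbers `0, …, B`, the program `c`
started in the store `s` halts in the store `s'` after `t` steps. Every executed instruction and
every evaluated test is one step. A word overflow blocks the execution. The machine is
deterministic: `t` and `s'` are determined by `c` and `s`. -/
inductive Exec (B : ℕ) : Cmd → Store → ℕ → Store → Prop
  | skip (s : Store) : Exec B .skip s 1 s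
  | instr (i : Instr) (s : Store) (h : i.Fits B s) : Exec B (.instr i) s 1 (i.run s)
  | seq {c₁ c₂ : Cmd} {s₀ s₁ s₂ : Store} {t₁ t₂ : ℕ}
      (h₁ : Exec B c₁ s₀ t₁ s₁) (h₂ : Exec B c₂ s₁ t₂ s₂) :
      Exec B (.seq c₁ c₂) s₀ (t₁ + t₂) s₂
  | cond_true {b : Test} {c₁ c₂ : Cmd} {s s' : Store} {t : ℕ}
      (hb : b.Holds s) (h : Exec B c₁ s t s') : Exec B (.cond b c₁ c₂) s (t + 1) s'
  | cond_false {b : Test} {c₁ c₂ : Cmd} {s s' : Store} {t : ℕ}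
      (hb : ¬ b.Holds s) (h : Exec B c₂ s t s') : Exec B (.cond b c₁ c₂) s (t + 1) s'
  | loop_done {b : Test} {c : Cmd} {s : Store}
      (hb : ¬ b.Holds s) : Exec B (.loop b c) s 1 s
  | loop_step {b : Test} {c : Cmd} {s₀ s₁ s₂ : Store} {t₁ t₂ : ℕ}
      (hb : b.Holds s₀) (h₁ : Exec B c s₀ t₁ s₁) (h₂ : Exec B (.loop b c) s₁ t₂ s₂) :
      Exec B (.loop b c) s₀ (t₁ + t₂ + 1) s₂

end RealRAM

/-! ## Graphs with a rooted spanning tree, their 1-cuts and 2-cuts, and the weight updates -/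

namespace LazyIncCuts

open RealRAM

/-- An undirected graph `G` on `n ≥ 2` vertices with its `m` edges listed by their end points,
positive capacities and positive initial weights, a spanning tree `T` rooted at `root` and
represented by parent pointers, and the accuracy parameter `ε`. -/
structure Input where
  n : ℕ
  two_le_n : 2 ≤ n
  G : SimpleGraph (Fin n)
  m : ℕ
  src : Fin m → Fin n
  dst : Fin m → Fin n
  edges : Set.BijOn (fun i => s(src i, dst i)) Set.univ G.edgeSet
  cap : Fin m → ℝ
  cap_pos : ∀ i, 0 < cap i
  wt : Fin m → ℝ
  wt_pos : ∀ i, 0 < wt i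
  T : SimpleGraph (Fin n)
  T_le : T ≤ G
  T_tree : T.IsTree
  root : Fin n
  parent : Fin n → Fin n
  parent_root : parent root = root
  parent_adj : ∀ v, v ≠ root → T.Adj v (parent v)
  parent_dist : ∀ v, v ≠ root → T.dist root v = T.dist root (parent v) + 1
  ε : ℝ
  ε_pos : 0 < ε
  ε_le_one : ε ≤ 1

/-- The succinct description of a cut. A non-root vertex `s` stands for the tree edge from `s` to
its parent: `one s` is the 1-cut induced by that edge, and `two s t` is the 2-cut induced by the
edges of `s` and `t`. -/
inductive CutDesc (n : ℕ) where
  | one (s : Fin n)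
  | two (s t : Fin n)

namespace Input

variable (P : Input)

/-- The down set of `v`: all descendants of `v` in the rooted tree, including `v`. -/
def down (v : Fin P.n) : Set (Fin P.n) := {u | ∃ k : ℕ, P.parent^[k] u = v}

/-- The descriptions of 1-cuts and 2-cuts: one tree edge, or two different tree edges. -/
def Valid : CutDesc P.n → Prop
  | .one s => s ≠ P.root
  | .two s t => s ≠ P.root ∧ t ≠ P.root ∧ s ≠ t

open Classical in
/-- A vertex set whose edge boundary is the described cut: `D(s)` for a 1-cut, and for a 2-cut
`D(t) \ D(s)` if `s` is below `t`, `D(s) \ D(t)` if `t` is below `s`, and `D(s) ∪ D(t)` if the two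
are incomparable. -/
noncomputable def side : CutDesc P.n → Set (Fin P.n)
  | .one s => P.down s
  | .two s t =>
      if s ∈ P.down t then P.down t \ P.down s
      else if t ∈ P.down s then P.down s \ P.down t
      else P.down s ∪ P.down t

/-- The edges of the cut: those with exactly one end point in the side. -/
def cut (q : CutDesc P.n) : Set (Fin P.m) :=
  {i | Xor (P.src i ∈ P.side q) (P.dst i ∈ P.side q)}

/-- The minimum capacity of an edge of the cut (a cut of a connected graph is not empty). -/
noncomputable def minCap (q : CutDesc P.n) : ℝ := sInf (P.cap '' P.cut q)

open Classical in
/-- The exact multiplicative weight update along a cut. -/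
noncomputable def mwu (q : CutDesc P.n) (w : Fin P.m → ℝ) : Fin P.m → ℝ := fun i =>
  if i ∈ P.cut q then w i * Real.exp (P.ε * P.minCap q / P.cap i) else w i

/-- The initial store: `n`, `m` and the root in the word registers 0, 1, 2, the accuracy in the
real register 0, the end points of the edges in the word arrays 0 and 1, the parent pointers in
the word array 2, capacities and weights in the real arrays 0 and 1, and zero elsewhere. -/
noncomputable def store : Store where
  nreg := fun k => if k = 0 then P.n else if k = 1 then P.m else if k = 2 then P.root else 0
  rreg := fun k => if k = 0 then P.ε else 0
  narr := fun A i =>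
    if A = 0 then (if h : i < P.m then P.src ⟨i, h⟩ else 0)
    else if A = 1 then (if h : i < P.m then P.dst ⟨i, h⟩ else 0)
    else if A = 2 then (if h : i < P.n then P.parent ⟨i, h⟩ else 0)
    else 0
  rarr := fun A i =>
    if A = 0 then (if h : i < P.m then P.cap ⟨i, h⟩ else 0)
    else if A = 1 then (if h : i < P.m then P.wt ⟨i, h⟩ else 0)
    else 0

end Input

/-- Passing the argument of `inc-cut`: the number of tree edges in the word register 3, the
vertices that describe them in the word registers 4 and 5. -/
def pass {n : ℕ} (s : Store) : CutDesc n → Store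
  | .one u => ((s.setN 3 1).setN 4 u).setN 5 0
  | .two u v => ((s.setN 3 2).setN 4 u).setN 5 v

/-- The list of pairs (edge, increment) returned by a call: its length is in the word register 6,
the edges are in the word array 3, the increments in the real array 2. -/
noncomputable def returned (s : Store) : List (ℕ × ℝ) :=
  (List.range (s.nreg 6)).map fun j => (s.narr 3 j, s.rarr 2 j)

/-- Adding the increments of a list to the weights. -/
noncomputable def applyIncs {m : ℕ} (Δ : List (ℕ × ℝ)) (w : Fin m → ℝ) : Fin m → ℝ := fun i =>
  w i + ((Δ.filter fun p => p.1 = (i : ℕ)).map Prod.snd).sum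

/-- The three routines of the data structure. -/
structure Impl where
  init : Cmd
  incCut : Cmd
  flush : Cmd

/-- `Reaches D B P s w w'`: on the input `P`, initialization and some sequence of calls to
`inc-cut` (with arbitrary 1-cuts and 2-cuts) and `flush` lead to the store `s`, to the exact
weights `w`, and to the approximate weights `w'` implied by the returned increments. -/
inductive Reaches (D : Impl) (B : ℕ) (P : Input) :
    Store → (Fin P.m → ℝ) → (Fin P.m → ℝ) → Prop
  | init {t : ℕ} {s : Store} (h : Exec B D.init P.store t s) : Reaches D B P s P.wt P.wt
  | incCut {t : ℕ} {s s' : Store} {w w' : Fin P.m → ℝ} (hr : Reaches D B P s w w')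
      (q : CutDesc P.n) (hq : P.Valid q) (h : Exec B D.incCut (pass s q) t s') :
      Reaches D B P s' (P.mwu q w) (applyIncs (returned s') w')
  | flush {t : ℕ} {s s' : Store} {w w' : Fin P.m → ℝ} (hr : Reaches D B P s w w')
      (h : Exec B D.flush s t s') :
      Reaches D B P s' w (applyIncs (returned s') w')

end LazyIncCuts

/-! Geometry of the cuts. Label the vertices so that every down set is an interval of labels
(`Labels`). The side of a 1-cut or 2-cut is then a union of at most two intervals, and its
complement is a union of at most three. With H = ⌊log₂ n⌋ + 1, an interval splits into at most 2H
dyadic intervals. Call the set of edges joining two given dyadic intervals a canonical cut.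
Multiplying out side and complement writes every cut as a partition into at most (4H)(6H) = 24H²
canonical cuts (`wp_splitCut`, `Tab.Ok.splits`). A label lies in one dyadic interval per level, so
an edge lies in at most 2H² canonical cuts (`Tab.Ok.card_mem_le`). All canonical cuts can therefore
be tabulated with at most 2H²m entries. Each list is sorted by capacity, so the minimum capacity of
a cut is found at the heads of its lists.

Lazy updates. An update adds γ to an exponent that is shared by all edges of the cut, and only the
factor ε/c(e) depends on the edge. So each canonical cut S stores one accumulated value Γ S, and
each entry k stores the value A k up to which its edge has been informed. The exact weight is w = w̃
· exp(ε · pend / c), where pend sums the lags Γ − A over all entries of the edge. Every entry has a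
threshold of order c/H². After Γ S is raised, its list is scanned from the cheapest entry on, lags
that reach the threshold are passed on, and the scan stops at the first one that does not. The
running time is thus a constant per canonical cut plus a constant per increment.

Why stopping early is harmless. Thresholds are rounded so that distinct values differ by a factor of
at least two. The invariant `Tab.Lazy` says that an entry lags behind its predecessor by less than
its own threshold, and not at all if the two thresholds agree. The lags then form a geometric sum
below twice the threshold (`Tab.Ok.lag_lt`), so pend is at most 2H² · 2 · c/H² = 4c
(`Tab.Ok.pend_le`), which gives the approximation. The scan preserves the invariant
(`Tab.Ok.lazy_advance`). A lag that is passed on is at least c/(2H²), so it multiplies the weight by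
at least 1 + ε/(2H²) (`Emitted.step`).

The programs are verified with a timed weakest-precondition calculus. `Represents` is the invariant
between calls, and `Exec.deterministic` transfers it to every possible run. -/

set_option linter.unusedSimpArgs false

/-! ### Frame property and determinism of the machine. -/

namespace RealRAM

/-- The parts of a store that an instruction can write. -/
inductive Loc where
  | nreg (k : ℕ)
  | rreg (k : ℕ)
  | narr (k : ℕ)
  | rarr (k : ℕ)
  deriving DecidableEq

/-- Two stores agree at a location. -/
def Loc.Same (s s' : Store) : Loc → Prop
  | .nreg k => s'.nreg k = s.nreg k
  | .rreg k => s'.rreg k = s.rreg k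
  | .narr k => s'.narr k = s.narr k
  | .rarr k => s'.rarr k = s.rarr k

def Instr.target : Instr → Loc
  | .nconst d _ | .nmove d _ | .nop _ d _ _ | .nload d _ _ => .nreg d
  | .nstore A _ _ => .narr A
  | .rcast d _ | .rmove d _ | .rop _ d _ _ | .rexp d _ | .rload d _ _ => .rreg d
  | .rstore A _ _ => .rarr A

def Cmd.writes : Cmd → List Loc
  | .skip => []
  | .instr i => [i.target]
  | .seq c₁ c₂ => c₁.writes ++ c₂.writes
  | .cond _ c₁ c₂ => c₁.writes ++ c₂.writes
  | .loop _ c => c.writes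

/-- `s'` agrees with `s` wherever the program `c` does not write. -/
def Frame (c : Cmd) (s s' : Store) : Prop := ∀ l : Loc, l ∉ c.writes → l.Same s s'

namespace Store

variable (s : Store) (d k a A i : ℕ) (x : ℝ)

@[simp] theorem setN_nreg : (s.setN d k).nreg a = if a = d then k else s.nreg a := by
  simp [setN, Function.update_apply]
@[simp] theorem setN_rreg : (s.setN d k).rreg = s.rreg := rfl
@[simp] theorem setN_narr : (s.setN d k).narr = s.narr := rfl
@[simp] theorem setN_rarr : (s.setN d k).rarr = s.rarr := rfl
@[simp] theorem setR_rreg : (s.setR d x).rreg a = if a = d then x else s.rreg a := by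
  simp [setR, Function.update_apply]
@[simp] theorem setR_nreg : (s.setR d x).nreg = s.nreg := rfl
@[simp] theorem setR_narr : (s.setR d x).narr = s.narr := rfl
@[simp] theorem setR_rarr : (s.setR d x).rarr = s.rarr := rfl
@[simp] theorem putN_narr : (s.putN A i k).narr a =
    if a = A then Function.update (s.narr A) i k else s.narr a := by
  simp [putN, Function.update_apply]
@[simp] theorem putN_nreg : (s.putN A i k).nreg = s.nreg := rfl
@[simp] theorem putN_rreg : (s.putN A i k).rreg = s.rreg := rfl
@[simp] theorem putN_rarr : (s.putN A i k).rarr = s.rarr := rfl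
@[simp] theorem putR_rarr : (s.putR A i x).rarr a =
    if a = A then Function.update (s.rarr A) i x else s.rarr a := by
  simp [putR, Function.update_apply]
@[simp] theorem putR_nreg : (s.putR A i x).nreg = s.nreg := rfl
@[simp] theorem putR_rreg : (s.putR A i x).rreg = s.rreg := rfl
@[simp] theorem putR_narr : (s.putR A i x).narr = s.narr := rfl

end Store

theorem Loc.Same.refl (s : Store) (l : Loc) : l.Same s s := by cases l <;> rfl

theorem Loc.Same.trans {s s' s'' : Store} {l : Loc} (h : l.Same s s') (h' : l.Same s' s'') :
    l.Same s s'' := by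
  cases l <;> simp_all [Loc.Same]

theorem Frame.refl (c : Cmd) (s : Store) : Frame c s s := fun l _ => .refl s l

theorem Frame.trans {c : Cmd} {s s' s'' : Store} (h : Frame c s s') (h' : Frame c s' s'') :
    Frame c s s'' := fun l hl => (h l hl).trans (h' l hl)

theorem Frame.mono {c c' : Cmd} {s s' : Store} (h : Frame c s s')
    (hc : ∀ l ∈ c.writes, l ∈ c'.writes) : Frame c' s s' :=
  fun l hl => h l fun h' => hl (hc l h')

theorem Frame.nreg {c : Cmd} {s s' : Store} (h : Frame c s s') (k : ℕ)
    (hk : Loc.nreg k ∉ c.writes) : s'.nreg k = s.nreg k := h _ hk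

theorem Frame.rreg {c : Cmd} {s s' : Store} (h : Frame c s s') (k : ℕ)
    (hk : Loc.rreg k ∉ c.writes) : s'.rreg k = s.rreg k := h _ hk

theorem Frame.narr {c : Cmd} {s s' : Store} (h : Frame c s s') (k : ℕ)
    (hk : Loc.narr k ∉ c.writes) : s'.narr k = s.narr k := h _ hk

theorem Frame.rarr {c : Cmd} {s s' : Store} (h : Frame c s s') (k : ℕ)
    (hk : Loc.rarr k ∉ c.writes) : s'.rarr k = s.rarr k := h _ hk

theorem Instr.frame (i : Instr) (s : Store) : Frame (.instr i) s (i.run s) := by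
  intro l hl
  cases i <;> cases l <;>
    simp_all [Cmd.writes, Instr.target, Loc.Same, Instr.run]

/-- The written locations are read off the syntax. For a concrete program, the claim that a register
or array survives is therefore settled by `decide`. -/
theorem Exec.frame {B : ℕ} {c : Cmd} {s s' : Store} {t : ℕ} (h : Exec B c s t s') :
    Frame c s s' := by
  induction h with
  | skip s => exact .refl _ s
  | instr i s h => exact i.frame s
  | seq _ _ ih₁ ih₂ =>
    exact (ih₁.mono (by simp +contextual [Cmd.writes])).trans
      (ih₂.mono (by simp +contextual [Cmd.writes]))
  | cond_true _ _ ih => exact ih.mono (by simp +contextual [Cmd.writes])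
  | cond_false _ _ ih => exact ih.mono (by simp +contextual [Cmd.writes])
  | loop_done => exact .refl _ _
  | loop_step _ _ _ ih₁ ih₂ => exact (ih₁.mono (by simp [Cmd.writes])).trans ih₂

/-- Lets a property of one run, as provided by `wp`, be asserted of an arbitrary given run; this is
needed because `Reaches` speaks of arbitrary executions. -/
theorem Exec.deterministic {B : ℕ} {c : Cmd} {s s₁ : Store} {t₁ : ℕ} (h₁ : Exec B c s t₁ s₁) :
    ∀ {t₂ : ℕ} {s₂ : Store}, Exec B c s t₂ s₂ → t₁ = t₂ ∧ s₁ = s₂ := by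
  induction h₁ with
  | skip s => intro _ _ h; cases h; exact ⟨rfl, rfl⟩
  | instr i s _ => intro _ _ h; cases h; exact ⟨rfl, rfl⟩
  | seq _ _ ih₁ ih₂ =>
    intro _ _ h
    cases h with
    | seq a b =>
      obtain ⟨rfl, rfl⟩ := ih₁ a
      obtain ⟨rfl, rfl⟩ := ih₂ b
      exact ⟨rfl, rfl⟩
  | cond_true hb _ ih =>
    intro _ _ h
    cases h with
    | cond_true _ a => obtain ⟨rfl, rfl⟩ := ih a; exact ⟨rfl, rfl⟩
    | cond_false hb' _ => exact absurd hb hb'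
  | cond_false hb _ ih =>
    intro _ _ h
    cases h with
    | cond_true hb' _ => exact absurd hb' hb
    | cond_false _ a => obtain ⟨rfl, rfl⟩ := ih a; exact ⟨rfl, rfl⟩
  | loop_done hb =>
    intro _ _ h
    cases h with
    | loop_done => exact ⟨rfl, rfl⟩
    | loop_step hb' _ _ => exact absurd hb' hb
  | loop_step hb _ _ ih₁ ih₂ =>
    intro _ _ h
    cases h with
    | loop_done hb' => exact absurd hb hb'
    | loop_step _ a b =>
      obtain ⟨rfl, rfl⟩ := ih₁ a
      obtain ⟨rfl, rfl⟩ := ih₂ b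
      exact ⟨rfl, rfl⟩

/-! ### Weakest preconditions with a clock -/

/-- Started at time `τ` in the store `s`, the program `c` halts, and the time and the store at
that moment satisfy `Q`. -/
def wp (B : ℕ) (c : Cmd) (Q : ℕ → Store → Prop) (τ : ℕ) (s : Store) : Prop :=
  ∃ t s', Exec B c s t s' ∧ Q (τ + t) s'

section wp

variable {B : ℕ} {c c₁ c₂ : Cmd} {b : Test} {Q R : ℕ → Store → Prop} {τ : ℕ} {s : Store}

/-- The consequence rule, strengthened by the frame: after a subprogram, everything it does not
write can still be recovered. -/
theorem wp.mono (h : wp B c Q τ s) (hQ : ∀ τ' s', Frame c s s' → Q τ' s' → R τ' s') :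
    wp B c R τ s := by
  obtain ⟨t, s', he, hq⟩ := h
  exact ⟨t, s', he, hQ _ _ he.frame hq⟩

theorem wp_skip : wp B .skip Q τ s ↔ Q (τ + 1) s := by
  constructor
  · rintro ⟨t, s', he, hq⟩
    cases he
    exact hq
  · exact fun h => ⟨1, s, .skip s, h⟩

theorem wp_instr {i : Instr} : wp B (.instr i) Q τ s ↔ i.Fits B s ∧ Q (τ + 1) (i.run s) := by
  constructor
  · rintro ⟨t, s', he, hq⟩
    cases he with
    | instr _ _ h => exact ⟨h, hq⟩
  · exact fun h => ⟨1, _, .instr i s h.1, h.2⟩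

theorem wp_seq : wp B (.seq c₁ c₂) Q τ s ↔ wp B c₁ (wp B c₂ Q) τ s := by
  constructor
  · rintro ⟨t, s', he, hq⟩
    cases he with
    | seq h₁ h₂ => exact ⟨_, _, h₁, _, _, h₂, by rwa [add_assoc]⟩
  · rintro ⟨t₁, s₁, h₁, t₂, s₂, h₂, hq⟩
    exact ⟨_, _, .seq h₁ h₂, by rwa [← add_assoc]⟩

theorem wp_cond : wp B (.cond b c₁ c₂) Q τ s ↔
    (b.Holds s → wp B c₁ Q (τ + 1) s) ∧ (¬ b.Holds s → wp B c₂ Q (τ + 1) s) := by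
  constructor
  · rintro ⟨t, s', he, hq⟩
    cases he with
    | @cond_true _ _ _ _ _ t hb h =>
      exact ⟨fun _ => ⟨_, _, h, by rwa [add_assoc, add_comm 1]⟩, fun h => absurd hb h⟩
    | @cond_false _ _ _ _ _ t hb h =>
      exact ⟨fun h => absurd h hb, fun _ => ⟨_, _, h, by rwa [add_assoc, add_comm 1]⟩⟩
  · rintro ⟨h₁, h₂⟩
    by_cases hb : b.Holds s
    · obtain ⟨t, s', he, hq⟩ := h₁ hb
      exact ⟨_, _, .cond_true hb he, by rwa [add_comm t, ← add_assoc]⟩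
    · obtain ⟨t, s', he, hq⟩ := h₂ hb
      exact ⟨_, _, .cond_false hb he, by rwa [add_comm t, ← add_assoc]⟩

/-- Loops, with an invariant and a variant. -/
theorem wp_loop (Inv : ℕ → Store → Prop) (μ : Store → ℕ) (h₀ : Inv τ s)
    (step : ∀ τ₁ s₁, Frame c s s₁ → Inv τ₁ s₁ → b.Holds s₁ →
      wp B c (fun τ₂ s₂ => Inv τ₂ s₂ ∧ μ s₂ < μ s₁) (τ₁ + 1) s₁)
    (done : ∀ τ₁ s₁, Frame c s s₁ → Inv τ₁ s₁ → ¬ b.Holds s₁ → Q (τ₁ + 1) s₁) :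
    wp B (.loop b c) Q τ s := by
  suffices H : ∀ k τ₁ s₁, μ s₁ ≤ k → Frame c s s₁ → Inv τ₁ s₁ → wp B (.loop b c) Q τ₁ s₁ from
    H _ τ s le_rfl (.refl _ _) h₀
  intro k
  induction k with
  | zero =>
    intro τ₁ s₁ hμ hf hi
    by_cases hb : b.Holds s₁
    · obtain ⟨t, s₂, -, -, hlt⟩ := step τ₁ s₁ hf hi hb
      omega
    · exact ⟨1, s₁, .loop_done hb, done _ _ hf hi hb⟩
  | succ k ih =>
    intro τ₁ s₁ hμ hf hi
    by_cases hb : b.Holds s₁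
    · obtain ⟨t, s₂, he, hi₂, hlt⟩ := step τ₁ s₁ hf hi hb
      obtain ⟨t', s₃, he', hq⟩ := ih _ s₂ (by omega) (hf.trans he.frame) hi₂
      refine ⟨_, _, .loop_step hb he he', ?_⟩
      convert hq using 1
      ring
    · exact ⟨1, s₁, .loop_done hb, done _ _ hf hi hb⟩

end wp

notation:60 a:61 ";;" b:60 => Cmd.seq a b

instance : Coe Instr Cmd := ⟨Cmd.instr⟩

/-- The loop `for i = 0, …, b - 1`, where `b` is the content of a word register. The word
register 7 is meant to contain 1. -/
def forLoop (i b : ℕ) (c : Cmd) : Cmd :=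
  Instr.nconst i 0 ;; .loop (.nlt i b) (c ;; Instr.nop .add i i 7)

/-- `Inv j` is asserted at the loop test, when the counter is `j`. The body may not write the
counter, the bound or register 7, so advancing the counter can be built into the conclusion of
`step`. -/
theorem wp_forLoop {B i b : ℕ} {c : Cmd} {Q : ℕ → Store → Prop} {τ : ℕ} {s : Store}
    (Inv : ℕ → ℕ → Store → Prop)
    (hw : Loc.nreg i ∉ c.writes ∧ Loc.nreg b ∉ c.writes ∧ Loc.nreg 7 ∉ c.writes ∧ b ≠ i ∧ 7 ≠ i)
    (h7 : s.nreg 7 = 1) (hb : s.nreg b ≤ B)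
    (h₀ : Inv 0 (τ + 1) (s.setN i 0))
    (step : ∀ j τ₁ s₁, j < s.nreg b → s₁.nreg i = j → Frame (forLoop i b c) s s₁ → Inv j τ₁ s₁ →
      wp B c (fun τ₂ s₂ => Inv (j + 1) (τ₂ + 1) (s₂.setN i (j + 1))) (τ₁ + 1) s₁)
    (done : ∀ τ₁ s₁, Frame (forLoop i b c) s s₁ → Inv (s.nreg b) τ₁ s₁ → Q (τ₁ + 1) s₁) :
    wp B (forLoop i b c) Q τ s := by
  obtain ⟨hi, hb', h7', hbi, h7i⟩ := hw
  have hF : Frame (forLoop i b c) s (s.setN i 0) := by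
    intro l hl
    refine (Instr.frame (.nconst i 0) s) l fun h => hl ?_
    simp only [forLoop, Cmd.writes, List.mem_append] at h ⊢
    exact Or.inl h
  have hM : ∀ l ∈ (c ;; (Instr.nop .add i i 7 : Cmd)).writes, l ∈ (forLoop i b c).writes := by
    intro l hl
    simp only [forLoop, Cmd.writes, List.mem_append] at hl ⊢
    exact Or.inr hl
  have e7 : ∀ s₁, Frame (c ;; (Instr.nop .add i i 7 : Cmd)) (s.setN i 0) s₁ → s₁.nreg 7 = 1 := by
    intro s₁ h
    rw [h.nreg 7 (by simp [Cmd.writes, Instr.target, h7', h7i])]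
    simp [h7i, h7]
  have eb : ∀ s₁, Frame (c ;; (Instr.nop .add i i 7 : Cmd)) (s.setN i 0) s₁ →
      s₁.nreg b = s.nreg b := by
    intro s₁ h
    rw [h.nreg b (by simp [Cmd.writes, Instr.target, hb', hbi])]
    simp [hbi]
  rw [forLoop, wp_seq, wp_instr]
  refine ⟨Nat.zero_le _, ?_⟩
  refine wp_loop (fun τ₁ s₁ => s₁.nreg i ≤ s.nreg b ∧ Inv (s₁.nreg i) τ₁ s₁)
    (fun s₁ => s.nreg b - s₁.nreg i) ?_ ?_ ?_
  · simpa [Instr.run] using h₀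
  · rintro τ₁ s₁ hf ⟨hle, hI⟩ hlt
    simp only [Test.Holds] at hlt
    simp only [Instr.run] at hf
    rw [eb s₁ hf] at hlt
    rw [wp_seq]
    refine (step _ τ₁ s₁ hlt rfl (hF.trans (hf.mono hM)) hI).mono ?_
    intro τ₂ s₂ hf₂ h₂
    have hi₂ : s₂.nreg i = s₁.nreg i := hf₂.nreg i hi
    have h₇ : s₂.nreg 7 = 1 := by rw [hf₂.nreg 7 h7', e7 s₁ hf]
    rw [wp_instr]
    simp only [Instr.Fits, Instr.run, NOp.eval, hi₂, h₇]
    refine ⟨by omega, ⟨?_, ?_⟩, ?_⟩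
    · simp only [Store.setN_nreg, if_true]; omega
    · simpa using h₂
    · simp only [Store.setN_nreg, if_true]; omega
  · rintro τ₁ s₁ hf ⟨hle, hI⟩ hlt
    simp only [Test.Holds] at hlt
    simp only [Instr.run] at hf
    rw [eb s₁ hf] at hlt
    have : s₁.nreg i = s.nreg b := by omega
    rw [this] at hI
    exact done τ₁ s₁ (hF.trans (hf.mono hM)) hI

end RealRAM

namespace LazyIncCuts

open RealRAM

/-! ### Levels of dyadic intervals -/

/-- Sets the word registers 7, 8, 9 to 1, 2, 0, fills the word array 8 with the powers of two up
to `n`, and leaves in the word registers 10, 11, 12 the number `H` of these powers, `H n` and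
`(H n) ^ 2`. -/
def levels : Cmd :=
  Instr.nconst 7 1 ;; Instr.nconst 8 2 ;; Instr.nconst 9 0 ;; Instr.nconst 10 0 ;;
  Instr.nconst 14 1 ;;
  .loop (.nle 14 0) (Instr.nstore 8 10 14 ;; Instr.nop .add 14 14 14 ;; Instr.nop .add 10 10 7) ;;
  Instr.nop .mul 11 10 0 ;; Instr.nop .mul 12 11 11

theorem lt_of_two_pow_le {k n : ℕ} (h : 2 ^ k ≤ n) : k < n := lt_of_lt_of_le k.lt_two_pow_self h

/-- The register 10 ends up as ⌊log₂ n⌋ + 1, characterized without logarithms by `k < H ↔ 2 ^ k ≤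
n`. Doubling stops at a word of at most 2n, and (H n)² ≤ n⁴. -/
theorem wp_levels {B n τ : ℕ} {s : Store} (hn : s.nreg 0 = n) (h2 : 2 ≤ n)
    (hB : 2 * n ^ 4 ≤ B) :
    wp B levels (fun _ s' => s'.nreg 7 = 1 ∧ s'.nreg 8 = 2 ∧ s'.nreg 9 = 0 ∧
      1 ≤ s'.nreg 10 ∧ s'.nreg 11 = s'.nreg 10 * n ∧ s'.nreg 12 = s'.nreg 11 * s'.nreg 11 ∧
      (∀ k, k < s'.nreg 10 ↔ 2 ^ k ≤ n) ∧ ∀ k < s'.nreg 10, s'.narr 8 k = 2 ^ k) τ s := by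
  have hn4 : n ≤ n ^ 4 := Nat.le_self_pow (by norm_num) n
  simp only [levels, wp_seq, wp_instr, Instr.Fits, Instr.run]
  refine ⟨by omega, by omega, by omega, by omega, by omega, ?_⟩
  refine wp_loop (fun _ s₁ => s₁.nreg 10 ≤ n ∧ s₁.nreg 14 = 2 ^ s₁.nreg 10 ∧
    (∀ k < s₁.nreg 10, s₁.narr 8 k = 2 ^ k ∧ 2 ^ k ≤ n)) (fun s₁ => 2 * n - s₁.nreg 14) ?_ ?_ ?_
  · simp
  · rintro τ₁ s₁ hf ⟨hH, hx, hk⟩ hb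
    have h7 : s₁.nreg 7 = 1 := by rw [hf.nreg 7 (by decide)]; simp
    have h0 : s₁.nreg 0 = n := by rw [hf.nreg 0 (by decide)]; simp [hn]
    simp only [Test.Holds, h0] at hb
    have hlt : s₁.nreg 10 < n := lt_of_two_pow_le (hx ▸ hb)
    simp only [wp_seq, wp_instr, Instr.Fits, Instr.run, NOp.eval]
    simp only [Store.setN_nreg, Store.putN_nreg, Store.setN_narr, Store.putN_narr, h7]
    norm_num
    have hpos : 0 < 2 ^ s₁.nreg 10 := by positivity
    refine ⟨by omega, by omega, ⟨by omega, by rw [hx, pow_succ]; ring, ?_⟩, by omega⟩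
    intro k hk'
    rcases hk'.lt_or_eq with h | rfl
    · rw [Function.update_of_ne h.ne]; exact hk k h
    · simp [hx]; omega
  · rintro τ₁ s₁ hf ⟨hH, hx, hk⟩ hb
    have h7 : s₁.nreg 7 = 1 := by rw [hf.nreg 7 (by decide)]; simp
    have h8 : s₁.nreg 8 = 2 := by rw [hf.nreg 8 (by decide)]; simp
    have h9 : s₁.nreg 9 = 0 := by rw [hf.nreg 9 (by decide)]; simp
    have h0 : s₁.nreg 0 = n := by rw [hf.nreg 0 (by decide)]; simp [hn]
    simp only [Test.Holds, h0, hx] at hb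
    have hM : s₁.nreg 10 * n ≤ n ^ 2 := by rw [sq]; exact Nat.mul_le_mul_right _ hH
    have hM2 : (s₁.nreg 10 * n) * (s₁.nreg 10 * n) ≤ n ^ 4 := by
      calc _ ≤ n ^ 2 * n ^ 2 := Nat.mul_le_mul hM hM
        _ = n ^ 4 := by ring
    have hn2 : n ^ 2 ≤ n ^ 4 := Nat.pow_le_pow_right (by omega) (by norm_num)
    simp only [wp_seq, wp_instr, Instr.Fits, Instr.run, NOp.eval]
    simp only [Store.setN_nreg, Store.setN_narr, h7, h8, h9, h0]
    norm_num
    refine ⟨by omega, by omega, ?_, ?_, fun k h => (hk k h).1⟩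
    · by_contra h
      have : s₁.nreg 10 = 0 := by omega
      rw [this] at hb
      omega
    · intro k
      refine ⟨fun h => (hk k h).2, fun h => ?_⟩
      by_contra h'
      exact hb ((Nat.pow_le_pow_right (by norm_num) (by omega)).trans h)

/-! ### Interval labels of the rooted tree -/

/-- Interval labels of a part `I` of the tree that is closed under taking parents. -/
structure Labels (P : Input) (I : Finset (Fin P.n)) (tin tout : ℕ → ℕ) : Prop where
  root_mem : P.root ∈ I
  parent_mem : ∀ v ∈ I, P.parent v ∈ I
  mem_down : ∀ u ∈ I, ∀ v ∈ I, (u ∈ P.down v ↔ tin v ≤ tin u ∧ tin u < tout v)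
  tout_le : ∀ v : Fin P.n, tout v ≤ I.card
  eq_zero : ∀ v : Fin P.n, v ∉ I → tin v = 0 ∧ tout v = 0

/-- Makes room for one more label at `p`. -/
def shift (p x : ℕ) : ℕ := if p ≤ x then x + 1 else x

theorem Input.mem_down_self (P : Input) (v : Fin P.n) : v ∈ P.down v := ⟨0, rfl⟩

theorem Input.mem_down_iff (P : Input) (u v : Fin P.n) :
    u ∈ P.down v ↔ u = v ∨ P.parent u ∈ P.down v := by
  constructor
  · rintro ⟨_ | k, hk⟩
    · exact Or.inl hk
    · exact Or.inr ⟨k, hk⟩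
  · rintro (rfl | ⟨k, hk⟩)
    · exact P.mem_down_self u
    · exact ⟨k + 1, hk⟩

namespace Labels

variable {P : Input} {I : Finset (Fin P.n)} {tin tout tin' tout' : ℕ → ℕ}

theorem tin_lt (h : Labels P I tin tout) {v : Fin P.n} (hv : v ∈ I) : tin v < tout v :=
  ((h.mem_down v hv v hv).mp (P.mem_down_self v)).2

theorem down_mem (h : Labels P I tin tout) {u v : Fin P.n} (hu : u ∈ I) (hv : u ∈ P.down v) :
    v ∈ I := by
  obtain ⟨k, rfl⟩ := hv
  induction k generalizing u with
  | zero => exact hu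
  | succ k ih => exact ih (h.parent_mem u hu)

theorem tin_le_card (h : Labels P I tin tout) (v : Fin P.n) : tin v ≤ I.card := by
  by_cases hv : v ∈ I
  · exact (h.tin_lt hv).le.trans (h.tout_le v)
  · simp [(h.eq_zero v hv).1]

/-- A new leaf receives the label right after its parent, and all labels from there on move up by
one. An interval contains the parent exactly if it starts before `p` and ends at `p` or later;
precisely these intervals grow by the new label. -/
theorem insert (h : Labels P I tin tout) {v : Fin P.n} (hv : v ∉ I) (hp : P.parent v ∈ I)
    {p : ℕ} (hpe : p = tin (P.parent v) + 1) (hin : tin' v = p) (hout : tout' v = p + 1)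
    (hin' : ∀ u : Fin P.n, u ≠ v → tin' u = shift p (tin u))
    (hout' : ∀ u : Fin P.n, u ≠ v → tout' u = shift p (tout u)) :
    Labels P (insert v I) tin' tout' := by
  have hpl := h.tin_lt hp
  have hpc := h.tout_le (P.parent v)
  refine ⟨by simp [h.root_mem], ?_, ?_, ?_, ?_⟩
  · intro u hu
    rcases Finset.mem_insert.mp hu with rfl | hu
    · exact Finset.mem_insert_of_mem hp
    · exact Finset.mem_insert_of_mem (h.parent_mem u hu)
  · intro a ha b hb
    rcases Finset.mem_insert.mp hb with rfl | hbI
    · rcases Finset.mem_insert.mp ha with rfl | ha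
      · simp [P.mem_down_self, hin, hout]
      · have hne : a ≠ b := fun e => hv (e ▸ ha)
        have : a ∉ P.down b := fun hd => hv (h.down_mem ha hd)
        simp only [this, false_iff, hin, hout, hin' a hne, shift]
        split <;> omega
    · have hbv : b ≠ v := fun e => hv (e ▸ hbI)
      rcases Finset.mem_insert.mp ha with hav | ha
      · subst hav
        -- The new vertex lies below `b` iff its parent does. An interval ending exactly at `p` has
        -- the parent as its last label; since its end is shifted as well, it takes in the new
        -- label.
        rw [P.mem_down_iff, h.mem_down _ hp b hbI, hin, hin' b hbv, hout' b hbv]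
        have hbl := h.tin_lt hbI
        simp only [Ne.symm hbv, false_or, shift]
        split <;> split <;> omega
      · have hav : a ≠ v := fun e => hv (e ▸ ha)
        rw [h.mem_down _ ha _ hbI, hin' a hav, hin' b hbv, hout' b hbv]
        simp only [shift]
        split <;> split <;> split <;> omega
  · intro u
    rw [Finset.card_insert_of_notMem hv]
    by_cases hu : u = v
    · subst hu; omega
    · rw [hout' u hu, shift]
      have := h.tout_le u
      split <;> omega
  · intro u hu
    simp only [Finset.mem_insert, not_or] at hu
    have := h.eq_zero u hu.2
    -- Since `p ≥ 1`, the default label 0 of vertices not yet treated is never shifted.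
    rw [hin' u hu.1, hout' u hu.1, this.1, this.2, shift, if_neg (by omega)]
    exact ⟨rfl, rfl⟩

end Labels

theorem Input.labels_singleton (P : Input) {tin tout : ℕ → ℕ} (h0 : ∀ i, tin i = 0)
    (h1 : ∀ v : Fin P.n, tout v = if v = P.root then 1 else 0) :
    Labels P {P.root} tin tout := by
  refine ⟨by simp, by simp [P.parent_root], ?_, ?_, ?_⟩
  · simp [P.mem_down_self, h0, h1]
  · intro v; rw [h1]; split <;> simp
  · intro v hv
    rw [h0, h1, if_neg (by simpa using hv)]
    exact ⟨rfl, rfl⟩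

theorem Input.depth_lt (P : Input) (v : Fin P.n) : P.T.dist P.root v < P.n := by
  obtain ⟨p, hp, hl⟩ := P.T_tree.connected.exists_path_of_dist P.root v
  rw [← hl]
  simpa using hp.length_lt

/-- Shifts all labels by one from the label in the word register 18 on. -/
def shiftLabels : Cmd :=
  forLoop 19 0
    (Instr.nload 20 4 19 ;;
      .cond (.nle 18 20) (Instr.nop .add 20 20 7 ;; Instr.nstore 4 19 20) .skip ;;
      Instr.nload 20 5 19 ;;
      .cond (.nle 18 20) (Instr.nop .add 20 20 7 ;; Instr.nstore 5 19 20) .skip)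

theorem wp_shiftLabels {B n τ : ℕ} {s : Store} (hn : s.nreg 0 = n) (h7 : s.nreg 7 = 1)
    (hin : ∀ u < n, s.narr 4 u ≤ n) (hout : ∀ u < n, s.narr 5 u ≤ n) (hB : n + 1 ≤ B) :
    wp B shiftLabels (fun _ s' => ∀ u < n, s'.narr 4 u = shift (s.nreg 18) (s.narr 4 u) ∧
      s'.narr 5 u = shift (s.nreg 18) (s.narr 5 u)) τ s := by
  refine wp_forLoop (fun j _ s₁ => ∀ u,
      s₁.narr 4 u = (if u < j then shift (s.nreg 18) (s.narr 4 u) else s.narr 4 u) ∧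
      s₁.narr 5 u = (if u < j then shift (s.nreg 18) (s.narr 5 u) else s.narr 5 u))
    (by decide) h7 (by omega) (by simp) ?_ ?_
  · intro j τ₁ s₁ hj hi hf hI
    rw [hn] at hj
    have e18 : s₁.nreg 18 = s.nreg 18 := hf.nreg 18 (by decide)
    have e7 : s₁.nreg 7 = 1 := by rw [hf.nreg 7 (by decide), h7]
    have e4 : s₁.narr 4 j = s.narr 4 j := by simpa using (hI j).1
    have e5 : s₁.narr 5 j = s.narr 5 j := by simpa using (hI j).2
    have := hin j hj
    have := hout j hj
    have key : ∀ u (a b : ℕ → ℕ),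
        a u = (if u < j then shift (s.nreg 18) (b u) else b u) →
        Function.update a j (shift (s.nreg 18) (b j)) u =
          if u < j + 1 then shift (s.nreg 18) (b u) else b u := by
      intro u a b h
      by_cases hu : u = j
      · subst hu; simp
      · rw [Function.update_of_ne hu, h]
        have : u < j + 1 ↔ u < j := by omega
        simp [this]
    have key' : ∀ u (a b : ℕ → ℕ), ¬ s.nreg 18 ≤ b j →
        a u = (if u < j then shift (s.nreg 18) (b u) else b u) →
        a u = if u < j + 1 then shift (s.nreg 18) (b u) else b u := by
      intro u a b hb h
      by_cases hu : u = j
      · subst hu; simp [h, shift, hb]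
      · rw [h]
        have : u < j + 1 ↔ u < j := by omega
        simp [this]
    simp only [wp_seq, wp_instr, wp_cond, wp_skip, Instr.Fits, Instr.run, NOp.eval, Test.Holds,
      Store.setN_nreg, Store.setN_narr, Store.putN_nreg, Store.putN_narr, hi, e18, e7, e4, e5]
    norm_num [e4, e5, -Order.lt_add_one_iff]
    refine ⟨fun h4 => ⟨by omega, fun h5 => ⟨by omega, fun u => ⟨?_, ?_⟩⟩, fun h5 u => ⟨?_, ?_⟩⟩,
      fun h4 => ⟨fun h5 => ⟨by omega, fun u => ⟨?_, ?_⟩⟩, fun h5 u => ⟨?_, ?_⟩⟩⟩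
    · simpa [shift, h4] using key u _ _ (hI u).1
    · simpa [shift, h5] using key u _ _ (hI u).2
    · simpa [shift, h4] using key u _ _ (hI u).1
    · exact key' u _ _ (by omega) (hI u).2
    · exact key' u _ _ (by omega) (hI u).1
    · simpa [shift, h5] using key u _ _ (hI u).2
    · exact key' u _ _ (by omega) (hI u).1
    · exact key' u _ _ (by omega) (hI u).2
  · intro τ₁ s₁ hf hI u hu
    simpa [hn, hu] using hI u

/-- Labels the vertex in the word register 15 if it is not labelled but its parent is. -/
def labelVertex : Cmd :=
  Instr.nload 16 6 15 ;;
  .cond (.neq 16 9)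
    (Instr.nload 16 2 15 ;; Instr.nload 17 6 16 ;;
      .cond (.neq 17 7)
        (Instr.nload 18 4 16 ;; Instr.nop .add 18 18 7 ;; shiftLabels ;;
          Instr.nstore 4 15 18 ;; Instr.nop .add 18 18 7 ;; Instr.nstore 5 15 18 ;;
          Instr.nstore 6 15 7) .skip) .skip

/-- Computes interval labels of the tree in the word arrays 4 and 5. -/
def labelTree : Cmd :=
  Instr.nstore 5 2 7 ;; Instr.nstore 6 2 7 ;; forLoop 14 0 (forLoop 15 0 labelVertex)

/-- The labels computed so far are correct for the set `I` of marked vertices. -/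
def LabelState (P : Input) (I : Finset (Fin P.n)) (s : Store) : Prop :=
  Labels P I (s.narr 4) (s.narr 5) ∧ ∀ v : Fin P.n, s.narr 6 v = if v ∈ I then 1 else 0

theorem wp_labelVertex {P : Input} {B τ : ℕ} {s : Store} {I : Finset (Fin P.n)} {v : Fin P.n}
    (h0 : s.nreg 0 = P.n) (h7 : s.nreg 7 = 1) (h9 : s.nreg 9 = 0) (hv : s.nreg 15 = v)
    (hp : ∀ v : Fin P.n, s.narr 2 v = P.parent v) (hB : 2 * P.n ≤ B) (hI : LabelState P I s) :
    wp B labelVertex (fun _ s' => ∃ I', I ⊆ I' ∧ (P.parent v ∈ I → v ∈ I') ∧ LabelState P I' s')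
      τ s := by
  obtain ⟨hL, h6⟩ := hI
  have hn := P.two_le_n
  have hcard : I.card ≤ P.n := by simpa using I.card_le_univ
  simp only [labelVertex, wp_seq, wp_instr, wp_cond, wp_skip, Instr.Fits, Instr.run, Test.Holds,
    Store.setN_nreg, Store.setN_narr, hv, h6, h9, h7, hp]
  norm_num [h6, hp, h7, h9]
  refine ⟨fun hvI => ⟨fun hpI => ?_, fun hpI => ?_⟩, fun hvI => ?_⟩
  · have hc := hL.tin_lt hpI
    have hc' := hL.tout_le (P.parent v)
    simp only [NOp.eval]
    refine ⟨by omega, ?_⟩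
    refine (wp_shiftLabels (n := P.n) ?_ ?_ ?_ ?_ (by omega)).mono ?_
    · simp [h0]
    · simp [h7]
    · intro u hu
      simpa using (hL.tin_le_card ⟨u, hu⟩).trans hcard
    · intro u hu
      simpa using (hL.tout_le ⟨u, hu⟩).trans hcard
    · intro τ₁ s₁ hf h₁
      have e18 : s₁.nreg 18 = s.narr 4 (P.parent v) + 1 := by
        rw [hf.nreg 18 (by decide)]; simp
      have e15 : s₁.nreg 15 = v := by rw [hf.nreg 15 (by decide)]; simp [hv]
      have e7 : s₁.nreg 7 = 1 := by rw [hf.nreg 7 (by decide)]; simp [h7]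
      have e6 : s₁.narr 6 = s.narr 6 := by rw [hf.narr 6 (by decide)]; simp
      simp only [Store.setN_nreg, Store.setN_narr, if_true] at h₁
      simp only [wp_seq, wp_instr, Instr.Fits, Instr.run, NOp.eval, Store.setN_nreg,
        Store.setN_narr, Store.putN_nreg, Store.putN_narr, e18, e15, e7, e6]
      norm_num [e15, e7, e18, e6]
      refine ⟨by omega, Insert.insert v I, by simp, by simp, ?_, ?_⟩
      · simp only [Store.putN_narr, Store.setN_narr]
        norm_num
        refine hL.insert hvI hpI rfl (by simp) (by simp) ?_ ?_
        · intro u hu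
          rw [Function.update_of_ne (by simpa [Fin.ext_iff] using hu)]
          exact (h₁ u u.2).1
        · intro u hu
          rw [Function.update_of_ne (by simpa [Fin.ext_iff] using hu)]
          exact (h₁ u u.2).2
      · intro u
        simp only [Store.putN_narr, Store.setN_narr]
        norm_num
        by_cases hu : u = v
        · simp [hu]
        · rw [e6, Function.update_of_ne (by simpa [Fin.ext_iff] using hu), h6]
          simp [hu]
  · exact ⟨I, subset_rfl, fun h => absurd h hpI, by simpa [LabelState] using ⟨hL, h6⟩⟩
  · exact ⟨I, subset_rfl, fun _ => hvI, by simpa [LabelState] using ⟨hL, h6⟩⟩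

/-- No traversal order is needed: each of the n rounds tries all vertices, and after round `a` every
vertex of depth at most `a + 1` has been labelled because its parent was. Initialization only has to
halt, so the cubic cost is irrelevant. -/
theorem wp_labelTree {P : Input} {B τ : ℕ} {s : Store}
    (h0 : s.nreg 0 = P.n) (h2 : s.nreg 2 = P.root) (h7 : s.nreg 7 = 1) (h9 : s.nreg 9 = 0)
    (hp : ∀ v : Fin P.n, s.narr 2 v = P.parent v)
    (h4 : ∀ i, s.narr 4 i = 0) (h5 : ∀ i, s.narr 5 i = 0) (h6 : ∀ i, s.narr 6 i = 0)
    (hB : 2 * P.n ≤ B) :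
    wp B labelTree (fun _ s' => Labels P Finset.univ (s'.narr 4) (s'.narr 5)) τ s := by
  simp only [labelTree, wp_seq, wp_instr, Instr.Fits, Instr.run, true_and]
  have hst : LabelState P {P.root} (((s.putN 5 (s.nreg 2) (s.nreg 7)).putN 6 (s.nreg 2)
      (s.nreg 7))) := by
    refine ⟨P.labels_singleton ?_ ?_, ?_⟩
    · simpa using h4
    · intro v
      simp [h2, h7, Function.update_apply, h5, Fin.ext_iff]
    · intro v
      simp [h2, h7, Function.update_apply, h6, Fin.ext_iff]
  refine wp_forLoop (fun a _ s₁ => ∃ I, LabelState P I s₁ ∧ ∀ v, P.T.dist P.root v ≤ a → v ∈ I)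
    (by decide) (by simpa using h7) (by simp [h0]; omega) ?_ ?_ ?_
  · refine ⟨{P.root}, by simpa [LabelState] using hst, fun v hv => ?_⟩
    have := (P.T_tree.connected.dist_eq_zero_iff (u := P.root) (v := v)).mp (by omega)
    simp [this]
  · rintro a τ₁ s₁ ha - hf ⟨I₀, hI₀, hd₀⟩
    have e0 : s₁.nreg 0 = P.n := by rw [hf.nreg 0 (by decide)]; simp [h0]
    have e7 : s₁.nreg 7 = 1 := by rw [hf.nreg 7 (by decide)]; simp [h7]
    have e9 : s₁.nreg 9 = 0 := by rw [hf.nreg 9 (by decide)]; simp [h9]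
    have ep : s₁.narr 2 = s.narr 2 := by rw [hf.narr 2 (by decide)]; simp
    refine wp_forLoop (fun j _ s₂ => ∃ I, LabelState P I s₂ ∧
        (∀ v, P.T.dist P.root v ≤ a → v ∈ I) ∧
        ∀ v : Fin P.n, (v : ℕ) < j → P.T.dist P.root v ≤ a + 1 → v ∈ I)
      (by decide) e7 (by omega) ?_ ?_ ?_
    · exact ⟨I₀, by simpa [LabelState] using hI₀, hd₀, by simp⟩
    · rintro j τ₂ s₂ hj hi hf₂ ⟨I, hI, hd, hd'⟩
      rw [e0] at hj
      have f0 : s₂.nreg 0 = P.n := by rw [hf₂.nreg 0 (by decide), e0]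
      have f7 : s₂.nreg 7 = 1 := by rw [hf₂.nreg 7 (by decide), e7]
      have f9 : s₂.nreg 9 = 0 := by rw [hf₂.nreg 9 (by decide), e9]
      have fp : s₂.narr 2 = s.narr 2 := by rw [hf₂.narr 2 (by decide), ep]
      refine (wp_labelVertex (v := ⟨j, hj⟩) f0 f7 f9 hi (by rw [fp]; exact hp) hB hI).mono ?_
      rintro τ₃ s₃ - ⟨I', hs, hp', hI'⟩
      refine ⟨I', by simpa [LabelState] using hI', fun v hv => hs (hd v hv), fun v hv hdv => ?_⟩
      rcases Nat.lt_succ_iff_lt_or_eq.mp hv with h | h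
      · exact hs (hd' v h hdv)
      · have hvj : v = ⟨j, hj⟩ := Fin.ext h
        rw [← hvj] at hp'
        by_cases hr : v = P.root
        · exact hs (hr ▸ hI.1.root_mem)
        · exact hp' (hd _ (by have := P.parent_dist v hr; omega))
    · rintro τ₂ s₂ hf₂ ⟨I, hI, hd, hd'⟩
      refine ⟨I, by simpa [LabelState] using hI, fun v hv => hd' v (by rw [e0]; exact v.2) hv⟩
  · rintro τ₁ s₁ hf ⟨I, hI, hd⟩
    -- After n rounds everything is labelled, since a shortest path in the tree has fewer than n
    -- edges.
    have : I = Finset.univ := by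
      ext v
      simp only [Finset.mem_univ, iff_true]
      refine hd v ?_
      have := P.depth_lt v
      simp [h0]
      omega
    exact this ▸ hI.1

end LazyIncCuts

namespace LazyIncCuts

open RealRAM Finset

/-! ### Sorting the edges by capacity -/

/-- The rank of `e` in the order by `c`, with ties broken by the index. -/
noncomputable def edgeRank (c : ℕ → ℝ) (m e : ℕ) : ℕ :=
  #{f ∈ range m | c f < c e ∨ c f = c e ∧ f < e}

/-- `ord` enumerates the numbers below `m` in increasing order of `c`, and `rank` is inverse
to it. -/
structure SortedBy (c : ℕ → ℝ) (m : ℕ) (ord rank : ℕ → ℕ) : Prop where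
  ord_lt : ∀ i < m, ord i < m
  rank_ord : ∀ i < m, rank (ord i) = i
  rank_lt : ∀ e < m, rank e < m
  ord_rank : ∀ e < m, ord (rank e) = e
  mono : ∀ i j, i < j → j < m → c (ord i) ≤ c (ord j)

theorem edgeRank_lt {c : ℕ → ℝ} {m e : ℕ} (he : e < m) : edgeRank c m e < m := by
  have : #{f ∈ range m | c f < c e ∨ c f = c e ∧ f < e} < #(range m) := by
    refine card_lt_card (filter_ssubset.mpr ⟨e, by simpa using he, by simp⟩)
  simpa [edgeRank] using this

/-- Breaking ties by the index makes the order strict, so the rank is injective even if capacities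
coincide. -/
theorem edgeRank_lt_edgeRank {c : ℕ → ℝ} {m e f : ℕ} (he : e < m)
    (h : c e < c f ∨ c e = c f ∧ e < f) : edgeRank c m e < edgeRank c m f := by
  refine card_lt_card ⟨?_, fun hs => ?_⟩
  · intro g hg
    simp only [mem_filter] at hg ⊢
    refine ⟨hg.1, ?_⟩
    rcases hg.2 with h₁ | ⟨h₁, h₁'⟩ <;> rcases h with h₂ | ⟨h₂, h₂'⟩
    · exact Or.inl (h₁.trans h₂)
    · exact Or.inl (h₂ ▸ h₁)
    · exact Or.inl (h₁ ▸ h₂)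
    · exact Or.inr ⟨h₁.trans h₂, h₁'.trans h₂'⟩
  · have : e ∈ filter (fun g => c g < c e ∨ c g = c e ∧ g < e) (range m) :=
      hs (by simp only [mem_filter, mem_range]; exact ⟨he, h⟩)
    simp at this

/-- An injective map from `range m` to itself is onto, so a left inverse of the rank is a two-sided
inverse. -/
theorem sortedBy_of_edgeRank {c : ℕ → ℝ} {m : ℕ} {ord : ℕ → ℕ}
    (h : ∀ e < m, ord (edgeRank c m e) = e) : SortedBy c m ord (edgeRank c m) := by
  have hinj : Set.InjOn (edgeRank c m) (range m) := by
    intro a ha b hb hab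
    simp only [coe_range, Set.mem_Iio] at ha hb
    rw [← h a ha, ← h b hb, hab]
  have hsurj := surjOn_of_injOn_of_card_le (edgeRank c m) (s := range m) (t := range m)
    (fun e he => by simpa using edgeRank_lt (by simpa using he)) hinj le_rfl
  have hex : ∀ i < m, ∃ e < m, edgeRank c m e = i := by
    intro i hi
    obtain ⟨e, he, rfl⟩ := hsurj (by simpa using hi : i ∈ (range m : Set ℕ))
    exact ⟨e, by simpa using he, rfl⟩
  refine ⟨?_, ?_, fun e he => edgeRank_lt he, h, ?_⟩
  · intro i hi
    obtain ⟨e, he, rfl⟩ := hex i hi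
    rwa [h e he]
  · intro i hi
    obtain ⟨e, he, rfl⟩ := hex i hi
    rw [h e he]
  · intro i j hij hj
    obtain ⟨e, he, rfl⟩ := hex i (hij.trans hj)
    obtain ⟨f, hf, rfl⟩ := hex j hj
    rw [h e he, h f hf]
    by_contra hlt
    exact absurd (edgeRank_lt_edgeRank hf (Or.inl (not_le.mp hlt))) hij.not_gt

/-- Computes in the word array 7 the list of all edges in the order of their capacities. -/
def sortEdges : Cmd :=
  forLoop 14 1
    (Instr.nconst 16 0 ;; Instr.rload 2 0 14 ;;
      forLoop 15 1
        (Instr.rload 3 0 15 ;;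
          .cond (.rlt 3 2) (Instr.nop .add 16 16 7)
            (.cond (.rlt 2 3) .skip (.cond (.nlt 15 14) (Instr.nop .add 16 16 7) .skip))) ;;
      Instr.nstore 7 16 14)

theorem card_filter_range_succ (p : ℕ → Prop) [DecidablePred p] (j : ℕ) :
    #{f ∈ range (j + 1) | p f} = #{f ∈ range j | p f} + if p j then 1 else 0 := by
  rw [range_add_one, filter_insert]
  split
  · rw [card_insert_of_notMem (by simp)]
  · rfl

theorem wp_sortEdges {B m τ : ℕ} {s : Store} (h1 : s.nreg 1 = m) (h7 : s.nreg 7 = 1)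
    (hB : m + 1 ≤ B) :
    wp B sortEdges (fun _ s' => SortedBy (s.rarr 0) m (s'.narr 7) (edgeRank (s.rarr 0) m)) τ s := by
  refine wp_forLoop (fun j _ s₁ => ∀ e < j, s₁.narr 7 (edgeRank (s.rarr 0) m e) = e)
    (by decide) h7 (by omega) (by simp) ?_ ?_
  · intro j τ₁ s₁ hj hi hf hI
    rw [h1] at hj
    have e7 : s₁.nreg 7 = 1 := by rw [hf.nreg 7 (by decide), h7]
    have e1 : s₁.nreg 1 = m := by rw [hf.nreg 1 (by decide), h1]
    have e0 : s₁.rarr 0 = s.rarr 0 := hf.rarr 0 (by decide)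
    simp only [wp_seq, wp_instr, Instr.Fits, Instr.run]
    refine ⟨by omega, trivial, ?_⟩
    refine wp_forLoop (fun a _ s₂ => s₂.nreg 16 =
        #{f ∈ range a | s.rarr 0 f < s.rarr 0 j ∨ s.rarr 0 f = s.rarr 0 j ∧ f < j})
      (by decide) (by simp [e7]) (by simp [e1]; omega) (by simp) ?_ ?_
    · intro a τ₂ s₂ ha hi₂ hf₂ hI₂
      simp only [Store.setR_nreg, Store.setN_nreg] at ha
      norm_num [e1] at ha
      have f7 : s₂.nreg 7 = 1 := by rw [hf₂.nreg 7 (by decide)]; simp [e7]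
      have f14 : s₂.nreg 14 = j := by rw [hf₂.nreg 14 (by decide)]; simp [hi]
      have f0 : s₂.rarr 0 = s.rarr 0 := by rw [hf₂.rarr 0 (by decide)]; simp [e0]
      have f2 : s₂.rreg 2 = s.rarr 0 j := by rw [hf₂.rreg 2 (by decide)]; simp [hi, e0]
      have hle : s₂.nreg 16 ≤ a := by
        rw [hI₂]; simpa using card_filter_le (range a) _
      simp only [wp_seq, wp_instr, wp_cond, wp_skip, Instr.Fits, Instr.run, Test.Holds, NOp.eval,
        Store.setR_rreg, Store.setR_nreg, Store.setN_nreg, card_filter_range_succ, f7, f14, f0, f2,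
        hi₂]
      norm_num [f0, f2]
      refine ⟨fun h => ⟨by omega, ?_⟩, fun h => ⟨fun h' => ?_, fun h' =>
        ⟨fun h'' => ⟨by omega, ?_⟩, fun h'' => ?_⟩⟩⟩
      · rw [if_pos (Or.inl h), hI₂]
      · rw [if_neg (by rintro (h₁ | ⟨h₁, -⟩) <;> linarith), hI₂]; simp
      · rw [if_pos (Or.inr ⟨le_antisymm h' h, h''⟩), hI₂]
      · rw [if_neg (by rintro (h₁ | ⟨h₁, h₂⟩) <;> [linarith; omega]), hI₂]; simp
    · intro τ₂ s₂ hf₂ hI₂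
      have f14 : s₂.nreg 14 = j := by rw [hf₂.nreg 14 (by decide)]; simp [hi]
      have f7 : s₂.narr 7 = s₁.narr 7 := by rw [hf₂.narr 7 (by decide)]; simp
      have f16 : s₂.nreg 16 = edgeRank (s.rarr 0) m j := by
        rw [hI₂]; simp [edgeRank, e1]
      simp only [wp_instr, Instr.Fits, Instr.run, true_and, Store.setN_narr, Store.putN_narr,
        if_true, f14, f7, f16]
      intro e he
      rcases Nat.lt_succ_iff_lt_or_eq.mp he with h | rfl
      · rw [Function.update_of_ne, hI e h]
        rcases lt_trichotomy (s.rarr 0 e) (s.rarr 0 j) with h' | h' | h'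
        · exact (edgeRank_lt_edgeRank (h.trans hj) (Or.inl h')).ne
        · exact (edgeRank_lt_edgeRank (h.trans hj) (Or.inr ⟨h', h⟩)).ne
        · exact (edgeRank_lt_edgeRank hj (Or.inl h')).ne'
      · simp
  · intro τ₁ s₁ hf hI
    exact sortedBy_of_edgeRank (by rwa [h1] at hI)

/-! ### Rounded capacities -/

/-- `thr` is a rounding of `c / D` whose distinct values differ by factors of at least two. -/
structure Thresholds (c thr : ℕ → ℝ) (m : ℕ) (ord : ℕ → ℕ) (D cmax : ℝ) : Prop where
  pos : ∀ i < m, 0 < thr (ord i)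
  mul_le : ∀ i < m, thr (ord i) * D ≤ c (ord i)
  lt_mul : ∀ i < m, c (ord i) < 2 * (thr (ord i) * D)
  gap : ∀ i j, i < j → j < m → thr (ord i) = thr (ord j) ∨ 2 * thr (ord i) ≤ thr (ord j)
  le_max : ∀ i < m, c (ord i) ≤ cmax
  max_nonneg : 0 ≤ cmax

/-- Computes in the real array 3 the thresholds of all edges, and in the real register 1 the
maximum capacity. -/
def thresholds : Cmd :=
  Instr.rcast 4 10 ;; Instr.rop .mul 4 4 4 ;; Instr.rcast 5 8 ;; Instr.rcast 6 9 ;;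
  Instr.rcast 1 9 ;;
  forLoop 14 1
    (Instr.nload 15 7 14 ;; Instr.rload 1 0 15 ;; Instr.rop .mul 7 5 6 ;;
      .cond (.rle 7 1) (Instr.rmove 6 1) .skip ;;
      Instr.rop .div 8 6 4 ;; Instr.rstore 3 15 8)

/-- Greedy rounding, which uses comparisons only. Capacities arrive in increasing order, and the
current leader serves as rounded value until some capacity is at least twice as large and becomes
the new leader. Each capacity is then within a factor two of its leader, and successive leaders at
least double. -/
theorem Thresholds.extend {c thr thr' : ℕ → ℝ} {m j : ℕ} {ord rank : ℕ → ℕ}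
    {D cmax lead lead' : ℝ} (hs : SortedBy c m ord rank) (hj : j < m) (hD : 0 < D)
    (hc : ∀ e < m, 0 < c e) (h : Thresholds c thr j ord D cmax)
    (hl : ∀ i < j, thr (ord i) = lead / D ∨ 2 * thr (ord i) ≤ lead / D)
    (hlm : lead ≤ cmax) (hm : ∀ i, j ≤ i → i < m → cmax ≤ c (ord i))
    (hl' : lead' = if 2 * lead ≤ c (ord j) then c (ord j) else lead)
    (ht : thr' = Function.update thr (ord j) (lead' / D)) :
    Thresholds c thr' (j + 1) ord D (c (ord j)) ∧
    (∀ i < j + 1, thr' (ord i) = lead' / D ∨ 2 * thr' (ord i) ≤ lead' / D) ∧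
    lead' ≤ c (ord j) ∧ ∀ i, j + 1 ≤ i → i < m → c (ord j) ≤ c (ord i) := by
  have hcj : 0 < c (ord j) := hc _ (hs.ord_lt j hj)
  have hlc : lead ≤ c (ord j) := hlm.trans (hm j le_rfl hj)
  have ho : ∀ i < j, thr' (ord i) = thr (ord i) := by
    intro i hi
    rw [ht, Function.update_of_ne]
    intro he
    have := hs.rank_ord i (hi.trans hj)
    rw [he, hs.rank_ord j hj] at this
    omega
  have hn : thr' (ord j) = lead' / D := by rw [ht]; simp
  have hle' : lead ≤ lead' := by rw [hl']; split <;> linarith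
  have hl'c : lead' ≤ c (ord j) := by rw [hl']; split <;> linarith
  have hl'c2 : c (ord j) < 2 * lead' := by rw [hl']; split <;> linarith
  have hl0 : 0 < lead' := by linarith
  have hdiv : lead' / D * D = lead' := div_mul_cancel₀ _ hD.ne'
  -- If the leader changes, it at least doubles, so every older threshold, being at most the old
  -- one, is at most half of the new one.
  have hgap : ∀ i < j, thr (ord i) = lead' / D ∨ 2 * thr (ord i) ≤ lead' / D := by
    intro i hi
    rw [hl']
    split
    · rename_i h2
      right
      rcases hl i hi with h' | h'
      · rw [h', ← mul_div_assoc]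
        exact div_le_div_of_nonneg_right h2 hD.le
      · exact h'.trans (div_le_div_of_nonneg_right hlc hD.le)
    · exact hl i hi
  have hcase : ∀ {p : ℕ → Prop}, (∀ i < j, p i) → p j → ∀ i < j + 1, p i := by
    intro p h₁ h₂ i hi
    rcases Nat.lt_succ_iff_lt_or_eq.mp hi with h | rfl
    · exact h₁ i h
    · exact h₂
  refine ⟨⟨?_, ?_, ?_, ?_, ?_, hcj.le⟩, ?_, hl'c, fun i hi him => hs.mono j i hi him⟩
  · exact hcase (fun i hi => by rw [ho i hi]; exact h.pos i hi) (by rw [hn]; positivity)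
  · exact hcase (fun i hi => by rw [ho i hi]; exact h.mul_le i hi) (by rw [hn, hdiv]; exact hl'c)
  · exact hcase (fun i hi => by rw [ho i hi]; exact h.lt_mul i hi) (by rw [hn, hdiv]; exact hl'c2)
  · intro a b hab hb
    rcases Nat.lt_succ_iff_lt_or_eq.mp hb with hb | rfl
    · rw [ho a (hab.trans hb), ho b hb]; exact h.gap a b hab hb
    · rw [ho a hab, hn]; exact hgap a hab
  · exact hcase (fun i hi => hs.mono i j hi hj) le_rfl
  · exact hcase (fun i hi => by rw [ho i hi]; exact hgap i hi) (Or.inl hn)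

theorem wp_thresholds {B m τ : ℕ} {s : Store} {rank : ℕ → ℕ} (h1 : s.nreg 1 = m)
    (h7 : s.nreg 7 = 1) (h8 : s.nreg 8 = 2) (h9 : s.nreg 9 = 0) (hH : 1 ≤ s.nreg 10)
    (hc : ∀ e < m, 0 < s.rarr 0 e) (hs : SortedBy (s.rarr 0) m (s.narr 7) rank) (hB : m + 1 ≤ B) :
    wp B thresholds (fun _ s' => Thresholds (s.rarr 0) (s'.rarr 3) m (s.narr 7)
      ((s.nreg 10 : ℝ) ^ 2) (s'.rreg 1)) τ s := by
  have hD : (0 : ℝ) < (s.nreg 10 : ℝ) ^ 2 := by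
    have : (0 : ℝ) < s.nreg 10 := by exact_mod_cast hH
    positivity
  simp only [thresholds, wp_seq, wp_instr, Instr.Fits, Instr.run, true_and, ROp.eval]
  refine wp_forLoop (fun j _ s₁ =>
      Thresholds (s.rarr 0) (s₁.rarr 3) j (s.narr 7) ((s.nreg 10 : ℝ) ^ 2) (s₁.rreg 1) ∧
      (∀ i < j, s₁.rarr 3 (s.narr 7 i) = s₁.rreg 6 / (s.nreg 10 : ℝ) ^ 2 ∨
        2 * s₁.rarr 3 (s.narr 7 i) ≤ s₁.rreg 6 / (s.nreg 10 : ℝ) ^ 2) ∧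
      s₁.rreg 6 ≤ s₁.rreg 1 ∧
      ∀ i, j ≤ i → i < m → s₁.rreg 1 ≤ s.rarr 0 (s.narr 7 i))
    (by decide) (by simp [h7]) (by simp [h1]; omega) ?_ ?_ ?_
  · simp only [Store.setN_rreg, Store.setR_rreg]
    norm_num [h9]
    -- The leader starts at 0, so the first edge passes the test 2 · 0 ≤ c and becomes a leader.
    exact ⟨⟨by simp, by simp, by simp, by simp, by simp, le_rfl⟩,
      fun i hi => (hc _ (hs.ord_lt i hi)).le⟩
  · rintro j τ₁ s₁ hj hi hf ⟨hT, hl, hlm, hm⟩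
    have hj : j < m := by simpa [h1] using hj
    have e7 : s₁.narr 7 = s.narr 7 := by rw [hf.narr 7 (by decide)]; simp
    have e0 : s₁.rarr 0 = s.rarr 0 := by rw [hf.rarr 0 (by decide)]; simp
    have e4 : s₁.rreg 4 = (s.nreg 10 : ℝ) ^ 2 := by
      rw [hf.rreg 4 (by decide)]; simp [sq]
    have e5 : s₁.rreg 5 = 2 := by
      rw [hf.rreg 5 (by decide)]; simp [h8]
    have ext := hT.extend hs hj hD hc hl hlm hm rfl rfl
    simp only [wp_seq, wp_instr, wp_cond, wp_skip, Instr.Fits, Instr.run, Test.Holds, ROp.eval,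
      true_and, Store.setN_nreg, Store.setN_rreg, Store.setN_rarr, Store.setR_rreg, Store.setR_rarr,
      Store.setR_nreg, Store.putR_rreg, Store.putR_rarr, e7, e0, e4, e5, hi]
    norm_num [e7, e0, e4, e5, -Order.lt_add_one_iff, -Order.add_one_le_iff]
    refine ⟨fun h => ?_, fun h => ?_⟩
    · rw [if_pos h] at ext
      exact ⟨ext.1, ext.2.1, ext.2.2.2⟩
    · rw [if_neg (not_le.mpr h)] at ext
      exact ext
  · rintro τ₁ s₁ hf ⟨hT, -⟩
    simpa [h1] using hT

end LazyIncCuts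

namespace LazyIncCuts

open RealRAM Finset

/-! ### The table of canonical cuts -/

/-- The position `p` lies in the dyadic interval with the number `I = k n + j`, which is
`[j 2 ^ k, (j + 1) 2 ^ k)`. -/
def InNode (n p I : ℕ) : Prop := p / 2 ^ (I / n) = I % n

/-- An edge with end points at `p` and `q` joins the two dyadic intervals whose numbers are
encoded in `S`. -/
def Joins (n M p q S : ℕ) : Prop :=
  (InNode n p (S / M) ∧ InNode n q (S % M)) ∨ (InNode n q (S / M) ∧ InNode n p (S % M))

instance (n p I : ℕ) : Decidable (InNode n p I) := by unfold InNode; infer_instance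

instance (n M p q S : ℕ) : Decidable (Joins n M p q S) := by unfold Joins; infer_instance

/-- The entries `N₀, …, N - 1` list the members of the class `S` that have rank below `i`, in
the order of their ranks. -/
structure Segment (mem : ℕ → ℕ → Prop) [∀ e S, Decidable (mem e S)] (rank : ℕ → ℕ)
    (m S i N₀ N : ℕ) (E Sg : ℕ → ℕ) : Prop where
  le : N₀ ≤ N
  spec : ∀ k, N₀ ≤ k → k < N → Sg k = S ∧ E k < m ∧ mem (E k) S ∧ rank (E k) < i
  sorted : ∀ k, N₀ ≤ k → k + 1 < N → rank (E k) < rank (E (k + 1))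
  count : ∀ e < m, ∑ k ∈ Ico N₀ N, (if E k = e then (1 : ℝ) else 0) =
    if rank e < i ∧ mem e S then 1 else 0

/-- The table of the members of the classes below `L`: the members of `S` are the entries
`E k` with `st S ≤ k < st (S + 1)`. -/
structure Entries (mem : ℕ → ℕ → Prop) [∀ e S, Decidable (mem e S)] (rank : ℕ → ℕ)
    (m L N : ℕ) (st E Sg : ℕ → ℕ) : Prop where
  st_last : st L = N
  st_le : ∀ S < L, st S ≤ st (S + 1)
  st_le_last : ∀ S ≤ L, st S ≤ N
  seg : ∀ S < L, ∀ k, st S ≤ k → k < st (S + 1) → Sg k = S ∧ mem (E k) S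
  sorted : ∀ S < L, ∀ k, st S ≤ k → k + 1 < st (S + 1) → rank (E k) < rank (E (k + 1))
  cover : ∀ k < N, Sg k < L ∧ st (Sg k) ≤ k ∧ k < st (Sg k + 1) ∧ E k < m
  sum : ∀ e < m, ∀ f : ℕ → ℝ, ∑ k ∈ range N, (if E k = e then f (Sg k) else 0) =
    ∑ S ∈ range L, if mem e S then f S else 0

section

variable {mem : ℕ → ℕ → Prop} [∀ e S, Decidable (mem e S)] {rank ord : ℕ → ℕ} {c : ℕ → ℝ}
  {m S i N₀ N : ℕ} {st E Sg : ℕ → ℕ}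

theorem Segment.nil : Segment mem rank m S 0 N₀ N₀ E Sg :=
  ⟨le_rfl, by intros; omega, by intros; omega, by simp⟩

theorem Segment.skip (h : Segment mem rank m S i N₀ N E Sg) (hs : SortedBy c m ord rank)
    (hm : ¬ mem (ord i) S) : Segment mem rank m S (i + 1) N₀ N E Sg := by
  refine ⟨h.le, fun k h₁ h₂ => ?_, h.sorted, fun e he => ?_⟩
  · have := h.spec k h₁ h₂
    exact ⟨this.1, this.2.1, this.2.2.1, by omega⟩
  · rw [h.count e he]
    refine if_congr ?_ rfl rfl
    by_cases hr : rank e = i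
    · have : e = ord i := by rw [← hr, hs.ord_rank e he]
      subst this
      simp [hm]
    · have : rank e < i ↔ rank e < i + 1 := by omega
      rw [this]

theorem Segment.append (h : Segment mem rank m S i N₀ N E Sg) (hs : SortedBy c m ord rank)
    (hi : i < m) (hm : mem (ord i) S) :
    Segment mem rank m S (i + 1) N₀ (N + 1) (Function.update E N (ord i))
      (Function.update Sg N S) := by
  have hr := hs.rank_ord i hi
  refine ⟨h.le.trans (by omega), fun k h₁ h₂ => ?_, fun k h₁ h₂ => ?_, fun e he => ?_⟩
  · by_cases hk : k = N
    · subst hk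
      simp [hs.ord_lt i hi, hm, hr]
    · have := h.spec k h₁ (by omega)
      rw [Function.update_of_ne hk, Function.update_of_ne hk]
      exact ⟨this.1, this.2.1, this.2.2.1, by omega⟩
  · rw [Function.update_of_ne (by omega)]
    by_cases hk : k + 1 = N
    · subst hk
      simp only [Function.update_self, hr]
      exact (h.spec k h₁ (by omega)).2.2.2
    · rw [Function.update_of_ne hk]
      exact h.sorted k h₁ (by omega)
  · rw [sum_Ico_succ_top h.le]
    have : ∑ k ∈ Ico N₀ N, (if Function.update E N (ord i) k = e then (1 : ℝ) else 0) =
        ∑ k ∈ Ico N₀ N, (if E k = e then (1 : ℝ) else 0) := by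
      refine sum_congr rfl fun k hk => ?_
      rw [Function.update_of_ne (by simp at hk; omega)]
    rw [this, h.count e he, Function.update_self]
    by_cases hre : rank e = i
    · have : e = ord i := by rw [← hre, hs.ord_rank e he]
      subst this
      simp [hm, hr]
    · have h₁ : ord i ≠ e := fun h' => hre (by rw [← h', hr])
      have h₂ : rank e < i ↔ rank e < i + 1 := by omega
      simp [h₁, h₂]

theorem Entries.nil (h : st 0 = 0) : Entries mem rank m 0 0 st E Sg :=
  ⟨h, by simp, by simp [h], by simp, by simp, by simp, by simp⟩

theorem Entries.congr {E' Sg' : ℕ → ℕ} (h : Entries mem rank m S N st E Sg)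
    (hE : ∀ k < N, E' k = E k) (hS : ∀ k < N, Sg' k = Sg k) :
    Entries mem rank m S N st E' Sg' := by
  refine ⟨h.st_last, h.st_le, h.st_le_last, fun S' hS' k h₁ h₂ => ?_, fun S' hS' k h₁ h₂ => ?_,
    fun k hk => ?_, fun e he f => ?_⟩
  · have := h.st_le_last (S' + 1) hS'
    rw [hE k (by omega), hS k (by omega)]
    exact h.seg S' hS' k h₁ h₂
  · have := h.st_le_last (S' + 1) hS'
    rw [hE k (by omega), hE (k + 1) (by omega)]
    exact h.sorted S' hS' k h₁ h₂
  · rw [hE k hk, hS k hk]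
    exact h.cover k hk
  · rw [← h.sum e he f]
    refine sum_congr rfl fun k hk => ?_
    rw [mem_range] at hk
    rw [hE k hk, hS k hk]

/-- Lists are stored one after the other, so closing the list of `S` only sets the start of the list
of `S + 1`. The double-counting identity `sum` splits off the new segment, on which the class is
constantly `S`. -/
theorem Entries.extend (h : Entries mem rank m S N₀ st E Sg) (hs : SortedBy c m ord rank)
    (hseg : Segment mem rank m S m N₀ N E Sg) :
    Entries mem rank m (S + 1) N (Function.update st (S + 1) N) E Sg := by
  have ho : ∀ S' ≤ S, Function.update st (S + 1) N S' = st S' := fun S' h' =>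
    Function.update_of_ne (by omega) _ _
  have hn : Function.update st (S + 1) N (S + 1) = N := by simp
  refine ⟨hn, fun S' hS' => ?_, fun S' hS' => ?_, fun S' hS' k h₁ h₂ => ?_,
    fun S' hS' k h₁ h₂ => ?_, fun k hk => ?_, fun e he f => ?_⟩
  · rcases Nat.lt_succ_iff_lt_or_eq.mp hS' with h' | rfl
    · rw [ho S' h'.le, ho (S' + 1) h']
      exact h.st_le S' h'
    · rw [ho S' le_rfl, hn, h.st_last]
      exact hseg.le
  · rcases hS'.lt_or_eq with h' | rfl
    · rw [ho S' (by omega)]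
      exact (h.st_le_last S' (by omega)).trans hseg.le
    · rw [hn]
  · rcases Nat.lt_succ_iff_lt_or_eq.mp hS' with h' | rfl
    · rw [ho S' h'.le] at h₁
      rw [ho (S' + 1) h'] at h₂
      exact h.seg S' h' k h₁ h₂
    · rw [ho S' le_rfl, h.st_last] at h₁
      rw [hn] at h₂
      have := hseg.spec k h₁ h₂
      exact ⟨this.1, this.2.2.1⟩
  · rcases Nat.lt_succ_iff_lt_or_eq.mp hS' with h' | rfl
    · rw [ho S' h'.le] at h₁
      rw [ho (S' + 1) h'] at h₂
      exact h.sorted S' h' k h₁ h₂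
    · rw [ho S' le_rfl, h.st_last] at h₁
      rw [hn] at h₂
      exact hseg.sorted k h₁ h₂
  · by_cases hk' : k < N₀
    · have := h.cover k hk'
      rw [ho _ this.1.le, ho (Sg k + 1) this.1]
      exact ⟨by omega, this.2⟩
    · have := hseg.spec k (by omega) hk
      rw [this.1, ho S le_rfl, hn, h.st_last]
      exact ⟨by omega, by omega, hk, this.2.1⟩
  · rw [sum_range_succ, ← h.sum e he f, range_eq_Ico,
      ← sum_Ico_consecutive _ (Nat.zero_le _) hseg.le, ← range_eq_Ico]
    congr 1
    have : ∑ k ∈ Ico N₀ N, (if E k = e then f (Sg k) else 0) =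
        ∑ k ∈ Ico N₀ N, f S * (if E k = e then (1 : ℝ) else 0) := by
      refine sum_congr rfl fun k hk => ?_
      rw [mem_Ico] at hk
      rw [(hseg.spec k hk.1 hk.2).1]
      simp
    rw [this, ← mul_sum, hseg.count e he]
    simp [hs.rank_lt e he]

end

/-- Decides in the word register 29 whether the edge in the word register 22 joins the two dyadic
intervals described by the word registers 18, 19 and 20, 21. -/
def testJoins : Cmd :=
  Instr.nload 23 0 22 ;; Instr.nload 23 4 23 ;; Instr.nload 24 1 22 ;; Instr.nload 24 4 24 ;;
  Instr.nop .div 25 23 18 ;; Instr.nop .div 26 24 20 ;;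
  Instr.nop .div 27 24 18 ;; Instr.nop .div 28 23 20 ;; Instr.nconst 29 0 ;;
  .cond (.neq 25 19) (.cond (.neq 26 21) (Instr.nconst 29 1) .skip) .skip ;;
  .cond (.neq 27 19) (.cond (.neq 28 21) (Instr.nconst 29 1) .skip) .skip

/-- Builds the table of canonical cuts in the word arrays 9, 10, 11; their total size is left in
the word register 13. -/
def buildTable : Cmd :=
  Instr.nconst 13 0 ;;
  forLoop 14 12
    (Instr.nop .div 16 14 11 ;; Instr.nop .mod 17 14 11 ;;
      Instr.nop .div 18 16 0 ;; Instr.nload 18 8 18 ;; Instr.nop .mod 19 16 0 ;;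
      Instr.nop .div 20 17 0 ;; Instr.nload 20 8 20 ;; Instr.nop .mod 21 17 0 ;;
      forLoop 15 1
        (Instr.nload 22 7 15 ;; testJoins ;;
          .cond (.neq 29 7)
            (Instr.nstore 10 13 22 ;; Instr.nstore 11 13 14 ;; Instr.nop .add 13 13 7) .skip) ;;
      Instr.nop .add 16 14 7 ;; Instr.nstore 9 16 13)

theorem wp_testJoins {B n τ p q : ℕ} {s : Store} {I J : ℕ}
    (hp : s.narr 4 (s.narr 0 (s.nreg 22)) = p) (hq : s.narr 4 (s.narr 1 (s.nreg 22)) = q)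
    (h18 : s.nreg 18 = 2 ^ (I / n)) (h19 : s.nreg 19 = I % n) (h20 : s.nreg 20 = 2 ^ (J / n))
    (h21 : s.nreg 21 = J % n) (hpB : p ≤ B) (hqB : q ≤ B) (hB : 1 ≤ B) :
    wp B testJoins (fun _ s' => s'.nreg 29 =
      if (InNode n p I ∧ InNode n q J) ∨ (InNode n q I ∧ InNode n p J) then 1 else 0) τ s := by
  simp only [testJoins, wp_seq, wp_instr, wp_cond, wp_skip, Instr.Fits, Instr.run, Test.Holds,
    NOp.eval, Store.setN_nreg, Store.setN_narr]
  norm_num [hp, hq, h18, h19, h20, h21]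
  have hd : ∀ x y, x ≤ B → x / y ≤ B := fun x y h => (Nat.div_le_self _ _).trans h
  refine ⟨hd _ _ hpB, hd _ _ hqB, hd _ _ hqB, hd _ _ hpB, ?_⟩
  simp only [← InNode.eq_1]
  by_cases h₁ : InNode n p I <;> by_cases h₂ : InNode n q J <;> by_cases h₃ : InNode n q I <;>
    by_cases h₄ : InNode n p J <;> simp [h₁, h₂, h₃, h₄, hB]

theorem wp_buildTable {B n m H M τ : ℕ} {s : Store} {rank : ℕ → ℕ} {c : ℕ → ℝ}
    (h0 : s.nreg 0 = n) (h1 : s.nreg 1 = m) (h7 : s.nreg 7 = 1) (h11 : s.nreg 11 = M)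
    (h12 : s.nreg 12 = M * M) (hM : M = H * n) (hn : 0 < n) (hm : 0 < M)
    (hpw : ∀ k < H, s.narr 8 k = 2 ^ k) (hs : SortedBy c m (s.narr 7) rank)
    (hp : ∀ e < m, s.narr 4 (s.narr 0 e) ≤ B) (hq : ∀ e < m, s.narr 4 (s.narr 1 e) ≤ B)
    (hz : s.narr 9 0 = 0) (hB : (M * M + 1) * (m + 1) ≤ B) :
    wp B buildTable (fun _ s' => Entries (fun e S => Joins n M (s.narr 4 (s.narr 0 e))
      (s.narr 4 (s.narr 1 e)) S) rank m (M * M) (s'.nreg 13) (s'.narr 9) (s'.narr 10)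
      (s'.narr 11)) τ s := by
  have hmB : m + 1 ≤ B := le_trans (Nat.le_mul_of_pos_left _ (by omega)) hB
  have hMB : M * M + 1 ≤ B := le_trans (Nat.le_mul_of_pos_right _ (by omega)) hB
  have hdiv : ∀ I < M, I / n < H := fun I hI => by
    rw [Nat.div_lt_iff_lt_mul hn]; exact hM ▸ hI
  set mem : ℕ → ℕ → Prop := fun e S => Joins n M (s.narr 4 (s.narr 0 e))
      (s.narr 4 (s.narr 1 e)) S with hmem
  rw [buildTable, wp_seq, wp_instr]
  refine ⟨Nat.zero_le _, ?_⟩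
  simp only [Instr.run]
  refine wp_forLoop (fun S _ s₁ => s₁.nreg 13 ≤ S * m ∧
      Entries mem rank m S (s₁.nreg 13) (s₁.narr 9) (s₁.narr 10) (s₁.narr 11))
    (by decide) (by simp [h7]) (by simp [h12]; omega) ?_ ?_ ?_
  · simpa using Entries.nil (by simpa using hz)
  · rintro S τ₁ s₁ hS hi hf ⟨hN, hE⟩
    have hS : S < M * M := by simpa [h12] using hS
    have e0 : s₁.nreg 0 = n := by rw [hf.nreg 0 (by decide)]; simp [h0]
    have e1 : s₁.nreg 1 = m := by rw [hf.nreg 1 (by decide)]; simp [h1]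
    have e7 : s₁.nreg 7 = 1 := by rw [hf.nreg 7 (by decide)]; simp [h7]
    have e11 : s₁.nreg 11 = M := by rw [hf.nreg 11 (by decide)]; simp [h11]
    have ea0 : s₁.narr 0 = s.narr 0 := by rw [hf.narr 0 (by decide)]; simp
    have ea1 : s₁.narr 1 = s.narr 1 := by rw [hf.narr 1 (by decide)]; simp
    have ea4 : s₁.narr 4 = s.narr 4 := by rw [hf.narr 4 (by decide)]; simp
    have ea7 : s₁.narr 7 = s.narr 7 := by rw [hf.narr 7 (by decide)]; simp
    have ea8 : s₁.narr 8 = s.narr 8 := by rw [hf.narr 8 (by decide)]; simp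
    have hI : S / M < M := (Nat.div_lt_iff_lt_mul hm).mpr hS
    have hJ : S % M < M := Nat.mod_lt _ hm
    have hd₁ : S / M / n ≤ S := (Nat.div_le_self _ _).trans (Nat.div_le_self _ _)
    have hd₂ : S % M / n ≤ S := (Nat.div_le_self _ _).trans (Nat.mod_le _ _)
    have hd₃ : S / M % n ≤ S := (Nat.mod_le _ _).trans (Nat.div_le_self _ _)
    have hd₄ : S % M % n ≤ S := (Nat.mod_le _ _).trans (Nat.mod_le _ _)
    have hd₅ : S / M ≤ S := Nat.div_le_self _ _
    have hd₆ : S % M ≤ S := Nat.mod_le _ _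
    simp only [wp_seq, wp_instr, Instr.Fits, Instr.run, NOp.eval, Store.setN_nreg,
      Store.setN_narr, Nat.reduceEqDiff, reduceIte, e0, e11, hi, ea8, true_and]
    refine ⟨by omega, by omega, by omega, by omega, by omega, by omega, ?_⟩
    have hSm : (S + 1) * (m + 1) ≤ B := (Nat.mul_le_mul_right _ (by omega)).trans hB
    refine wp_forLoop (fun i _ s₂ => s₂.nreg 13 ≤ S * m + i ∧
        (∀ k < s₁.nreg 13, s₂.narr 10 k = s₁.narr 10 k) ∧
        (∀ k < s₁.nreg 13, s₂.narr 11 k = s₁.narr 11 k) ∧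
        Segment mem rank m S i (s₁.nreg 13) (s₂.nreg 13) (s₂.narr 10) (s₂.narr 11))
      (by decide) (by simp [e7]) (by simp [e1]; omega) ?_ ?_ ?_
    · simpa [hN] using Segment.nil
    · rintro i τ₂ s₂ hi₂ hi₂' hf₂ ⟨hN₂, hk₁, hk₂, hseg⟩
      have hi₂ : i < m := by simpa [e1] using hi₂
      have f7 : s₂.nreg 7 = 1 := by rw [hf₂.nreg 7 (by decide)]; simp [e7]
      have f14 : s₂.nreg 14 = S := by rw [hf₂.nreg 14 (by decide)]; simp [hi]
      have f18 : s₂.nreg 18 = 2 ^ (S / M / n) := by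
        rw [hf₂.nreg 18 (by decide)]; simp [hpw _ (hdiv _ hI)]
      have f19 : s₂.nreg 19 = S / M % n := by rw [hf₂.nreg 19 (by decide)]; simp
      have f20 : s₂.nreg 20 = 2 ^ (S % M / n) := by
        rw [hf₂.nreg 20 (by decide)]; simp [hpw _ (hdiv _ hJ)]
      have f21 : s₂.nreg 21 = S % M % n := by rw [hf₂.nreg 21 (by decide)]; simp
      have fa0 : s₂.narr 0 = s.narr 0 := by rw [hf₂.narr 0 (by decide)]; simp [ea0]
      have fa1 : s₂.narr 1 = s.narr 1 := by rw [hf₂.narr 1 (by decide)]; simp [ea1]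
      have fa4 : s₂.narr 4 = s.narr 4 := by rw [hf₂.narr 4 (by decide)]; simp [ea4]
      have fa7 : s₂.narr 7 = s.narr 7 := by rw [hf₂.narr 7 (by decide)]; simp [ea7]
      have hol := hs.ord_lt i hi₂
      simp only [wp_seq, wp_instr, Instr.Fits, Instr.run, true_and, hi₂', fa7]
      refine (wp_testJoins (n := n) (I := S / M) (J := S % M)
        (p := s.narr 4 (s.narr 0 (s.narr 7 i))) (q := s.narr 4 (s.narr 1 (s.narr 7 i)))
        (by simp [fa4, fa0]) (by simp [fa4, fa1]) (by simp [f18]) (by simp [f19]) (by simp [f20])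
        (by simp [f21]) (hp _ hol) (hq _ hol) (by omega)).mono ?_
      intro τ₃ s₃ hf₃ h29
      have g7 : s₃.nreg 7 = 1 := by rw [hf₃.nreg 7 (by decide)]; simp [f7]
      have g13 : s₃.nreg 13 = s₂.nreg 13 := by rw [hf₃.nreg 13 (by decide)]; simp
      have g14 : s₃.nreg 14 = S := by rw [hf₃.nreg 14 (by decide)]; simp [f14]
      have g22 : s₃.nreg 22 = s.narr 7 i := by rw [hf₃.nreg 22 (by decide)]; simp
      have ga10 : s₃.narr 10 = s₂.narr 10 := by rw [hf₃.narr 10 (by decide)]; simp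
      have ga11 : s₃.narr 11 = s₂.narr 11 := by rw [hf₃.narr 11 (by decide)]; simp
      have hdef : (if (InNode n (s.narr 4 (s.narr 0 (s.narr 7 i))) (S / M) ∧
            InNode n (s.narr 4 (s.narr 1 (s.narr 7 i))) (S % M)) ∨
          (InNode n (s.narr 4 (s.narr 1 (s.narr 7 i))) (S / M) ∧
            InNode n (s.narr 4 (s.narr 0 (s.narr 7 i))) (S % M)) then 1 else 0) =
          if mem (s.narr 7 i) S then 1 else 0 := by
        simp only [hmem, Joins]
      rw [hdef] at h29
      simp only [wp_seq, wp_instr, wp_cond, wp_skip, Instr.Fits, Instr.run, true_and, NOp.eval,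
        Test.Holds, Store.setN_nreg, Store.setN_narr, Store.putN_nreg, Store.putN_narr,
        Nat.reduceEqDiff, reduceIte, g7, g13, g14, g22, ga10, ga11]
      have hSm' : (S + 1) * (m + 1) = S * m + S + m + 1 := by ring
      have hle := hseg.le
      refine ⟨fun h => ⟨by omega, by omega, fun k hk => ?_, fun k hk => ?_, ?_⟩,
        fun h => ⟨by omega, hk₁, hk₂, ?_⟩⟩
      · rw [Function.update_of_ne (by omega), hk₁ k hk]
      · rw [Function.update_of_ne (by omega), hk₂ k hk]
      · refine hseg.append hs hi₂ ?_
        by_contra hc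
        rw [h29, if_neg hc] at h
        omega
      · refine hseg.skip hs fun hc => h ?_
        rw [h29, if_pos hc]
    · rintro τ₂ s₂ hf₂ ⟨hN₂, hk₁, hk₂, hseg⟩
      have f7 : s₂.nreg 7 = 1 := by rw [hf₂.nreg 7 (by decide)]; simp [e7]
      have f14 : s₂.nreg 14 = S := by rw [hf₂.nreg 14 (by decide)]; simp [hi]
      have fa9 : s₂.narr 9 = s₁.narr 9 := by rw [hf₂.narr 9 (by decide)]; simp
      simp only [Store.setN_nreg, Nat.reduceEqDiff, reduceIte, e1] at hN₂ hseg
      simp only [wp_seq, wp_instr, Instr.Fits, Instr.run, true_and, NOp.eval,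
        Store.setN_nreg, Store.setN_narr, Store.putN_nreg, Store.putN_narr,
        Nat.reduceEqDiff, reduceIte, f7, f14, fa9]
      refine ⟨by omega, by rw [Nat.succ_mul]; exact hN₂, (hE.congr hk₁ hk₂).extend hs hseg⟩
  · rintro τ₁ s₁ hf ⟨-, hE⟩
    simpa [h12] using hE

end LazyIncCuts

namespace LazyIncCuts

open RealRAM Finset

/-! ### The static part of the data structure -/

/-- The part of the store that the initialization computes and that no later call changes. -/
structure Tab where
  n : ℕ
  m : ℕ
  one : ℕ
  two : ℕ
  zero : ℕ
  H : ℕ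
  M : ℕ
  N : ℕ
  src : ℕ → ℕ
  dst : ℕ → ℕ
  tin : ℕ → ℕ
  tout : ℕ → ℕ
  ord : ℕ → ℕ
  st : ℕ → ℕ
  ent : ℕ → ℕ
  seg : ℕ → ℕ
  ε : ℝ
  cmax : ℝ
  cap : ℕ → ℝ
  thr : ℕ → ℝ

def view (s : Store) : Tab where
  n := s.nreg 0
  m := s.nreg 1
  one := s.nreg 7
  two := s.nreg 8
  zero := s.nreg 9
  H := s.nreg 10
  M := s.nreg 11
  N := s.nreg 13
  src := s.narr 0
  dst := s.narr 1
  tin := s.narr 4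
  tout := s.narr 5
  ord := s.narr 7
  st := s.narr 9
  ent := s.narr 10
  seg := s.narr 11
  ε := s.rreg 0
  cmax := s.rreg 1
  cap := s.rarr 0
  thr := s.rarr 3

namespace Tab

/-- The edge `e` belongs to the canonical cut `S`. -/
def Mem (T : Tab) (e S : ℕ) : Prop := Joins T.n T.M (T.tin (T.src e)) (T.tin (T.dst e)) S

instance (T : Tab) (e S : ℕ) : Decidable (T.Mem e S) := by unfold Mem; infer_instance

structure Ok (P : Input) (T : Tab) : Prop where
  n_eq : T.n = P.n
  m_eq : T.m = P.m
  one_eq : T.one = 1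
  two_eq : T.two = 2
  zero_eq : T.zero = 0
  H_pos : 1 ≤ T.H
  lt_H_iff : ∀ k, k < T.H ↔ 2 ^ k ≤ P.n
  M_eq : T.M = T.H * P.n
  src_eq : ∀ i : Fin P.m, T.src i = P.src i
  dst_eq : ∀ i : Fin P.m, T.dst i = P.dst i
  cap_eq : ∀ i : Fin P.m, T.cap i = P.cap i
  ε_eq : T.ε = P.ε
  labels : Labels P univ T.tin T.tout
  sorted : SortedBy T.cap P.m T.ord (edgeRank T.cap P.m)
  thresholds : Thresholds T.cap T.thr P.m T.ord ((T.H : ℝ) ^ 2) T.cmax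
  entries : Entries T.Mem (edgeRank T.cap P.m) P.m (T.M * T.M) T.N T.st T.ent T.seg

/-- The part of the weight exponent of `e` that has not been passed on. -/
noncomputable def pend (T : Tab) (Γ A : ℕ → ℝ) (e : ℕ) : ℝ :=
  ∑ k ∈ range T.N, if T.ent k = e then Γ (T.seg k) - A k else 0

/-- The state `A` of the entries never runs ahead of the state `Γ` of their canonical cuts, and
within each canonical cut an entry lags behind the previous one by less than its threshold. -/
structure Lazy (T : Tab) (Γ A : ℕ → ℝ) : Prop where
  le : ∀ k < T.N, A k ≤ Γ (T.seg k)
  succ_le : ∀ S < T.M * T.M, ∀ k, T.st S ≤ k → k + 1 < T.st (S + 1) → A (k + 1) ≤ A k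
  sub_lt : ∀ S < T.M * T.M, ∀ k, T.st S ≤ k → k + 1 < T.st (S + 1) →
    A k - A (k + 1) < T.thr (T.ent (k + 1))
  eq_of_eq : ∀ S < T.M * T.M, ∀ k, T.st S ≤ k → k + 1 < T.st (S + 1) →
    T.thr (T.ent k) = T.thr (T.ent (k + 1)) → A k = A (k + 1)

/-- The first entry of the canonical cut `S` lags behind by less than its threshold. -/
def Head (T : Tab) (Γ A : ℕ → ℝ) (S : ℕ) : Prop :=
  T.st S < T.st (S + 1) → Γ S - A (T.st S) < T.thr (T.ent (T.st S))

end Tab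

/-- The data structure in the store `s` represents the exact weights `w` and the approximate
weights `w'`. -/
structure Represents (P : Input) (s : Store) (w w' : Fin P.m → ℝ) : Prop where
  ok : (view s).Ok P
  lz : (view s).Lazy (s.rarr 5) (s.rarr 4)
  head : ∀ S < (view s).M * (view s).M, (view s).Head (s.rarr 5) (s.rarr 4) S
  wt_eq : ∀ i : Fin P.m, w' i = s.rarr 1 i
  wt_pos : ∀ i, 0 < w' i
  exact_eq : ∀ i : Fin P.m,
    w i = w' i * Real.exp (P.ε * (view s).pend (s.rarr 5) (s.rarr 4) i / P.cap i)
  buf_zero : ∀ i : Fin P.m, s.rarr 6 i = 0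

/-- Distinct edges of a simple graph have distinct ordered pairs of end points; the crude bound
suffices for word sizes. -/
theorem Input.m_le (P : Input) : P.m ≤ P.n ^ 2 := by
  have : Function.Injective fun i => (P.src i, P.dst i) := by
    intro i j h
    simp only [Prod.mk.injEq] at h
    exact P.edges.injOn (Set.mem_univ i) (Set.mem_univ j) (by simp [h.1, h.2])
  simpa [sq] using Fintype.card_le_of_injective _ this

/-- The initialization. -/
def initCmd : Cmd := levels ;; labelTree ;; sortEdges ;; thresholds ;; buildTable

theorem wp_initCmd {P : Input} {B τ : ℕ} (hB : 100 * P.n ^ 8 ≤ B) :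
    wp B initCmd (fun _ s => Represents P s P.wt P.wt) τ P.store := by
  have hn := P.two_le_n
  have hm := P.m_le
  have hpow : ∀ k ≤ 8, P.n ^ k ≤ P.n ^ 8 := fun k hk => Nat.pow_le_pow_right (by omega) hk
  have hp1 : P.n ≤ P.n ^ 8 := by simpa using hpow 1 (by norm_num)
  have hp2 := hpow 2 (by norm_num)
  have hp4 := hpow 4 (by norm_num)
  have hp6 := hpow 6 (by norm_num)
  rw [initCmd, wp_seq]
  refine (wp_levels (n := P.n) (by simp [Input.store]) hn (by omega)).mono ?_
  rintro τ₁ s₁ hf₁ ⟨h7, h8, h9, hH, hM, hL, hk, hpw⟩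
  have a0 : s₁.nreg 0 = P.n := by rw [hf₁.nreg 0 (by decide)]; simp [Input.store]
  have a1 : s₁.nreg 1 = P.m := by rw [hf₁.nreg 1 (by decide)]; simp [Input.store]
  have a2 : s₁.nreg 2 = P.root := by rw [hf₁.nreg 2 (by decide)]; simp [Input.store]
  rw [wp_seq]
  refine (wp_labelTree (P := P) a0 a2 h7 h9 ?_ ?_ ?_ ?_ (by omega)).mono ?_
  · intro v; rw [hf₁.narr 2 (by decide)]; simp [Input.store]
  · intro i; rw [hf₁.narr 4 (by decide)]; simp [Input.store]
  · intro i; rw [hf₁.narr 5 (by decide)]; simp [Input.store]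
  · intro i; rw [hf₁.narr 6 (by decide)]; simp [Input.store]
  intro τ₂ s₂ hf₂ hlab
  rw [wp_seq]
  refine (wp_sortEdges (m := P.m) (by rw [hf₂.nreg 1 (by decide), a1])
    (by rw [hf₂.nreg 7 (by decide), h7]) (by omega)).mono ?_
  intro τ₃ s₃ hf₃ hsort
  have c1 : s₃.nreg 1 = P.m := by rw [hf₃.nreg 1 (by decide), hf₂.nreg 1 (by decide), a1]
  have c10 : s₃.nreg 10 = s₁.nreg 10 := by rw [hf₃.nreg 10 (by decide), hf₂.nreg 10 (by decide)]
  have cr2 : s₂.rarr 0 = P.store.rarr 0 := by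
    rw [hf₂.rarr 0 (by decide), hf₁.rarr 0 (by decide)]
  have cr3 : s₃.rarr 0 = P.store.rarr 0 := by rw [hf₃.rarr 0 (by decide), cr2]
  rw [cr2] at hsort
  rw [wp_seq]
  refine (wp_thresholds (m := P.m) c1
    (by rw [hf₃.nreg 7 (by decide), hf₂.nreg 7 (by decide), h7])
    (by rw [hf₃.nreg 8 (by decide), hf₂.nreg 8 (by decide), h8])
    (by rw [hf₃.nreg 9 (by decide), hf₂.nreg 9 (by decide), h9])
    (by rw [c10]; exact hH) ?_ (by rw [cr3]; exact hsort) (by omega)).mono ?_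
  · intro e he
    rw [cr3]
    simpa [Input.store, he] using P.cap_pos ⟨e, he⟩
  intro τ₄ s₄ hf₄ hthr
  rw [cr3, c10] at hthr
  have n0 : s₄.nreg 0 = P.n := by
    rw [hf₄.nreg 0 (by decide), hf₃.nreg 0 (by decide), hf₂.nreg 0 (by decide), a0]
  have n1 : s₄.nreg 1 = P.m := by rw [hf₄.nreg 1 (by decide), c1]
  have n7 : s₄.nreg 7 = 1 := by
    rw [hf₄.nreg 7 (by decide), hf₃.nreg 7 (by decide), hf₂.nreg 7 (by decide), h7]
  have n8 : s₄.nreg 8 = 2 := by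
    rw [hf₄.nreg 8 (by decide), hf₃.nreg 8 (by decide), hf₂.nreg 8 (by decide), h8]
  have n9 : s₄.nreg 9 = 0 := by
    rw [hf₄.nreg 9 (by decide), hf₃.nreg 9 (by decide), hf₂.nreg 9 (by decide), h9]
  have n10 : s₄.nreg 10 = s₁.nreg 10 := by rw [hf₄.nreg 10 (by decide), c10]
  have n11 : s₄.nreg 11 = s₁.nreg 10 * P.n := by
    rw [hf₄.nreg 11 (by decide), hf₃.nreg 11 (by decide), hf₂.nreg 11 (by decide), hM]
  have n12 : s₄.nreg 12 = s₁.nreg 10 * P.n * (s₁.nreg 10 * P.n) := by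
    rw [hf₄.nreg 12 (by decide), hf₃.nreg 12 (by decide), hf₂.nreg 12 (by decide), hL, hM]
  have a_0 : s₄.narr 0 = P.store.narr 0 := by
    rw [hf₄.narr 0 (by decide), hf₃.narr 0 (by decide), hf₂.narr 0 (by decide),
      hf₁.narr 0 (by decide)]
  have a_1 : s₄.narr 1 = P.store.narr 1 := by
    rw [hf₄.narr 1 (by decide), hf₃.narr 1 (by decide), hf₂.narr 1 (by decide),
      hf₁.narr 1 (by decide)]
  have a_4 : s₄.narr 4 = s₂.narr 4 := by rw [hf₄.narr 4 (by decide), hf₃.narr 4 (by decide)]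
  have a_5 : s₄.narr 5 = s₂.narr 5 := by rw [hf₄.narr 5 (by decide), hf₃.narr 5 (by decide)]
  have a_7 : s₄.narr 7 = s₃.narr 7 := hf₄.narr 7 (by decide)
  have a_8 : s₄.narr 8 = s₁.narr 8 := by
    rw [hf₄.narr 8 (by decide), hf₃.narr 8 (by decide), hf₂.narr 8 (by decide)]
  have a_9 : s₄.narr 9 0 = 0 := by
    rw [hf₄.narr 9 (by decide), hf₃.narr 9 (by decide), hf₂.narr 9 (by decide),
      hf₁.narr 9 (by decide)]
    simp [Input.store]
  have hsrc : ∀ i : Fin P.m, s₄.narr 0 i = P.src i := by intro i; simp [a_0, Input.store]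
  have hdst : ∀ i : Fin P.m, s₄.narr 1 i = P.dst i := by intro i; simp [a_1, Input.store]
  have htin : ∀ v : Fin P.n, s₄.narr 4 v ≤ P.n := by
    intro v; rw [a_4]; simpa using hlab.tin_le_card v
  have hHn : s₁.nreg 10 ≤ P.n := by
    by_contra h
    exact absurd (lt_of_two_pow_le ((hk P.n).mp (by omega))) (lt_irrefl _)
  have hMn : s₁.nreg 10 * P.n ≤ P.n ^ 2 := by rw [sq]; exact Nat.mul_le_mul_right _ hHn
  -- The largest words are positions in the table. There are M² ≤ n⁴ canonical cuts with at most m ≤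
  -- n² members each, so a crude bound of order n⁶ holds.
  have hsz : (s₁.nreg 10 * P.n * (s₁.nreg 10 * P.n) + 1) * (P.m + 1) ≤ B := by
    calc _ ≤ (P.n ^ 2 * P.n ^ 2 + 1) * (P.n ^ 2 + 1) := by gcongr
      _ = P.n ^ 6 + P.n ^ 4 + P.n ^ 2 + 1 := by ring
      _ ≤ B := by omega
  refine (wp_buildTable (n := P.n) (m := P.m) (H := s₁.nreg 10) (M := s₁.nreg 10 * P.n)
    (c := P.store.rarr 0) (rank := edgeRank (P.store.rarr 0) P.m) n0 n1 n7 n11 n12 rfl (by omega)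
    (Nat.mul_pos hH (by omega)) (by rw [a_8]; exact hpw) (by rw [a_7]; exact hsort)
    ?_ ?_ a_9 hsz).mono ?_
  · intro e he
    rw [hsrc ⟨e, he⟩]
    exact (htin _).trans (by omega)
  · intro e he
    rw [hdst ⟨e, he⟩]
    exact (htin _).trans (by omega)
  intro τ₅ s₅ hf₅ hent
  have b0 : s₅.rarr 0 = P.store.rarr 0 := by
    rw [hf₅.rarr 0 (by decide), hf₄.rarr 0 (by decide), cr3]
  have b1 : s₅.rarr 1 = P.store.rarr 1 := by
    rw [hf₅.rarr 1 (by decide), hf₄.rarr 1 (by decide), hf₃.rarr 1 (by decide),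
      hf₂.rarr 1 (by decide), hf₁.rarr 1 (by decide)]
  have b4 : s₅.rarr 4 = fun _ => 0 := by
    rw [hf₅.rarr 4 (by decide), hf₄.rarr 4 (by decide), hf₃.rarr 4 (by decide),
      hf₂.rarr 4 (by decide), hf₁.rarr 4 (by decide)]
    simp [Input.store]
  have b5 : s₅.rarr 5 = fun _ => 0 := by
    rw [hf₅.rarr 5 (by decide), hf₄.rarr 5 (by decide), hf₃.rarr 5 (by decide),
      hf₂.rarr 5 (by decide), hf₁.rarr 5 (by decide)]
    simp [Input.store]
  have b6 : s₅.rarr 6 = fun _ => 0 := by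
    rw [hf₅.rarr 6 (by decide), hf₄.rarr 6 (by decide), hf₃.rarr 6 (by decide),
      hf₂.rarr 6 (by decide), hf₁.rarr 6 (by decide)]
    simp [Input.store]
  have hok : (view s₅).Ok P := by
    refine ⟨?_, ?_, ?_, ?_, ?_, ?_, ?_, ?_, ?_, ?_, ?_, ?_, ?_, ?_, ?_, ?_⟩
    · rw [view, hf₅.nreg 0 (by decide), n0]
    · rw [view, hf₅.nreg 1 (by decide), n1]
    · rw [view, hf₅.nreg 7 (by decide), n7]
    · rw [view, hf₅.nreg 8 (by decide), n8]
    · rw [view, hf₅.nreg 9 (by decide), n9]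
    · rw [view, hf₅.nreg 10 (by decide), n10]; exact hH
    · rw [view, hf₅.nreg 10 (by decide), n10]; exact hk
    · rw [view, hf₅.nreg 10 (by decide), hf₅.nreg 11 (by decide), n10, n11]
    · rw [view, hf₅.narr 0 (by decide)]; exact hsrc
    · rw [view, hf₅.narr 1 (by decide)]; exact hdst
    · rw [view, b0]; intro i; simp [Input.store]
    · rw [view, hf₅.rreg 0 (by decide), hf₄.rreg 0 (by decide), hf₃.rreg 0 (by decide),
        hf₂.rreg 0 (by decide), hf₁.rreg 0 (by decide)]
      simp [Input.store]
    · rw [view, hf₅.narr 4 (by decide), hf₅.narr 5 (by decide), a_4, a_5]; exact hlab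
    · rw [view, hf₅.narr 7 (by decide), a_7, b0]; exact hsort
    · rw [view, hf₅.narr 7 (by decide), a_7, b0, hf₅.rarr 3 (by decide), hf₅.nreg 10 (by decide),
        n10, hf₅.rreg 1 (by decide)]
      exact hthr
    · have hmem : (view s₅).Mem = fun e S => Joins P.n (s₁.nreg 10 * P.n)
          (s₄.narr 4 (s₄.narr 0 e)) (s₄.narr 4 (s₄.narr 1 e)) S := by
        funext e S
        simp only [Tab.Mem, view, hf₅.nreg 0 (by decide), hf₅.nreg 11 (by decide),
          hf₅.narr 0 (by decide), hf₅.narr 1 (by decide), hf₅.narr 4 (by decide), n0, n11]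
      have hM' : (view s₅).M = s₁.nreg 10 * P.n := by
        rw [view, hf₅.nreg 11 (by decide), n11]
      have hc' : (view s₅).cap = P.store.rarr 0 := b0
      rw [hM', hc']
      change Entries _ _ _ _ (s₅.nreg 13) (s₅.narr 9) (s₅.narr 10) (s₅.narr 11)
      convert hent using 1
  -- All states are zero at the start: there are no lags, and the strict inequalities of the
  -- invariant reduce to positivity of the thresholds.
  have hpos := hok.thresholds.pos
  refine ⟨hok, ?_, ?_, ?_, P.wt_pos, ?_, ?_⟩
  · have hE := hok.entries
    have hthr0 : ∀ k < (view s₅).N, 0 < (view s₅).thr ((view s₅).ent k) := by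
      intro k hk
      have := (hE.cover k hk).2.2.2
      rw [← hok.sorted.ord_rank _ this]
      exact hpos _ (hok.sorted.rank_lt _ this)
    refine ⟨by simp [b4, b5], by simp [b4], ?_, by simp [b4]⟩
    intro S hS k h₁ h₂
    have := hE.st_le_last (S + 1) hS
    simpa [b4] using hthr0 (k + 1) (by omega)
  · intro S hS hlt
    have hE := hok.entries
    have := hE.st_le_last (S + 1) hS
    have := (hE.cover ((view s₅).st S) (by omega)).2.2.2
    rw [b4, b5, sub_self, ← hok.sorted.ord_rank _ this]
    exact hpos _ (hok.sorted.rank_lt _ this)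
  · intro i; simp [b1, Input.store]
  · intro i; simp [Tab.pend, b4, b5]
  · intro i; simp [b6]

end LazyIncCuts

namespace LazyIncCuts

open RealRAM Finset

/-! ### Bounds on lags and on the size of the table. -/

namespace Tab.Ok

variable {P : Input} {T : Tab} {Γ A : ℕ → ℝ} {e k S : ℕ}

theorem H_le (h : T.Ok P) : T.H ≤ P.n := by
  by_contra hc
  exact absurd (lt_of_two_pow_le ((h.lt_H_iff P.n).mp (by omega))) (lt_irrefl _)

theorem M_le (h : T.Ok P) : T.M ≤ P.n ^ 2 := by
  rw [h.M_eq, sq]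
  exact Nat.mul_le_mul_right _ h.H_le

theorem H_sq_pos (h : T.Ok P) : (0 : ℝ) < (T.H : ℝ) ^ 2 := by
  have : (0 : ℝ) < T.H := by exact_mod_cast h.H_pos
  positivity

theorem thr_pos (h : T.Ok P) (he : e < P.m) : 0 < T.thr e := by
  have := h.thresholds.pos _ (h.sorted.rank_lt e he)
  rwa [h.sorted.ord_rank e he] at this

theorem thr_mul_le (h : T.Ok P) (he : e < P.m) : T.thr e * (T.H : ℝ) ^ 2 ≤ T.cap e := by
  have := h.thresholds.mul_le _ (h.sorted.rank_lt e he)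
  rwa [h.sorted.ord_rank e he] at this

theorem cap_lt (h : T.Ok P) (he : e < P.m) : T.cap e < 2 * (T.thr e * (T.H : ℝ) ^ 2) := by
  have := h.thresholds.lt_mul _ (h.sorted.rank_lt e he)
  rwa [h.sorted.ord_rank e he] at this

theorem cap_le_cmax (h : T.Ok P) (he : e < P.m) : T.cap e ≤ T.cmax := by
  have := h.thresholds.le_max _ (h.sorted.rank_lt e he)
  rwa [h.sorted.ord_rank e he] at this

theorem lt_N (h : T.Ok P) (hS : S < T.M * T.M) (hk : k < T.st (S + 1)) : k < T.N :=
  lt_of_lt_of_le hk (h.entries.st_le_last (S + 1) hS)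

theorem ent_lt (h : T.Ok P) (hk : k < T.N) : T.ent k < P.m := (h.entries.cover k hk).2.2.2

/-- Lists are sorted by capacity, so the minimum over a canonical cut can be read off its first
entry in constant time. -/
theorem entry_cap_le (h : T.Ok P) (hS : S < T.M * T.M) (h₁ : T.st S ≤ k)
    (h₂ : k < T.st (S + 1)) : T.cap (T.ent (T.st S)) ≤ T.cap (T.ent k) := by
  induction k, h₁ using Nat.le_induction with
  | base => exact le_rfl
  | succ k hk ih =>
    refine (ih (by omega)).trans ?_
    have hr := h.entries.sorted S hS k hk h₂
    have h₃ := h.ent_lt (h.lt_N hS (show k < _ by omega))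
    have h₄ := h.ent_lt (h.lt_N hS h₂)
    have := h.sorted.mono _ _ hr (h.sorted.rank_lt _ h₄)
    rwa [h.sorted.ord_rank _ h₃, h.sorted.ord_rank _ h₄] at this

theorem entry_gap (h : T.Ok P) (hS : S < T.M * T.M) (h₁ : T.st S ≤ k)
    (h₂ : k + 1 < T.st (S + 1)) : T.thr (T.ent k) = T.thr (T.ent (k + 1)) ∨
      2 * T.thr (T.ent k) ≤ T.thr (T.ent (k + 1)) := by
  have hr := h.entries.sorted S hS k h₁ h₂
  have h₃ := h.ent_lt (h.lt_N hS (show k < _ by omega))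
  have h₄ := h.ent_lt (h.lt_N hS h₂)
  have := h.thresholds.gap _ _ hr (h.sorted.rank_lt _ h₄)
  rwa [h.sorted.ord_rank _ h₃, h.sorted.ord_rank _ h₄] at this

/-- The lags within a canonical cut add up to at most twice the threshold. -/
theorem lag_lt (h : T.Ok P) (hl : T.Lazy Γ A) (hS : S < T.M * T.M) (hh : T.Head Γ A S)
    (h₁ : T.st S ≤ k) (h₂ : k < T.st (S + 1)) : Γ S - A k < 2 * T.thr (T.ent k) := by
  induction k, h₁ using Nat.le_induction with
  | base =>
    have := h.thr_pos (h.ent_lt (h.lt_N hS h₂))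
    have := hh h₂
    linarith
  | succ k hk ih =>
    have ih := ih (by omega)
    have hlt := hl.sub_lt S hS k hk h₂
    -- Equal thresholds force equal states, and the bound carries over. Otherwise the threshold
    -- doubles, and the old bound 2 thr k ≤ thr (k + 1) plus the new gap, below thr (k + 1), stays
    -- below 2 thr (k + 1).
    rcases h.entry_gap hS hk h₂ with heq | hge
    · rw [← hl.eq_of_eq S hS k hk h₂ heq, ← heq]
      exact ih
    · linarith

theorem card_mem_le (_ : T.Ok P) (hM : T.M = T.H * T.n) (hn : 0 < T.n) (e : ℕ) :
    #{S ∈ range (T.M * T.M) | T.Mem e S} ≤ 2 * T.H ^ 2 := by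
  set p := T.tin (T.src e)
  set q := T.tin (T.dst e)
  -- A canonical cut containing `e` is determined by the levels of its two intervals and by which
  -- end point lies in the first one: a position lies in only one dyadic interval per level. This
  -- gives at most H · H · 2 possibilities.
  let f : (ℕ × ℕ) × Bool → ℕ := fun x =>
    (x.1.1 * T.n + (bif x.2 then p else q) / 2 ^ x.1.1) * T.M +
      (x.1.2 * T.n + (bif x.2 then q else p) / 2 ^ x.1.2)
  have hsub : filter (fun S => T.Mem e S) (range (T.M * T.M)) ⊆
      image f ((range T.H ×ˢ range T.H) ×ˢ univ) := by
    intro S hS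
    simp only [mem_filter, mem_range] at hS
    obtain ⟨hS, hm⟩ := hS
    have hM0 : 0 < T.M := Nat.pos_of_ne_zero fun h => by simp [h] at hS
    have h₁ : S / T.M / T.n < T.H := by
      rw [Nat.div_lt_iff_lt_mul hn, ← hM]; exact (Nat.div_lt_iff_lt_mul hM0).mpr hS
    have h₂ : S % T.M / T.n < T.H := by
      rw [Nat.div_lt_iff_lt_mul hn, ← hM]; exact Nat.mod_lt _ hM0
    rw [mem_image]
    rcases hm with ⟨ha, hb⟩ | ⟨ha, hb⟩
    · refine ⟨((S / T.M / T.n, S % T.M / T.n), true), by simp [h₁, h₂], ?_⟩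
      simp only [InNode] at ha hb
      simp only [f, cond_true]
      rw [ha, hb, Nat.div_add_mod', Nat.div_add_mod', Nat.div_add_mod']
    · refine ⟨((S / T.M / T.n, S % T.M / T.n), false), by simp [h₁, h₂], ?_⟩
      simp only [InNode] at ha hb
      simp only [f, cond_false]
      rw [ha, hb, Nat.div_add_mod', Nat.div_add_mod', Nat.div_add_mod']
  refine (card_le_card hsub).trans (card_image_le.trans ?_)
  simp only [card_product, card_range, card_univ, Fintype.card_bool]
  exact le_of_eq (by ring)

theorem sum_ent_le (h : T.Ok P) (he : e < P.m) {x : ℝ} (hx : 0 ≤ x) :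
    ∑ k ∈ range T.N, (if T.ent k = e then x else 0) ≤ 2 * (T.H : ℝ) ^ 2 * x := by
  rw [h.entries.sum e he fun _ => x, ← sum_filter, sum_const, nsmul_eq_mul]
  refine mul_le_mul_of_nonneg_right ?_ hx
  have := h.card_mem_le (by rw [h.M_eq, h.n_eq]) (by have := P.two_le_n; have := h.n_eq; omega) e
  exact_mod_cast this

theorem N_le (h : T.Ok P) : (T.N : ℝ) ≤ 2 * (T.H : ℝ) ^ 2 * P.m := by
  have h₁ : (T.N : ℝ) = ∑ k ∈ range T.N, ∑ e ∈ range P.m, if T.ent k = e then (1 : ℝ) else 0 := by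
    rw [sum_congr rfl (g := fun _ => (1 : ℝ))]
    · simp
    · intro k hk
      rw [mem_range] at hk
      simp [h.ent_lt hk]
  rw [h₁, sum_comm]
  refine (sum_le_sum fun e he => h.sum_ent_le (mem_range.mp he) zero_le_one).trans ?_
  simp
  linarith

theorem pend_nonneg (hl : T.Lazy Γ A) (e : ℕ) : 0 ≤ T.pend Γ A e := by
  refine sum_nonneg fun k hk => ?_
  have := hl.le k (mem_range.mp hk)
  split <;> linarith

/-- There are at most 2H² entries per edge, each with a lag below 2 thr, and thr · H² ≤ c. -/
theorem pend_le (h : T.Ok P) (hl : T.Lazy Γ A) (hh : ∀ S < T.M * T.M, T.Head Γ A S)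
    (he : e < P.m) : T.pend Γ A e ≤ 4 * T.cap e := by
  have h₁ : T.pend Γ A e ≤ ∑ k ∈ range T.N, (if T.ent k = e then 2 * T.thr e else 0) := by
    refine sum_le_sum fun k hk => ?_
    rw [mem_range] at hk
    obtain ⟨hS, hk₁, hk₂, -⟩ := h.entries.cover k hk
    split
    · rename_i hke
      have := h.lag_lt hl hS (hh _ hS) hk₁ hk₂
      rw [hke] at this
      exact this.le
    · exact le_rfl
  have := h.thr_pos he
  have h₂ := h.sum_ent_le he (x := 2 * T.thr e) (by linarith)
  have := h.thr_mul_le he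
  linarith

theorem exists_entry (h : T.Ok P) (he : e < P.m) (hS : S < T.M * T.M) (hm : T.Mem e S) :
    ∃ k, T.st S ≤ k ∧ k < T.st (S + 1) ∧ T.ent k = e := by
  -- Testing the double-counting identity with the indicator of `S` gives the value 1, so some entry
  -- of `e` must lie in `S`.
  have hs := h.entries.sum e he fun S' => if S' = S then 1 else 0
  have hr : ∑ S' ∈ range (T.M * T.M), (if T.Mem e S' then (if S' = S then (1 : ℝ) else 0) else 0)
      = 1 := by
    rw [sum_eq_single S]
    · simp [hm]
    · intro b _ hb; simp [hb]
    · intro hc; exact absurd (mem_range.mpr hS) hc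
  rw [hr] at hs
  obtain ⟨k, hk, hne⟩ := exists_ne_zero_of_sum_ne_zero (hs.trans_ne one_ne_zero)
  rw [mem_range] at hk
  have h₁ : T.ent k = e := by by_contra hc; simp [hc] at hne
  have h₂ : T.seg k = S := by by_contra hc; simp [hc] at hne
  obtain ⟨-, h₃, h₄, -⟩ := h.entries.cover k hk
  rw [h₂] at h₃ h₄
  exact ⟨k, h₃, h₄, h₁⟩

end Tab.Ok

/-! ### Cuts as products of families of dyadic intervals -/

namespace Input

variable (P : Input)

theorem mem_down_trans {u v w : Fin P.n} (h₁ : u ∈ P.down v) (h₂ : v ∈ P.down w) :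
    u ∈ P.down w := by
  obtain ⟨k, rfl⟩ := h₁
  obtain ⟨l, rfl⟩ := h₂
  exact ⟨l + k, Function.iterate_add_apply _ _ _ _⟩

theorem mem_down_or_mem_down {u v w : Fin P.n} (h₁ : u ∈ P.down v) (h₂ : u ∈ P.down w) :
    v ∈ P.down w ∨ w ∈ P.down v := by
  obtain ⟨k, rfl⟩ := h₁
  obtain ⟨l, rfl⟩ := h₂
  rcases le_total k l with h | h
  · left
    refine ⟨l - k, ?_⟩
    rw [← Function.iterate_add_apply, Nat.sub_add_cancel h]
  · right
    refine ⟨k - l, ?_⟩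
    rw [← Function.iterate_add_apply, Nat.sub_add_cancel h]

/-- The side of a 2-cut is the symmetric difference of two down sets. -/
theorem mem_side_two {s t u : Fin P.n} :
    u ∈ P.side (.two s t) ↔ Xor (u ∈ P.down s) (u ∈ P.down t) := by
  simp only [side, Xor]
  split_ifs with h₁ h₂
  · have : u ∈ P.down s → u ∈ P.down t := fun h => P.mem_down_trans h h₁
    simp only [Set.mem_sdiff]
    tauto
  · have : u ∈ P.down t → u ∈ P.down s := fun h => P.mem_down_trans h h₂
    simp only [Set.mem_sdiff]
    tauto
  · have : u ∈ P.down s → u ∈ P.down t → False := fun h h' => by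
      rcases P.mem_down_or_mem_down h h' with h | h
      · exact h₁ h
      · exact h₂ h
    simp only [Set.mem_union]
    tauto

end Input

/-- A single loop counter `t` runs through all pairs of nodes as `(t / b, t % b)`. -/
theorem sum_range_mul_div_mod (f : ℕ → ℕ → ℕ) (a b : ℕ) :
    ∑ t ∈ range (a * b), f (t / b) (t % b) = ∑ i ∈ range a, ∑ j ∈ range b, f i j := by
  rcases Nat.eq_zero_or_pos b with rfl | hb
  · simp
  induction a with
  | zero => simp
  | succ a ih =>
    rw [Nat.succ_mul, sum_range_add, ih, sum_range_succ]
    congr 1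
    refine sum_congr rfl fun j hj => ?_
    rw [mem_range] at hj
    congr 1
    · rw [add_comm, Nat.add_mul_div_right _ _ hb, Nat.div_eq_of_lt hj, zero_add]
    · rw [add_comm, Nat.add_mul_mod_self_right, Nat.mod_eq_of_lt hj]

/-- The nodes `A 0, …, A (a - 1)` cover each position with the property `p` exactly once and no
other position. -/
def Covers (n : ℕ) (A : ℕ → ℕ) (a : ℕ) (p : ℕ → Prop) [DecidablePred p] : Prop :=
  ∀ x < n, ∑ i ∈ range a, (if InNode n x (A i) then 1 else 0) = if p x then 1 else 0

theorem Covers.of_inNode {n a i x : ℕ} {A : ℕ → ℕ} {p : ℕ → Prop} [DecidablePred p]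
    (h : Covers n A a p) (hi : i < a) (hx : x < n) (hm : InNode n x (A i)) : p x := by
  have h₁ := h x hx
  have h₂ := single_le_sum (f := fun i => if InNode n x (A i) then 1 else 0)
    (fun _ _ => Nat.zero_le _) (mem_range.mpr hi)
  simp only [hm, if_true] at h₂
  by_contra hc
  rw [if_neg hc] at h₁
  omega

/-- The number of product cuts containing an edge factors into counts of nodes at its two ends, and
these counts are the indicators of `p` and of its negation. What remains is 1 if `p` separates the
ends and 0 otherwise. -/
theorem sum_joins {n M a b x y : ℕ} {A A' : ℕ → ℕ} {p : ℕ → Prop} [DecidablePred p]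
    (hA : Covers n A a p) (hA' : Covers n A' b fun x => ¬ p x) (hM : ∀ j < b, A' j < M)
    (hx : x < n) (hy : y < n) :
    ∑ t ∈ range (a * b), (if Joins n M x y (A (t / b) * M + A' (t % b)) then 1 else 0) =
      if p x ∧ ¬ p y ∨ p y ∧ ¬ p x then 1 else 0 := by
  have h₁ : ∀ i < a, ∀ j < b, (if Joins n M x y (A i * M + A' j) then 1 else 0) =
      (if InNode n x (A i) then 1 else 0) * (if InNode n y (A' j) then 1 else 0) +
      (if InNode n y (A i) then 1 else 0) * (if InNode n x (A' j) then 1 else 0) := by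
    intro i hi j hj
    have hMj := hM j hj
    have hd : (A i * M + A' j) / M = A i := by
      rw [add_comm, Nat.add_mul_div_right _ _ (by omega), Nat.div_eq_of_lt hMj, zero_add]
    have hm : (A i * M + A' j) % M = A' j := by
      rw [add_comm, Nat.add_mul_mod_self_right, Nat.mod_eq_of_lt hMj]
    simp only [Joins, hd, hm]
    have k₁ := fun h => hA.of_inNode hi hx h
    have k₂ := fun h => hA'.of_inNode hj hx h
    -- The two orientations never hold at once: a position cannot lie both in a node of the side and
    -- in a node of the complement. The indicator of the disjunction is therefore a sum.
    by_cases c₁ : InNode n x (A i) <;> by_cases c₂ : InNode n x (A' j)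
    · exact absurd (k₁ c₁) (k₂ c₂)
    all_goals simp [c₁, c₂]
  rw [sum_range_mul_div_mod fun i j => if Joins n M x y (A i * M + A' j) then 1 else 0]
  have h₂ : ∑ i ∈ range a, ∑ j ∈ range b, (if Joins n M x y (A i * M + A' j) then 1 else 0) =
      (∑ i ∈ range a, if InNode n x (A i) then 1 else 0) *
        (∑ j ∈ range b, if InNode n y (A' j) then 1 else 0) +
      (∑ i ∈ range a, if InNode n y (A i) then 1 else 0) *
        (∑ j ∈ range b, if InNode n x (A' j) then 1 else 0) := by
    rw [sum_mul_sum, sum_mul_sum, ← sum_add_distrib]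
    refine sum_congr rfl fun i hi => ?_
    rw [← sum_add_distrib]
    exact sum_congr rfl fun j hj => h₁ i (mem_range.mp hi) j (mem_range.mp hj)
  rw [h₂, hA x hx, hA y hy, hA' x hx, hA' y hy]
  by_cases c₁ : p x <;> by_cases c₂ : p y <;> simp [c₁, c₂]

/-- The canonical cuts `Sq 0, …, Sq (r - 1)` partition the cut `q`. -/
structure Tab.Splits (P : Input) (T : Tab) (q : CutDesc P.n) (Sq : ℕ → ℕ) (r : ℕ) : Prop where
  lt : ∀ t < r, Sq t < T.M * T.M
  sum_mem : ∀ i : Fin P.m, i ∈ P.cut q → ∑ t ∈ range r, (if T.Mem i (Sq t) then 1 else 0) = 1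
  sum_not_mem : ∀ i : Fin P.m, i ∉ P.cut q →
    ∑ t ∈ range r, (if T.Mem i (Sq t) then 1 else 0) = 0

theorem Tab.Ok.splits {P : Input} {T : Tab} (h : T.Ok P) {q : CutDesc P.n} {a b : ℕ}
    {A A' : ℕ → ℕ} {p : ℕ → Prop} [DecidablePred p]
    (hside : ∀ u : Fin P.n, u ∈ P.side q ↔ p (T.tin u))
    (hA : Covers P.n A a p) (hA' : Covers P.n A' b fun x => ¬ p x)
    (hM : ∀ i < a, A i < T.M) (hM' : ∀ j < b, A' j < T.M) :
    T.Splits P q (fun t => A (t / b) * T.M + A' (t % b)) (a * b) := by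
  have htin : ∀ u : Fin P.n, T.tin u < P.n := fun u => by
    have h₁ := h.labels.tin_lt (mem_univ u)
    have h₂ := h.labels.tout_le u
    simp at h₂
    omega
  have key : ∀ i : Fin P.m,
      ∑ t ∈ range (a * b), (if T.Mem i (A (t / b) * T.M + A' (t % b)) then 1 else 0) =
        if p (T.tin (P.src i)) ∧ ¬ p (T.tin (P.dst i)) ∨
          p (T.tin (P.dst i)) ∧ ¬ p (T.tin (P.src i)) then 1 else 0 := by
    intro i
    rw [← sum_joins hA hA' hM' (htin (P.src i)) (htin (P.dst i))]
    simp only [Tab.Mem, h.n_eq, h.src_eq, h.dst_eq]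
  have hcut : ∀ i : Fin P.m, i ∈ P.cut q ↔ (p (T.tin (P.src i)) ∧ ¬ p (T.tin (P.dst i)) ∨
          p (T.tin (P.dst i)) ∧ ¬ p (T.tin (P.src i))) := by
    intro i
    simp only [Input.cut, Set.mem_ofPred_eq, Xor, hside]
  refine ⟨fun t ht => ?_, fun i hi => ?_, fun i hi => ?_⟩
  · have hb : 0 < b := Nat.pos_of_ne_zero fun hb => by simp [hb] at ht
    have h₁ := hM (t / b) ((Nat.div_lt_iff_lt_mul hb).mpr ht)
    have h₂ := hM' (t % b) (Nat.mod_lt _ hb)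
    calc _ < A (t / b) * T.M + T.M := by omega
      _ = (A (t / b) + 1) * T.M := by ring
      _ ≤ T.M * T.M := Nat.mul_le_mul_right _ h₁
  · rw [key, if_pos ((hcut i).mp hi)]
  · rw [key, if_neg fun hc => hi ((hcut i).mpr hc)]

namespace Tab.Splits

variable {P : Input} {T : Tab} {q : CutDesc P.n} {Sq : ℕ → ℕ} {r : ℕ}

theorem mem_cut (h : T.Splits P q Sq r) {t : ℕ} (ht : t < r) {i : Fin P.m}
    (hm : T.Mem i (Sq t)) : i ∈ P.cut q := by
  by_contra hc
  have h₁ := h.sum_not_mem i hc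
  have h₂ := single_le_sum (f := fun t => if T.Mem i (Sq t) then 1 else 0)
    (fun _ _ => Nat.zero_le _) (mem_range.mpr ht)
  simp only [hm, if_true] at h₂
  omega

theorem exists_mem (h : T.Splits P q Sq r) {i : Fin P.m} (hi : i ∈ P.cut q) :
    ∃ t < r, T.Mem i (Sq t) := by
  obtain ⟨t, ht, hne⟩ := exists_ne_zero_of_sum_ne_zero ((h.sum_mem i hi).trans_ne one_ne_zero)
  refine ⟨t, mem_range.mp ht, ?_⟩
  by_contra hc
  simp [hc] at hne

open Classical in
/-- Raising every canonical cut of `q` by `γ` raises the exponents of the edges of `q` by `γ`. -/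
theorem pend_add (h : T.Splits P q Sq r) (hT : T.Ok P) (Γ A : ℕ → ℝ) (γ : ℝ) (i : Fin P.m) :
    T.pend (fun S => Γ S + γ * ∑ t ∈ range r, if Sq t = S then 1 else 0) A i =
      T.pend Γ A i + if i ∈ P.cut q then γ else 0 := by
  have h₁ : T.pend (fun S => Γ S + γ * ∑ t ∈ range r, if Sq t = S then 1 else 0) A i =
      T.pend Γ A i + ∑ k ∈ range T.N, (if T.ent k = i then
        γ * ∑ t ∈ range r, (if Sq t = T.seg k then (1 : ℝ) else 0) else 0) := by
    rw [Tab.pend, Tab.pend, ← sum_add_distrib]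
    refine sum_congr rfl fun k _ => ?_
    split <;> ring
  rw [h₁, hT.entries.sum i i.2 fun S => γ * ∑ t ∈ range r, (if Sq t = S then (1 : ℝ) else 0)]
  congr 1
  have h₂ : ∑ S ∈ range (T.M * T.M), (if T.Mem i S then
      γ * ∑ t ∈ range r, (if Sq t = S then (1 : ℝ) else 0) else 0) =
      γ * ((∑ t ∈ range r, if T.Mem i (Sq t) then 1 else 0 : ℕ) : ℝ) := by
    push_cast
    have h₃ : ∀ S, (if T.Mem i S then γ * ∑ t ∈ range r, (if Sq t = S then (1 : ℝ) else 0) else 0) =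
        ∑ t ∈ range r, if Sq t = S then γ * (if T.Mem i S then 1 else 0) else 0 := by
      intro S
      split
      · rw [mul_sum]; simp
      · simp
    simp_rw [h₃]
    rw [sum_comm, mul_sum]
    refine sum_congr rfl fun t ht => ?_
    rw [sum_ite_eq, if_pos (mem_range.mpr (h.lt t (mem_range.mp ht)))]
  rw [h₂]
  by_cases hi : i ∈ P.cut q
  · simp [h.sum_mem i hi, hi]
  · simp [h.sum_not_mem i hi, hi]

end Tab.Splits

end LazyIncCuts

namespace LazyIncCuts

open RealRAM Finset

/-! ### Decomposition of intervals into dyadic intervals -/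

/-- The number of the nodes `A 0, …, A (a - 1)` that contain the position `x`. -/
def nodeCount (n : ℕ) (A : ℕ → ℕ) (a x : ℕ) : ℕ :=
  ∑ i ∈ range a, if InNode n x (A i) then 1 else 0

theorem nodeCount_append (n : ℕ) (A : ℕ → ℕ) (a x I : ℕ) :
    nodeCount n (Function.update A a I) (a + 1) x =
      nodeCount n A a x + if InNode n x I then 1 else 0 := by
  rw [nodeCount, sum_range_succ, Function.update_self]
  congr 1
  refine sum_congr rfl fun i hi => ?_
  rw [Function.update_of_ne (by simp at hi; omega)]

theorem inNode_iff {n x k j : ℕ} (hj : j < n) : InNode n x (k * n + j) ↔ x / 2 ^ k = j := by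
  rw [InNode, add_comm, Nat.add_mul_div_right _ _ (by omega), Nat.div_eq_of_lt hj, zero_add,
    Nat.add_mul_mod_self_right, Nat.mod_eq_of_lt hj]

/-- Appends to the word array `A`, with length in the word register `c`, a decomposition of the
interval `[l, r)` into dyadic intervals, where `l` and `r` are given in word registers. -/
def decompose (l r A c : ℕ) : Cmd :=
  Instr.nmove 19 l ;; Instr.nmove 20 r ;; Instr.nconst 21 0 ;;
  .loop (.nlt 19 20)
    (Instr.nop .mod 22 19 8 ;;
      .cond (.neq 22 7)
        (Instr.nop .add 23 21 19 ;; Instr.nstore A c 23 ;; Instr.nop .add c c 7 ;;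
          Instr.nop .add 19 19 7) .skip ;;
      Instr.nop .mod 22 20 8 ;;
      .cond (.neq 22 7)
        (Instr.nop .sub 20 20 7 ;; Instr.nop .add 23 21 20 ;; Instr.nstore A c 23 ;;
          Instr.nop .add c c 7) .skip ;;
      Instr.nop .div 19 19 8 ;; Instr.nop .div 20 20 8 ;; Instr.nop .add 21 21 0)

theorem forall_lt_update {A : ℕ → ℕ} {a M v : ℕ} (h : ∀ i < a, A i < M) (hv : v < M) :
    ∀ i < a + 1, Function.update A a v i < M := by
  intro i hi
  by_cases hia : i = a
  · subst hia; simpa using hv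
  · rw [Function.update_of_ne hia]
    exact h i (by omega)

/-- Bottom-up decomposition as in a segment tree. At level `k` the rest of the interval is measured
in blocks of length 2^k; a block at an odd end is split off as a node, after which both ends are
even and can be halved. Each level yields at most two nodes. -/
theorem wp_decompose {B n H M τ l r A c lv rv : ℕ} {s : Store} (hc : c = 24 ∨ c = 25)
    (h0 : s.nreg 0 = n) (h7 : s.nreg 7 = 1) (h8 : s.nreg 8 = 2) (hl : s.nreg l = lv)
    (hr : s.nreg r = rv) (hrr : r ≠ 19) (hrv : rv ≤ n) (hH : ∀ k, k < H ↔ 2 ^ k ≤ n)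
    (hM : M = H * n) (hA : ∀ i < s.nreg c, s.narr A i < M)
    (hB : M + 2 * n ≤ B) (hcB : s.nreg c + 2 * H ≤ B) :
    wp B (decompose l r A c) (fun τ' s' => τ' ≤ τ + 16 * H + 4 ∧
      s'.nreg c ≤ s.nreg c + 2 * H ∧ (∀ i < s'.nreg c, s'.narr A i < M) ∧
      ∀ x, nodeCount n (s'.narr A) (s'.nreg c) x =
        nodeCount n (s.narr A) (s.nreg c) x + if lv ≤ x ∧ x < rv then 1 else 0) τ s := by
  simp only [decompose, wp_seq, wp_instr, Instr.Fits, Instr.run, true_and, Store.setN_nreg, hrr,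
    if_false, hl, hr]
  refine ⟨Nat.zero_le _, ?_⟩
  -- Conserved quantity: the nodes found so far together with the remaining range of level-`k`
  -- blocks cover each position as often as required. Register 21 holds `k * n`, the number of the
  -- first node of level `k`.
  refine wp_loop (fun τ₁ s₁ => ∃ k ≤ H, τ₁ ≤ τ + 16 * k + 3 ∧ s₁.nreg 21 = k * n ∧
      s₁.nreg 20 * 2 ^ k ≤ n ∧ s₁.nreg c ≤ s.nreg c + 2 * k ∧ (∀ i < s₁.nreg c, s₁.narr A i < M) ∧
      ∀ x, nodeCount n (s₁.narr A) (s₁.nreg c) x +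
          (if s₁.nreg 19 ≤ x / 2 ^ k ∧ x / 2 ^ k < s₁.nreg 20 then 1 else 0) =
        nodeCount n (s.narr A) (s.nreg c) x + if lv ≤ x ∧ x < rv then 1 else 0)
    (fun s₁ => s₁.nreg 20) ?_ ?_ ?_
  · refine ⟨0, Nat.zero_le _, by omega, by simp, by simpa using hrv, ?_, ?_, ?_⟩ <;>
      rcases hc with rfl | rfl <;> first | exact hA | simp
  · rintro τ₁ s₁ hf ⟨k, hk, hτ, h21, h20, hcl, hAl, hcnt⟩ hb
    simp only [Test.Holds] at hb
    have e0 : s₁.nreg 0 = n := by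
      rcases hc with rfl | rfl <;> rw [hf.nreg 0 (by simp [Cmd.writes, Instr.target])] <;> simp [h0]
    have e7 : s₁.nreg 7 = 1 := by
      rcases hc with rfl | rfl <;> rw [hf.nreg 7 (by simp [Cmd.writes, Instr.target])] <;> simp [h7]
    have e8 : s₁.nreg 8 = 2 := by
      rcases hc with rfl | rfl <;> rw [hf.nreg 8 (by simp [Cmd.writes, Instr.target])] <;> simp [h8]
    generalize hl₁ : s₁.nreg 19 = l₁ at hb hcnt
    generalize hr₁ : s₁.nreg 20 = r₁ at hb hcnt h20
    have hpk : 1 ≤ 2 ^ k := Nat.one_le_two_pow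
    have hrn : r₁ ≤ n := le_trans (Nat.le_mul_of_pos_right _ hpk) h20
    -- The loop test gives `r₁ ≥ 1`, hence 2^k ≤ n, which limits the number of rounds by `H`.
    have hkH : k < H := (hH k).mpr (le_trans (Nat.le_mul_of_pos_left _ (by omega)) h20)
    have hkn : k * n + n ≤ M := by
      rw [hM, ← Nat.succ_mul]; exact Nat.mul_le_mul_right _ hkH
    have hr2 : ∀ r₂, r₂ ≤ r₁ → r₂ / 2 * 2 ^ (k + 1) ≤ n := by
      intro r₂ h₂
      calc r₂ / 2 * 2 ^ (k + 1) = (r₂ / 2 * 2) * 2 ^ k := by ring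
        _ ≤ r₁ * 2 ^ k := Nat.mul_le_mul_right _ (by omega)
        _ ≤ n := h20
    have hx : ∀ x, x / 2 ^ (k + 1) = x / 2 ^ k / 2 := fun x => by
      rw [pow_succ, Nat.div_div_eq_div_mul]
    have hml : k * n + l₁ < M := by omega
    have hmr : k * n + (r₁ - 1) < M := by omega
    have hcl' : s.nreg c + 2 * k + 2 ≤ B := by omega
    have hinl : ∀ x, InNode n x (k * n + l₁) ↔ x / 2 ^ k = l₁ := fun x => inNode_iff (by omega)
    have hinr : ∀ x, InNode n x (k * n + (r₁ - 1)) ↔ x / 2 ^ k = r₁ - 1 := fun x =>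
      inNode_iff (by omega)
    rcases hc with rfl | rfl <;>
    · simp only [wp_seq, wp_instr, wp_cond, wp_skip, Instr.Fits, Instr.run, NOp.eval, Test.Holds,
        Store.setN_nreg, Store.setN_narr, Store.putN_nreg, Store.putN_narr, Nat.reduceEqDiff,
        reduceIte, e0, e7, e8, hl₁, hr₁, h21, true_and, OfNat.ofNat_ne_zero,
        OfNat.zero_ne_ofNat]
      refine ⟨by omega, fun ho => ⟨by omega, by omega, by omega, by omega,
          fun ho' => ⟨by omega, by omega, by omega, by omega, by omega, by omega,
            ⟨k + 1, hkH, by omega, by ring, hr2 _ (by omega), by omega,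
              forall_lt_update (forall_lt_update hAl hml) hmr, ?_⟩, by omega⟩,
          fun ho' => ⟨by omega, by omega, by omega,
            ⟨k + 1, hkH, by omega, by ring, hr2 _ (by omega), by omega,
              forall_lt_update hAl hml, ?_⟩, by omega⟩⟩,
        fun ho => ⟨by omega,
          fun ho' => ⟨by omega, by omega, by omega, by omega, by omega, by omega,
            ⟨k + 1, hkH, by omega, by ring, hr2 _ (by omega), by omega,
              forall_lt_update hAl hmr, ?_⟩, by omega⟩,
          fun ho' => ⟨by omega, by omega, by omega,
            ⟨k + 1, hkH, by omega, by ring, hr2 _ (by omega), by omega, hAl, ?_⟩, by omega⟩⟩⟩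
      all_goals
        intro x
        rw [← hcnt x]
        simp only [nodeCount_append, hx, hinl, hinr]
        generalize x / 2 ^ k = y
        clear hcnt hinl hinr hx hr2 hf
        split_ifs <;> omega
  · rintro τ₁ s₁ hf ⟨k, hk, hτ, h21, h20, hcl, hAl, hcnt⟩ hb
    simp only [Test.Holds] at hb
    refine ⟨by omega, by omega, hAl, fun x => ?_⟩
    rw [← hcnt x, if_neg (by omega), add_zero]

/-! ### Splitting a cut into canonical cuts -/

/-- Sorts the contents of two word registers. -/
def sortPair (x y : ℕ) : Cmd :=
  .cond (.nlt y x) (Instr.nmove 18 x ;; Instr.nmove x y ;; Instr.nmove y 18) .skip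

/-- Computes in the word registers 14 to 17 the sorted end points of the interval or the two
intervals of the cut that was passed. -/
def breakpoints : Cmd :=
  Instr.nload 14 4 4 ;; Instr.nload 15 5 4 ;;
  .cond (.neq 3 7) (Instr.nmove 16 15 ;; Instr.nmove 17 15)
    (Instr.nload 16 4 5 ;; Instr.nload 17 5 5) ;;
  sortPair 14 16 ;; sortPair 15 17 ;; sortPair 15 16

theorem wp_sortPair {B τ x y : ℕ} {s : Store} (hxy : x ≠ y) (hx : x ≠ 18) (hy : y ≠ 18) :
    wp B (sortPair x y) (fun τ' s' => τ' ≤ τ + 4 ∧ s'.nreg x = min (s.nreg x) (s.nreg y) ∧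
      s'.nreg y = max (s.nreg x) (s.nreg y)) τ s := by
  simp only [sortPair, wp_seq, wp_instr, wp_cond, wp_skip, Instr.Fits, Instr.run, Test.Holds,
    Store.setN_nreg, hxy, hxy.symm, hx, hy, reduceIte, true_and, hx.symm, hy.symm]
  refine ⟨fun h => ⟨by omega, ?_, ?_⟩, fun h => ⟨by omega, ?_, ?_⟩⟩ <;> omega

/-- Membership in the union of two consecutive intervals. -/
def InSide (a b c d x : ℕ) : Prop := (a ≤ x ∧ x < b) ∨ (c ≤ x ∧ x < d)

instance (a b c d : ℕ) : DecidablePred (InSide a b c d) := fun x => by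
  unfold InSide; infer_instance

/-- The side is a symmetric difference of two label intervals. Its indicator changes exactly at
their four end points, so sorting these gives two consecutive intervals, whether the down sets are
nested or disjoint. For a 1-cut the second interval is taken to be empty. -/
theorem wp_breakpoints {P : Input} {B τ : ℕ} {s : Store} (hT : (view s).Ok P) (q : CutDesc P.n) :
    wp B breakpoints (fun τ' s' => τ' ≤ τ + 17 ∧ s'.nreg 14 ≤ s'.nreg 15 ∧
      s'.nreg 15 ≤ s'.nreg 16 ∧ s'.nreg 16 ≤ s'.nreg 17 ∧ s'.nreg 17 ≤ P.n ∧
      ∀ u : Fin P.n, u ∈ P.side q ↔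
        InSide (s'.nreg 14) (s'.nreg 15) (s'.nreg 16) (s'.nreg 17) ((view s).tin u))
      τ (pass s q) := by
  have h7 : s.nreg 7 = 1 := hT.one_eq
  have hlab := hT.labels
  have hout : ∀ u : Fin P.n, s.narr 5 u ≤ P.n := fun u =>
    (hlab.tout_le u).trans (by simp)
  have hlt : ∀ u : Fin P.n, s.narr 4 u < s.narr 5 u := fun u => hlab.tin_lt (mem_univ u)
  have hdown : ∀ u v : Fin P.n, u ∈ P.down v ↔ s.narr 4 v ≤ s.narr 4 u ∧ s.narr 4 u < s.narr 5 v :=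
    fun u v => hlab.mem_down u (mem_univ u) v (mem_univ v)
  -- Starts and ends are already in order within each interval, so three exchanges suffice: order
  -- the two starts, order the two ends, and order the middle pair.
  have key : ∀ (τ₁ : ℕ) (s₁ : Store), s₁.nreg 14 ≤ s₁.nreg 15 → s₁.nreg 16 ≤ s₁.nreg 17 →
      s₁.nreg 15 ≤ P.n → s₁.nreg 17 ≤ P.n → wp B (sortPair 14 16 ;; sortPair 15 17 ;; sortPair 15 16)
      (fun τ' s' => τ' ≤ τ₁ + 12 ∧ s'.nreg 14 ≤ s'.nreg 15 ∧
        s'.nreg 15 ≤ s'.nreg 16 ∧ s'.nreg 16 ≤ s'.nreg 17 ∧ s'.nreg 17 ≤ P.n ∧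
        ∀ x, InSide (s'.nreg 14) (s'.nreg 15) (s'.nreg 16) (s'.nreg 17) x ↔
          Xor (s₁.nreg 14 ≤ x ∧ x < s₁.nreg 15) (s₁.nreg 16 ≤ x ∧ x < s₁.nreg 17)) τ₁ s₁ := by
    intro τ₁ s₁ h₁ h₂ h₃ h₄
    rw [wp_seq]
    refine (wp_sortPair (by decide) (by decide) (by decide)).mono ?_
    rintro τ₂ s₂ hf₂ ⟨ht₂, a₂, b₂⟩
    rw [wp_seq]
    refine (wp_sortPair (by decide) (by decide) (by decide)).mono ?_
    rintro τ₃ s₃ hf₃ ⟨ht₃, a₃, b₃⟩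
    refine (wp_sortPair (by decide) (by decide) (by decide)).mono ?_
    rintro τ₄ s₄ hf₄ ⟨ht₄, a₄, b₄⟩
    have c₁ : s₄.nreg 14 = s₂.nreg 14 := by rw [hf₄.nreg 14 (by decide), hf₃.nreg 14 (by decide)]
    have c₂ : s₄.nreg 17 = s₃.nreg 17 := hf₄.nreg 17 (by decide)
    have c₃ : s₃.nreg 16 = s₂.nreg 16 := hf₃.nreg 16 (by decide)
    have c₄ : s₂.nreg 15 = s₁.nreg 15 := hf₂.nreg 15 (by decide)
    have c₅ : s₂.nreg 17 = s₁.nreg 17 := hf₂.nreg 17 (by decide)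
    refine ⟨by omega, by omega, by omega, by omega, by omega, fun x => ?_⟩
    simp only [InSide, Xor, c₁, c₂, a₄, b₄, c₃, b₂, a₂, a₃, b₃, c₄, c₅]
    omega
  rw [breakpoints]
  cases q with
  | one u =>
    simp only [pass, wp_seq, wp_instr, wp_cond, wp_skip, Instr.Fits, Instr.run, Test.Holds,
      Store.setN_nreg, Store.setN_narr, Nat.reduceEqDiff, reduceIte, true_and, h7, forall_true_left,
      not_true_eq_false, false_imp_iff, and_true]
    have hu := hlt u
    have hu' := hout u
    simp only [← wp_seq]
    refine (key _ _ ?_ ?_ ?_ ?_).mono ?_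
    any_goals simp
    any_goals omega
    intro τ₃ s₃ _ ht h₁ h₂ h₃ h₄ hx
    refine ⟨by omega, h₁, h₂, h₃, h₄, fun v => ?_⟩
    rw [hx, Input.side, hdown]
    change _ ↔ Xor (_ ≤ s.narr 4 v ∧ s.narr 4 v < _) (_ ≤ s.narr 4 v ∧ s.narr 4 v < _)
    simp only [Xor]
    omega
  | two u v =>
    simp only [pass, wp_seq, wp_instr, wp_cond, wp_skip, Instr.Fits, Instr.run, Test.Holds,
      Store.setN_nreg, Store.setN_narr, Nat.reduceEqDiff, reduceIte, true_and, h7, forall_true_left,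
      not_false_eq_true, false_imp_iff, OfNat.ofNat_ne_one]
    have hu := hlt u
    have hu' := hout u
    have hv := hlt v
    have hv' := hout v
    simp only [← wp_seq]
    refine (key _ _ ?_ ?_ ?_ ?_).mono ?_
    any_goals simp
    any_goals omega
    intro τ₃ s₃ _ ht h₁ h₂ h₃ h₄ hx
    refine ⟨by omega, h₁, h₂, h₃, h₄, fun w => ?_⟩
    rw [hx, P.mem_side_two, hdown, hdown]
    rfl

end LazyIncCuts

/-! ### The canonical cuts of a given cut. -/

namespace LazyIncCuts

open RealRAM Finset

/-- Splits the cut that was passed into canonical cuts, which are the products of the nodes listed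
in the word arrays 12 and 13. -/
def splitCut : Cmd :=
  breakpoints ;; Instr.nconst 24 0 ;; Instr.nconst 25 0 ;;
  decompose 9 14 13 25 ;; decompose 14 15 12 24 ;; decompose 15 16 13 25 ;;
  decompose 16 17 12 24 ;; decompose 17 0 13 25 ;; Instr.nop .mul 26 24 25

/-- The `t`-th canonical cut of the current cut. -/
def canonical (s : Store) (t : ℕ) : ℕ :=
  s.narr 12 (t / s.nreg 25) * s.nreg 11 + s.narr 13 (t % s.nreg 25)

theorem view_pass {n : ℕ} (s : Store) (q : CutDesc n) : view (pass s q) = view s := by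
  cases q <;> simp [view, pass]

/-- A program that does not write to the static part of the store. -/
def Cmd.KeepsTables (c : Cmd) : Prop :=
  ∀ l ∈ c.writes, l ∉ [Loc.nreg 0, .nreg 1, .nreg 7, .nreg 8, .nreg 9, .nreg 10, .nreg 11, .nreg 13,
    .narr 0, .narr 1, .narr 4, .narr 5, .narr 7, .narr 9, .narr 10, .narr 11,
    .rreg 0, .rreg 1, .rarr 0, .rarr 3]

instance (c : Cmd) : Decidable (Cmd.KeepsTables c) := by unfold Cmd.KeepsTables; infer_instance

theorem view_eq_of_frame {c : Cmd} {s s' : Store} (hc : Cmd.KeepsTables c) (hf : Frame c s s') :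
    view s' = view s := by
  have key : ∀ l ∈ [Loc.nreg 0, .nreg 1, .nreg 7, .nreg 8, .nreg 9, .nreg 10, .nreg 11, .nreg 13,
    .narr 0, .narr 1, .narr 4, .narr 5, .narr 7, .narr 9, .narr 10, .narr 11,
    .rreg 0, .rreg 1, .rarr 0, .rarr 3], l.Same s s' :=
    fun l hl => hf l fun h => hc l h hl
  simp only [List.mem_cons, List.not_mem_nil, or_false, forall_eq_or_imp, forall_eq,
    Loc.Same] at key
  simp only [view, key]

/-- The intervals [a, b) and [c, d) of the side go to array 12, the gaps [0, a), [b, c) and [d, n)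
to array 13. With at most 2H nodes per interval there are at most 4H · 6H products. -/
theorem wp_splitCut {P : Input} {B τ : ℕ} {s : Store} (hT : (view s).Ok P) (q : CutDesc P.n)
    (hB : 100 * P.n ^ 8 ≤ B) :
    wp B splitCut (fun τ' s' => τ' ≤ τ + 80 * (view s).H + 40 ∧
      s'.nreg 26 ≤ 24 * (view s).H ^ 2 ∧
      (view s).Splits P q (canonical s') (s'.nreg 26)) τ (pass s q) := by
  have hn := P.two_le_n
  have hp : ∀ k ≤ 8, P.n ^ k ≤ P.n ^ 8 := fun k hk => Nat.pow_le_pow_right (by omega) hk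
  have hp1 : P.n ≤ P.n ^ 8 := by simpa using hp 1 (by norm_num)
  have hp2 := hp 2 (by norm_num)
  have hH := hT.H_le
  have hM := hT.M_le
  have hH' := hT.lt_H_iff
  have hMe := hT.M_eq
  set H := (view s).H
  set M := (view s).M with hMdef
  have hHH : H * H ≤ P.n ^ 2 := by rw [sq]; exact Nat.mul_le_mul hH hH
  rw [splitCut, wp_seq]
  refine (wp_breakpoints hT q).mono ?_
  rintro τ₁ s₁ hf₁ ⟨ht₁, h₁, h₂, h₃, h₄, hside⟩
  have v₁ : view s₁ = view s := by rw [view_eq_of_frame (by decide) hf₁, view_pass]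
  have ok : ∀ s', view s' = view s → s'.nreg 0 = P.n ∧ s'.nreg 7 = 1 ∧ s'.nreg 8 = 2 ∧
      s'.nreg 9 = 0 ∧ s'.nreg 11 = M := by
    intro s' h
    have hT' : (view s').Ok P := h ▸ hT
    exact ⟨hT'.n_eq, hT'.one_eq, hT'.two_eq, hT'.zero_eq, by rw [hMdef, ← h]; rfl⟩
  simp only [wp_seq, wp_instr, Instr.Fits, Instr.run]
  refine ⟨Nat.zero_le _, Nat.zero_le _, ?_⟩
  generalize hs₂ : (s₁.setN 24 0).setN 25 0 = s₂
  have v₂ : view s₂ = view s := by rw [← v₁, ← hs₂]; simp [view]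
  have r14 : s₂.nreg 14 = s₁.nreg 14 := by rw [← hs₂]; simp
  have r15 : s₂.nreg 15 = s₁.nreg 15 := by rw [← hs₂]; simp
  have r16 : s₂.nreg 16 = s₁.nreg 16 := by rw [← hs₂]; simp
  have r17 : s₂.nreg 17 = s₁.nreg 17 := by rw [← hs₂]; simp
  have r24 : s₂.nreg 24 = 0 := by rw [← hs₂]; simp
  have r25 : s₂.nreg 25 = 0 := by rw [← hs₂]; simp
  generalize s₁.nreg 14 = a at *
  generalize s₁.nreg 15 = b at *
  generalize s₁.nreg 16 = c at *
  generalize s₁.nreg 17 = d at *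
  obtain ⟨z0, z7, z8, z9, -⟩ := ok s₂ v₂
  refine (wp_decompose (B := B) (n := P.n) (H := H) (M := M) (lv := 0) (rv := a) (Or.inr rfl) z0 z7 z8 z9
    r14 (by decide) (by omega) hH' hMe (by simp [r25]) (by omega) (by omega)).mono ?_
  rintro τ₃ s₃ hf₃ ⟨ht₃, c₃, m₃, n₃⟩
  have v₃ : view s₃ = view s := by rw [view_eq_of_frame (by decide) hf₃, v₂]
  obtain ⟨z0, z7, z8, z9, -⟩ := ok s₃ v₃
  have e24 : s₃.nreg 24 = 0 := by rw [hf₃.nreg 24 (by decide), r24]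
  rw [wp_seq]
  refine (wp_decompose (B := B) (n := P.n) (H := H) (M := M) (lv := a) (rv := b) (Or.inl rfl) z0 z7 z8
    (by rw [hf₃.nreg 14 (by decide), r14]) (by rw [hf₃.nreg 15 (by decide), r15])
    (by decide) (by omega) hH' hMe (by simp [e24]) (by omega) (by omega)).mono ?_
  rintro τ₄ s₄ hf₄ ⟨ht₄, c₄, m₄, n₄⟩
  have v₄ : view s₄ = view s := by rw [view_eq_of_frame (by decide) hf₄, v₃]
  obtain ⟨z0, z7, z8, z9, -⟩ := ok s₄ v₄
  have e25 : s₄.nreg 25 = s₃.nreg 25 := hf₄.nreg 25 (by decide)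
  have e13 : s₄.narr 13 = s₃.narr 13 := hf₄.narr 13 (by decide)
  rw [wp_seq]
  refine (wp_decompose (B := B) (n := P.n) (H := H) (M := M) (lv := b) (rv := c) (Or.inr rfl) z0 z7 z8
    (by rw [hf₄.nreg 15 (by decide), hf₃.nreg 15 (by decide), r15])
    (by rw [hf₄.nreg 16 (by decide), hf₃.nreg 16 (by decide), r16])
    (by decide) (by omega) hH' hMe (by rw [e25, e13]; exact m₃) (by omega) (by omega)).mono ?_
  rintro τ₅ s₅ hf₅ ⟨ht₅, c₅, m₅, n₅⟩
  have v₅ : view s₅ = view s := by rw [view_eq_of_frame (by decide) hf₅, v₄]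
  obtain ⟨z0, z7, z8, z9, -⟩ := ok s₅ v₅
  have g24 : s₅.nreg 24 = s₄.nreg 24 := hf₅.nreg 24 (by decide)
  have g12 : s₅.narr 12 = s₄.narr 12 := hf₅.narr 12 (by decide)
  rw [wp_seq]
  refine (wp_decompose (B := B) (n := P.n) (H := H) (M := M) (lv := c) (rv := d) (Or.inl rfl) z0 z7 z8
    (by rw [hf₅.nreg 16 (by decide), hf₄.nreg 16 (by decide), hf₃.nreg 16 (by decide), r16])
    (by rw [hf₅.nreg 17 (by decide), hf₄.nreg 17 (by decide), hf₃.nreg 17 (by decide), r17])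
    (by decide) (by omega) hH' hMe (by rw [g24, g12]; exact m₄) (by omega) (by omega)).mono ?_
  rintro τ₆ s₆ hf₆ ⟨ht₆, c₆, m₆, n₆⟩
  have v₆ : view s₆ = view s := by rw [view_eq_of_frame (by decide) hf₆, v₅]
  obtain ⟨z0, z7, z8, z9, -⟩ := ok s₆ v₆
  have k25 : s₆.nreg 25 = s₅.nreg 25 := hf₆.nreg 25 (by decide)
  have k13 : s₆.narr 13 = s₅.narr 13 := hf₆.narr 13 (by decide)
  rw [wp_seq]
  refine (wp_decompose (B := B) (n := P.n) (H := H) (M := M) (lv := d) (rv := P.n) (Or.inr rfl) z0 z7 z8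
    (by rw [hf₆.nreg 17 (by decide), hf₅.nreg 17 (by decide), hf₄.nreg 17 (by decide),
      hf₃.nreg 17 (by decide), r17]) z0
    (by decide) (by omega) hH' hMe (by rw [k25, k13]; exact m₅) (by omega) (by omega)).mono ?_
  rintro τ₇ s₇ hf₇ ⟨ht₇, c₇, m₇, n₇⟩
  have v₇ : view s₇ = view s := by rw [view_eq_of_frame (by decide) hf₇, v₆]
  have l24 : s₇.nreg 24 = s₆.nreg 24 := hf₇.nreg 24 (by decide)
  have l12 : s₇.narr 12 = s₆.narr 12 := hf₇.narr 12 (by decide)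
  have i24 : s₇.nreg 24 ≤ 4 * H := by omega
  have i25 : s₇.nreg 25 ≤ 6 * H := by omega
  have hmul : s₇.nreg 24 * s₇.nreg 25 ≤ 24 * H ^ 2 := by
    calc _ ≤ (4 * H) * (6 * H) := Nat.mul_le_mul i24 i25
      _ = 24 * H ^ 2 := by ring
  have hH2 : H ^ 2 ≤ P.n ^ 2 := by rw [sq H]; exact hHH
  rw [wp_instr]
  simp only [Instr.Fits, Instr.run, NOp.eval, Store.setN_nreg, if_true]
  refine ⟨by omega, by omega, hmul, ?_⟩
  have hcan : canonical (s₇.setN 26 (s₇.nreg 24 * s₇.nreg 25)) = fun t =>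
      s₇.narr 12 (t / s₇.nreg 25) * (view s).M + s₇.narr 13 (t % s₇.nreg 25) := by
    funext t
    simp [canonical, (ok s₇ v₇).2.2.2.2, hMdef]
  rw [hcan]
  have zero : ∀ (A : ℕ → ℕ) x, nodeCount P.n A 0 x = 0 := fun A x => by simp [nodeCount]
  have n₄' : ∀ x, nodeCount P.n (s₄.narr 12) (s₄.nreg 24) x = if a ≤ x ∧ x < b then 1 else 0 := by
    intro x; rw [n₄ x, e24, zero, zero_add]
  have n₃' : ∀ x, nodeCount P.n (s₃.narr 13) (s₃.nreg 25) x = if 0 ≤ x ∧ x < a then 1 else 0 := by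
    intro x; rw [n₃ x, r25, zero, zero_add]
  refine hT.splits (p := InSide a b c d) hside ?_ ?_ ?_ m₇
  · intro x hx
    change nodeCount P.n (s₇.narr 12) (s₇.nreg 24) x = _
    rw [l24, l12, n₆ x, g24, g12, n₄' x]
    by_cases hc : InSide a b c d x
    · rw [if_pos hc]
      simp only [InSide] at hc
      split_ifs <;> omega
    · rw [if_neg hc]
      simp only [InSide] at hc
      split_ifs <;> omega
  · intro x hx
    change nodeCount P.n (s₇.narr 13) (s₇.nreg 25) x = _
    rw [n₇ x, k25, k13, n₅ x, e25, e13, n₃' x]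
    by_cases hc : InSide a b c d x
    · rw [if_neg (not_not.mpr hc)]
      simp only [InSide] at hc
      split_ifs <;> omega
    · rw [if_pos hc]
      simp only [InSide] at hc
      split_ifs <;> omega
  · rw [l24, l12]; exact m₆

end LazyIncCuts

namespace LazyIncCuts

open RealRAM Finset

/-! ### Passing on the increments of a canonical cut -/

/-- The result of passing on the lag of the entries of `S` before the entry `j`. -/
def Tab.advance (T : Tab) (S j : ℕ) (γ : ℝ) (A : ℕ → ℝ) (k : ℕ) : ℝ :=
  if T.st S ≤ k ∧ k < j then γ else A k

theorem Tab.advance_start (T : Tab) (S : ℕ) (γ : ℝ) (A : ℕ → ℝ) :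
    T.advance S (T.st S) γ A = A := by
  funext k
  rw [advance, if_neg (by omega)]

theorem Tab.advance_succ (T : Tab) {S j : ℕ} (γ : ℝ) (A : ℕ → ℝ) (hj : T.st S ≤ j) :
    Function.update (T.advance S j γ A) j γ = T.advance S (j + 1) γ A := by
  funext k
  by_cases hk : k = j
  · subst hk; simp [advance, hj]
  · rw [Function.update_of_ne hk, advance, advance]
    refine if_congr ?_ rfl rfl
    omega

theorem Tab.advance_self (T : Tab) (S j : ℕ) (γ : ℝ) (A : ℕ → ℝ) : T.advance S j γ A j = A j := by
  rw [advance, if_neg (by omega)]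

/-- Passing on lags in a canonical cut until an entry below its threshold restores the
invariants of that canonical cut and keeps those of the others. -/
theorem Tab.Ok.lazy_advance {P : Input} {T : Tab} (hT : T.Ok P) {Γ A : ℕ → ℝ} {S j : ℕ}
    (hl : T.Lazy Γ A) (hS : S < T.M * T.M) (hj : T.st S ≤ j) (hj' : j ≤ T.st (S + 1))
    (hot : ∀ k, T.st S ≤ k → k < j → T.thr (T.ent k) ≤ Γ S - A k)
    (below : j < T.st (S + 1) → Γ S - A j < T.thr (T.ent j)) :
    T.Lazy Γ (T.advance S j (Γ S) A) ∧ T.Head Γ (T.advance S j (Γ S) A) S ∧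
      ∀ S' < T.M * T.M, T.Head Γ A S' → T.Head Γ (T.advance S j (Γ S) A) S' := by
  -- The segments of different canonical cuts are disjoint, because each entry knows the cut it
  -- belongs to.
  have hother : ∀ S' < T.M * T.M, S' ≠ S → ∀ k, T.st S' ≤ k → k < T.st (S' + 1) →
      T.advance S j (Γ S) A k = A k := by
    intro S' hS' hne k h₁ h₂
    rw [advance, if_neg]
    rintro ⟨h₃, h₄⟩
    have e₁ := (hT.entries.seg S' hS' k h₁ h₂).1
    have e₂ := (hT.entries.seg S hS k h₃ (by omega)).1
    exact hne (e₁ ▸ e₂)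
  have hlt : ∀ k, k < j → T.st S ≤ k → T.advance S j (Γ S) A k = Γ S := fun k h₁ h₂ => by
    rw [advance, if_pos ⟨h₂, h₁⟩]
  have hge : ∀ k, j ≤ k → T.advance S j (Γ S) A k = A k := fun k h => by
    rw [advance, if_neg (by omega)]
  have hAS : ∀ k, T.st S ≤ k → k < T.st (S + 1) → A k ≤ Γ S := fun k h₁ h₂ => by
    have := hl.le k (hT.lt_N hS h₂)
    rwa [(hT.entries.seg S hS k h₁ h₂).1] at this
  have hhead : T.Head Γ (T.advance S j (Γ S) A) S := by
    intro h
    rcases hj.lt_or_eq with h' | h'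
    · rw [hlt _ h' le_rfl, sub_self]
      exact hT.thr_pos (hT.ent_lt (hT.lt_N hS h))
    · rw [hge _ h'.ge, h']
      exact below (h' ▸ h)
  refine ⟨⟨?_, ?_, ?_, ?_⟩, hhead, ?_⟩
  · intro k hk
    rw [advance]
    split
    · rename_i h
      rw [(hT.entries.seg S hS k h.1 (by omega)).1]
    · exact hl.le k hk
  · intro S' hS' k h₁ h₂
    by_cases hne : S' = S
    · subst hne
      rcases lt_trichotomy (k + 1) j with h | h | h
      · rw [hlt _ h (by omega), hlt k (by omega) h₁]
      · rw [hge _ h.ge, hlt k (by omega) h₁]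
        exact hAS _ (by omega) h₂
      · rw [hge (k + 1) (by omega), hge k (by omega)]
        exact hl.succ_le S' hS' k h₁ h₂
    · rw [hother S' hS' hne _ h₁ (by omega), hother S' hS' hne _ (by omega) h₂]
      exact hl.succ_le S' hS' k h₁ h₂
  · intro S' hS' k h₁ h₂
    by_cases hne : S' = S
    · subst hne
      rcases lt_trichotomy (k + 1) j with h | h | h
      · rw [hlt _ h (by omega), hlt k (by omega) h₁, sub_self]
        exact hT.thr_pos (hT.ent_lt (hT.lt_N hS h₂))
      · rw [hge _ h.ge, hlt k (by omega) h₁, h]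
        exact below (by omega)
      · rw [hge (k + 1) (by omega), hge k (by omega)]
        exact hl.sub_lt S' hS' k h₁ h₂
    · rw [hother S' hS' hne _ h₁ (by omega), hother S' hS' hne _ (by omega) h₂]
      exact hl.sub_lt S' hS' k h₁ h₂
  · intro S' hS' k h₁ h₂ heq
    by_cases hne : S' = S
    · subst hne
      rcases lt_trichotomy (k + 1) j with h | h | h
      · rw [hlt _ h (by omega), hlt k (by omega) h₁]
      -- Here `k + 1 = j` is where the scan stopped. With equal thresholds both entries had the same
      -- state, so entry `k` would have been below its threshold too and could not have been passed
      -- on.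
      · have e := hl.eq_of_eq S' hS' k h₁ h₂ heq
        have a := hot k h₁ (by omega)
        have b := below (by omega)
        rw [← h, ← e, ← heq] at b
        exact absurd a (not_le.mpr b)
      · rw [hge (k + 1) (by omega), hge k (by omega)]
        exact hl.eq_of_eq S' hS' k h₁ h₂ heq
    · rw [hother S' hS' hne _ h₁ (by omega), hother S' hS' hne _ (by omega) h₂]
      exact hl.eq_of_eq S' hS' k h₁ h₂ heq
  · intro S' hS' hh
    by_cases hne : S' = S
    · exact hne ▸ hhead
    · intro h
      rw [hother S' hS' hne _ le_rfl h]
      exact hh h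

theorem Tab.pend_update (T : Tab) (Γ A : ℕ → ℝ) {k : ℕ} (hk : k < T.N) (x : ℝ) (e : ℕ) :
    T.pend Γ (Function.update A k x) e =
      T.pend Γ A e - if T.ent k = e then x - A k else 0 := by
  rw [pend, pend, eq_sub_iff_add_eq, ← sum_erase_add _ _ (mem_range.mpr hk),
    ← sum_erase_add (range T.N) (fun j => if T.ent j = e then Γ (T.seg j) - A j else 0)
      (mem_range.mpr hk), add_assoc]
  congr 1
  · refine sum_congr rfl fun j hj => ?_
    rw [Function.update_of_ne (ne_of_mem_erase hj)]
  · rw [Function.update_self]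
    split <;> ring

/-- The approximate weights `wt` result from `w₀` by the `cnt` increments `od` to the edges `oe`,
each of them at least `θ w`, and the exact weights `w` result from `wt` by passing on all lags. -/
structure Emitted (P : Input) (T : Tab) (Γ A : ℕ → ℝ) (w w₀ : Fin P.m → ℝ) (θ : ℝ)
    (wt : ℕ → ℝ) (cnt : ℕ) (oe : ℕ → ℕ) (od : ℕ → ℝ) : Prop where
  exact_eq : ∀ i : Fin P.m, w i = wt i * Real.exp (P.ε * T.pend Γ A i / P.cap i)
  sum_eq : ∀ i : Fin P.m, wt i = w₀ i + ∑ j ∈ range cnt, if oe j = i then od j else 0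
  large : ∀ j < cnt, ∃ i : Fin P.m, oe j = i ∧ θ * w i ≤ od j
  pos : ∀ i : Fin P.m, 0 < wt i
  pend_le : ∀ i : Fin P.m, T.pend Γ A i ≤ 5 * P.cap i

theorem sum_update_append (cnt : ℕ) (oe : ℕ → ℕ) (od : ℕ → ℝ) (e : ℕ) (δ : ℝ) (i : ℕ) :
    ∑ j ∈ range (cnt + 1), (if Function.update oe cnt e j = i then
      Function.update od cnt δ j else 0) =
    ∑ j ∈ range cnt, (if oe j = i then od j else 0) + if e = i then δ else 0 := by
  rw [sum_range_succ, Function.update_self, Function.update_self]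
  congr 1
  refine sum_congr rfl fun j hj => ?_
  rw [mem_range] at hj
  rw [Function.update_of_ne hj.ne, Function.update_of_ne hj.ne]

/-- Passing on a lag moves it from the pending exponent into the approximate weight, so the exact
weight is unchanged. The increment is large because the lag is at least the threshold, and the
approximate weight is within a factor e⁵ of the exact one. -/
theorem Emitted.step {P : Input} {T : Tab} {Γ A : ℕ → ℝ} {w w₀ : Fin P.m → ℝ} {θ : ℝ}
    {wt : ℕ → ℝ} {cnt : ℕ} {oe : ℕ → ℕ} {od : ℕ → ℝ} (hT : T.Ok P)
    (h : Emitted P T Γ A w w₀ θ wt cnt oe od)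
    (hθ : θ = Real.exp (-5) / 2 * (P.ε / (T.H : ℝ) ^ 2)) {k e : ℕ} {g new : ℝ} (hk : k < T.N)
    (he : e = T.ent k) (hlag : T.thr e ≤ g - A k)
    (hnew : new = Real.exp (P.ε * (g - A k) / T.cap e) * wt e) :
    Emitted P T Γ (Function.update A k g) w w₀ θ (Function.update wt e new) (cnt + 1)
      (Function.update oe cnt e) (Function.update od cnt (new - wt e)) := by
  have hem : e < P.m := he ▸ hT.ent_lt hk
  set ie : Fin P.m := ⟨e, hem⟩ with hie
  have hcap : T.cap e = P.cap ie := hT.cap_eq ie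
  have hcpos : 0 < P.cap ie := P.cap_pos ie
  have hthr := hT.thr_pos hem
  have hwpos : 0 < wt e := h.pos ie
  have hε := P.ε_pos
  have hne : ∀ i : Fin P.m, i ≠ ie → (i : ℕ) ≠ e := fun i hi hc => hi (Fin.ext hc)
  have hp : ∀ i : Fin P.m, i ≠ ie → T.pend Γ (Function.update A k g) i = T.pend Γ A i := by
    intro i hi
    rw [T.pend_update Γ A hk, if_neg (by rw [← he]; exact (hne i hi).symm), sub_zero]
  have hpe : T.pend Γ (Function.update A k g) e = T.pend Γ A e - (g - A k) := by
    rw [T.pend_update Γ A hk, if_pos he.symm]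
  refine ⟨fun i => ?_, fun i => ?_, fun j hj => ?_, fun i => ?_, fun i => ?_⟩
  · by_cases hi : i = ie
    · subst hi
      change w ie = Function.update wt e new e * Real.exp (P.ε * T.pend _ _ e / _)
      rw [h.exact_eq ie, Function.update_self, hnew, hpe, hcap]
      change wt e * Real.exp (P.ε * T.pend Γ A e / _) = _
      rw [mul_comm (Real.exp _) (wt e), mul_assoc, ← Real.exp_add]
      congr 2
      ring
    · rw [Function.update_of_ne (hne i hi), hp i hi, h.exact_eq i]
  · rw [sum_update_append, ← add_assoc, ← h.sum_eq i]
    by_cases hi : i = ie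
    · subst hi
      simp [hie]
    · rw [Function.update_of_ne (hne i hi), if_neg (hne i hi).symm, add_zero]
  · rcases Nat.lt_succ_iff_lt_or_eq.mp hj with h' | rfl
    · rw [Function.update_of_ne h'.ne, Function.update_of_ne h'.ne]
      exact h.large j h'
    · refine ⟨ie, by simp [hie], ?_⟩
      rw [Function.update_self, hθ, h.exact_eq ie, hnew]
      -- Rounding loses at most a factor two: the lag is at least thr > c / (2H²).
      have hx : P.ε / (2 * (T.H : ℝ) ^ 2) ≤ P.ε * (g - A k) / T.cap e := by
        have hH := hT.H_sq_pos
        have hlt := hT.cap_lt hem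
        have hcp : 0 < T.cap e := hcap ▸ hcpos
        rw [div_le_div_iff₀ (by positivity) hcp, mul_assoc]
        refine mul_le_mul_of_nonneg_left ?_ hε.le
        nlinarith [mul_le_mul_of_nonneg_right hlag hH.le]
      have hx' := Real.add_one_le_exp (P.ε * (g - A k) / T.cap e)
      -- During a call the pending exponent is at most 5c, and ε ≤ 1; this is the origin of exp (-5)
      -- in the constant.
      have hE : Real.exp (P.ε * T.pend Γ A ie / P.cap ie) ≤ Real.exp 5 := by
        refine Real.exp_le_exp.mpr ?_
        rw [div_le_iff₀ hcpos]
        have h₁ := h.pend_le ie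
        have h₂ := P.ε_le_one
        nlinarith
      have hE5 : Real.exp (-5) * Real.exp 5 = 1 := by rw [← Real.exp_add]; simp
      calc Real.exp (-5) / 2 * (P.ε / (T.H : ℝ) ^ 2) *
            (wt ie * Real.exp (P.ε * T.pend Γ A ie / P.cap ie))
          ≤ Real.exp (-5) / 2 * (P.ε / (T.H : ℝ) ^ 2) * (wt ie * Real.exp 5) := by
            have : 0 < wt ie := hwpos
            gcongr
        _ = (Real.exp (-5) * Real.exp 5) * (P.ε / (2 * (T.H : ℝ) ^ 2)) * wt e := by
            change _ * (wt e * _) = _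
            field_simp
        _ = P.ε / (2 * (T.H : ℝ) ^ 2) * wt e := by rw [hE5, one_mul]
        _ ≤ (Real.exp (P.ε * (g - A k) / T.cap e) - 1) * wt e :=
            mul_le_mul_of_nonneg_right (by linarith) hwpos.le
        _ = _ := by ring
  · by_cases hi : i = ie
    · subst hi
      change 0 < Function.update wt e new e
      rw [Function.update_self, hnew]
      positivity
    · rw [Function.update_of_ne (hne i hi)]
      exact h.pos i
  · by_cases hi : i = ie
    · subst hi
      change T.pend _ _ e ≤ _
      rw [hpe]
      have := h.pend_le ie
      change T.pend Γ A e ≤ _ at this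
      linarith
    · rw [hp i hi]
      exact h.pend_le i

theorem applyIncs_returned {m : ℕ} (s : Store) (w : Fin m → ℝ) (i : Fin m) :
    applyIncs (returned s) w i =
      w i + ∑ j ∈ range (s.nreg 6), if s.narr 3 j = i then s.rarr 2 j else 0 := by
  rw [applyIncs, returned]
  congr 1
  induction s.nreg 6 with
  | zero => simp
  | succ r ih =>
    rw [List.range_succ, List.map_append, List.filter_append, List.map_append, List.sum_append, ih,
      sum_range_succ]
    congr 1
    by_cases h : s.narr 3 r = i <;> simp [h]

theorem mem_returned {s : Store} {p : ℕ × ℝ} :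
    p ∈ returned s ↔ ∃ j < s.nreg 6, (s.narr 3 j, s.rarr 2 j) = p := by
  simp [returned]

theorem length_returned (s : Store) : (returned s).length = s.nreg 6 := by simp [returned]

end LazyIncCuts

namespace LazyIncCuts

open RealRAM Finset

/-! ### The update along a cut -/

/-- Computes in the word register 28 the canonical cut with the index in the word register 27. -/
def getCanonical : Cmd :=
  Instr.nop .div 29 27 25 ;; Instr.nload 29 12 29 ;; Instr.nop .mul 29 29 11 ;;
  Instr.nop .mod 30 27 25 ;; Instr.nload 30 13 30 ;; Instr.nop .add 28 29 30

/-- Computes in the word registers 28, 29, 30 the canonical cut with the index in the word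
register 27 and the range of its entries. -/
def getSegment : Cmd :=
  getCanonical ;; Instr.nload 29 9 28 ;; Instr.nop .add 30 28 7 ;; Instr.nload 30 9 30

theorem wp_getCanonical {B τ t L : ℕ} {s : Store} (ht : s.nreg 27 = t) (htB : t ≤ B)
    (hc : canonical s t < L) (hL : L ≤ B) :
    wp B getCanonical (fun τ' s' => τ' = τ + 6 ∧ s'.nreg 28 = canonical s t) τ s := by
  simp only [canonical] at hc
  simp only [getCanonical, wp_seq, wp_instr, Instr.Fits, Instr.run, NOp.eval, Store.setN_nreg,
    Store.setN_narr, Nat.reduceEqDiff, reduceIte, true_and, ht, canonical, and_true]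
  exact ⟨(Nat.div_le_self _ _).trans htB, by omega, (Nat.mod_le _ _).trans htB, by omega⟩

theorem wp_getSegment {B τ t L : ℕ} {s : Store} (ht : s.nreg 27 = t) (htB : t ≤ B)
    (hc : canonical s t < L) (hL : L ≤ B) (h7 : s.nreg 7 = 1) :
    wp B getSegment (fun τ' s' => τ' = τ + 9 ∧ s'.nreg 28 = canonical s t ∧
      s'.nreg 29 = (view s).st (canonical s t) ∧
      s'.nreg 30 = (view s).st (canonical s t + 1)) τ s := by
  rw [getSegment, wp_seq]
  refine (wp_getCanonical ht htB hc hL).mono ?_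
  rintro τ₁ s₁ hf ⟨h₁, h₂⟩
  have e7 : s₁.nreg 7 = 1 := by rw [hf.nreg 7 (by decide), h7]
  have e9 : s₁.narr 9 = (view s).st := hf.narr 9 (by decide)
  simp only [wp_seq, wp_instr, Instr.Fits, Instr.run, NOp.eval, Store.setN_nreg,
    Store.setN_narr, Nat.reduceEqDiff, reduceIte, true_and, h₂, e7, e9, and_true]
  omega

theorem canonical_eq_of_frame {c : Cmd} {s s' : Store} (hf : Frame c s s')
    (hc : Loc.narr 12 ∉ c.writes ∧ Loc.narr 13 ∉ c.writes ∧ Loc.nreg 11 ∉ c.writes ∧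
      Loc.nreg 25 ∉ c.writes) : canonical s' = canonical s := by
  funext t
  simp only [canonical, hf.narr 12 hc.1, hf.narr 13 hc.2.1, hf.nreg 11 hc.2.2.1,
    hf.nreg 25 hc.2.2.2]

/-- Computes in the real register 2 the minimum capacity of the current cut. -/
def findMinCap : Cmd :=
  Instr.rmove 2 1 ;;
  forLoop 27 26
    (getSegment ;;
      .cond (.nlt 29 30)
        (Instr.nload 29 10 29 ;; Instr.rload 3 0 29 ;;
          .cond (.rlt 3 2) (Instr.rmove 2 3) .skip) .skip)

/-- What the loops over the canonical cuts of the cut `q` need to know about the store. -/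
structure CutReady (P : Input) (B : ℕ) (s : Store) (q : CutDesc P.n) : Prop where
  ok : (view s).Ok P
  splits : (view s).Splits P q (canonical s) (s.nreg 26)
  le : s.nreg 26 ≤ 24 * P.n ^ 2
  words : 100 * P.n ^ 8 ≤ B

namespace CutReady

variable {P : Input} {B : ℕ} {s : Store} {q : CutDesc P.n}

theorem of_frame (h : CutReady P B s q) {c : Cmd} {s' : Store} (hf : Frame c s s')
    (hk : Cmd.KeepsTables c)
    (hc : Loc.narr 12 ∉ c.writes ∧ Loc.narr 13 ∉ c.writes ∧ Loc.nreg 11 ∉ c.writes ∧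
      Loc.nreg 25 ∉ c.writes) (hc' : Loc.nreg 26 ∉ c.writes) : CutReady P B s' q := by
  obtain ⟨h₁, h₂, h₃, h₄⟩ := h
  rw [← view_eq_of_frame hk hf] at h₁ h₂
  rw [← canonical_eq_of_frame hf hc, ← hf.nreg 26 hc'] at h₂
  rw [← hf.nreg 26 hc'] at h₃
  exact ⟨h₁, h₂, h₃, h₄⟩

theorem pow_le (_ : CutReady P B s q) (k : ℕ) (hk : k ≤ 8) : P.n ^ k ≤ P.n ^ 8 :=
  Nat.pow_le_pow_right (by have := P.two_le_n; omega) hk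

theorem size_le (h : CutReady P B s q) : s.nreg 26 + 1 ≤ B := by
  have := h.le
  have := h.words
  have := h.pow_le 2 (by norm_num)
  have := Nat.one_le_pow 8 P.n (by have := P.two_le_n; omega)
  omega

theorem sq_le (h : CutReady P B s q) : (view s).M * (view s).M ≤ B := by
  have h₁ := Nat.mul_le_mul h.ok.M_le h.ok.M_le
  have := h.words
  have := h.pow_le 4 (by norm_num)
  have : P.n ^ 2 * P.n ^ 2 = P.n ^ 4 := by ring
  omega

end CutReady

/-- The search starts at the maximum capacity, which is harmless for a nonempty cut. Claims about
the minimum are made only for given edges of the cut, so its nonemptiness is never needed. -/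
theorem wp_findMinCap {P : Input} {B τ : ℕ} {s : Store} {q : CutDesc P.n}
    (h : CutReady P B s q) :
    wp B findMinCap (fun τ' s' => τ' ≤ τ + 16 * s.nreg 26 + 3 ∧ 0 ≤ s'.rreg 2 ∧
      ∀ i ∈ P.cut q, s'.rreg 2 = P.minCap q ∧ s'.rreg 2 ≤ P.cap i) τ s := by
  have hT := h.ok
  have hS := h.splits
  simp only [findMinCap, wp_seq, wp_instr, Instr.Fits, Instr.run, true_and]
  refine wp_forLoop (fun t τ₁ s₁ => τ₁ ≤ τ + 16 * t + 2 ∧ 0 ≤ s₁.rreg 2 ∧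
      (s₁.rreg 2 = (view s).cmax ∨ ∃ i ∈ P.cut q, s₁.rreg 2 = P.cap i) ∧
      s₁.rreg 2 ≤ (view s).cmax ∧
      ∀ t' < t, (view s).st (canonical s t') < (view s).st (canonical s t' + 1) →
        s₁.rreg 2 ≤ (view s).cap ((view s).ent ((view s).st (canonical s t'))))
    (by decide) hT.one_eq (by have := h.size_le; simp; omega) ?_ ?_ ?_
  · have hmax := hT.thresholds.max_nonneg
    simp only [Store.setN_rreg, Store.setR_rreg, if_true]
    exact ⟨by omega, hmax, Or.inl rfl, le_rfl, by simp⟩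
  · rintro t τ₁ s₁ ht hi hf ⟨hτ, h0, hor, hmax, hall⟩
    simp only [Store.setR_nreg] at ht
    have v₁ : view s₁ = view s := by
      rw [view_eq_of_frame (by decide) hf]; simp [view]
    have c₁ : canonical s₁ = canonical s := by
      rw [canonical_eq_of_frame hf (by decide)]; rfl
    have hcl := hS.lt t ht
    rw [wp_seq]
    refine (wp_getSegment hi (by have := h.size_le; omega) (c₁ ▸ hcl) h.sq_le
      (by have := hT.one_eq; rwa [← v₁] at this)).mono ?_
    rintro τ₂ s₂ hf₂ ⟨ht₂, -, h29, h30⟩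
    have v₂ : view s₂ = view s := by rw [view_eq_of_frame (by decide) hf₂, v₁]
    rw [c₁, v₁] at h29 h30
    have e10 : s₂.narr 10 = (view s).ent := by rw [← v₂]; rfl
    have e0 : s₂.rarr 0 = (view s).cap := by rw [← v₂]; rfl
    have er : s₂.rreg 2 = s₁.rreg 2 := hf₂.rreg 2 (by decide)
    simp only [wp_seq, wp_instr, wp_cond, wp_skip, Instr.Fits, Instr.run, Test.Holds, true_and,
      Store.setN_nreg, Store.setN_rreg, Store.setN_rarr, Store.setR_rreg, Nat.reduceEqDiff,
      reduceIte, h29, h30, e10, e0, er]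
    refine ⟨fun hlt => ?_, fun hlt => ?_⟩
    · have hcut : ∃ i ∈ P.cut q, (view s).cap ((view s).ent ((view s).st (canonical s t))) =
          P.cap i := by
        have hm := (hT.entries.seg _ hcl _ le_rfl hlt).2
        have he := hT.ent_lt (hT.lt_N hcl hlt)
        exact ⟨⟨_, he⟩, hS.mem_cut ht hm, hT.cap_eq ⟨_, he⟩⟩
      obtain ⟨i, hi, hci⟩ := hcut
      refine ⟨fun hc => ⟨by omega, ?_, Or.inr ⟨i, hi, hci⟩, by linarith, fun t' ht' hlt' => ?_⟩,
        fun hc => ⟨by omega, h0, hor, hmax, fun t' ht' hlt' => ?_⟩⟩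
      · rw [hci]; exact (P.cap_pos i).le
      · rcases Nat.lt_succ_iff_lt_or_eq.mp ht' with h' | rfl
        · exact hc.le.trans (hall t' h' hlt')
        · exact le_rfl
      · rcases Nat.lt_succ_iff_lt_or_eq.mp ht' with h' | rfl
        · exact hall t' h' hlt'
        · exact not_lt.mp hc
    · refine ⟨by omega, h0, hor, hmax, fun t' ht' hlt' => ?_⟩
      rcases Nat.lt_succ_iff_lt_or_eq.mp ht' with h' | rfl
      · exact hall t' h' hlt'
      · exact absurd hlt' hlt
  · rintro τ₁ s₁ hf ⟨hτ, h0, hor, hmax, hall⟩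
    simp only [Store.setR_nreg] at hτ hall
    refine ⟨by omega, h0, ?_⟩
    have hle : ∀ i ∈ P.cut q, s₁.rreg 2 ≤ P.cap i := by
      intro i hi
      obtain ⟨t, ht, hm⟩ := hS.exists_mem hi
      obtain ⟨k, hk₁, hk₂, hk₃⟩ := hT.exists_entry i.2 (hS.lt t ht) hm
      refine (hall t ht (by omega)).trans ((hT.entry_cap_le (hS.lt t ht) hk₁ hk₂).trans ?_)
      rw [hk₃, hT.cap_eq]
    intro i hi
    refine ⟨?_, hle i hi⟩
    -- If the register still holds the maximum capacity, it is also a lower bound for the cut, so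
    -- every edge of the cut attains it.
    have hmem : s₁.rreg 2 ∈ P.cap '' P.cut q := by
      rcases hor with h' | ⟨j, hj, h'⟩
      · refine ⟨i, hi, le_antisymm ?_ (hle i hi)⟩
        rw [h', ← hT.cap_eq]
        exact hT.cap_le_cmax i.2
      · exact ⟨j, hj, h'.symm⟩
    have hleast : IsLeast (P.cap '' P.cut q) (s₁.rreg 2) := by
      refine ⟨hmem, ?_⟩
      rintro _ ⟨j, hj, rfl⟩
      exact hle j hj
    exact hleast.csInf_eq.symm

/-- Adds the real register 2 to the states of all canonical cuts of the current cut. -/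
def raise : Cmd :=
  forLoop 27 26 (getCanonical ;; Instr.rload 3 5 28 ;; Instr.rop .add 3 3 2 ;; Instr.rstore 5 28 3)

/-- Counting with multiplicity avoids proving that the list of canonical cuts has no repetitions;
`Tab.Splits.pend_add` uses the same form. -/
theorem wp_raise {P : Input} {B τ : ℕ} {s : Store} {q : CutDesc P.n} (h : CutReady P B s q) :
    wp B raise (fun τ' s' => τ' ≤ τ + 11 * s.nreg 26 + 2 ∧
      s'.rarr 5 = fun S => s.rarr 5 S + s.rreg 2 *
        ∑ t ∈ range (s.nreg 26), if canonical s t = S then 1 else 0) τ s := by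
  have hT := h.ok
  have hS := h.splits
  refine wp_forLoop (fun r τ₁ s₁ => τ₁ ≤ τ + 11 * r + 1 ∧
      s₁.rarr 5 = fun S => s.rarr 5 S + s.rreg 2 *
        ∑ t ∈ range r, if canonical s t = S then 1 else 0)
    (by decide) hT.one_eq (by have := h.size_le; omega) (by simp) ?_ ?_
  · rintro t τ₁ s₁ ht hi hf ⟨hτ, h5⟩
    have c₁ : canonical s₁ = canonical s := canonical_eq_of_frame hf (by decide)
    have hcl := hS.lt t ht
    rw [wp_seq]
    refine (wp_getCanonical hi (by have := h.size_le; omega) (c₁ ▸ hcl) h.sq_le).mono ?_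
    rintro τ₂ s₂ hf₂ ⟨ht₂, h28⟩
    have e5 : s₂.rarr 5 = s₁.rarr 5 := hf₂.rarr 5 (by decide)
    have e2 : s₂.rreg 2 = s.rreg 2 := by rw [hf₂.rreg 2 (by decide), hf.rreg 2 (by decide)]
    simp only [wp_seq, wp_instr, Instr.Fits, Instr.run, ROp.eval, true_and, Store.setN_rarr,
      Store.putR_rarr, Store.setR_rarr, Store.setR_rreg, Store.setR_nreg, Nat.reduceEqDiff,
      reduceIte, h28, c₁, e5, e2]
    refine ⟨by omega, ?_⟩
    funext S
    rw [sum_range_succ]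
    by_cases hSt : S = canonical s t
    · subst hSt
      rw [Function.update_self, h5]
      simp
      ring
    · rw [Function.update_of_ne hSt, h5]
      simp [Ne.symm hSt]
  · rintro τ₁ s₁ hf ⟨hτ, h5⟩
    exact ⟨by omega, h5⟩

/-- Passes on the lags of the entries from the word register 29 up to the word register 30 of a
canonical cut, until the first entry whose lag is below its threshold. The state of the canonical
cut is in the real register 3. -/
def emitSegment : Cmd :=
  .loop (.nlt 29 30)
    (Instr.nload 31 10 29 ;; Instr.rload 4 4 29 ;; Instr.rop .sub 4 3 4 ;; Instr.rload 5 3 31 ;;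
      .cond (.rle 5 4)
        (Instr.rstore 4 29 3 ;; Instr.rload 6 0 31 ;; Instr.rop .mul 4 0 4 ;;
          Instr.rop .div 4 4 6 ;; Instr.rexp 4 4 ;; Instr.rload 6 1 31 ;; Instr.rop .mul 4 4 6 ;;
          Instr.rstore 1 31 4 ;; Instr.rop .sub 4 4 6 ;; Instr.rstore 2 6 4 ;;
          Instr.nstore 3 6 31 ;; Instr.nop .add 6 6 7 ;; Instr.nop .add 29 29 7)
        (Instr.nmove 30 29))

/-- The increments returned so far during an update. -/
def EmitState (P : Input) (w w₀ : Fin P.m → ℝ) (s : Store) : Prop :=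
  Emitted P (view s) (s.rarr 5) (s.rarr 4) w w₀
    (Real.exp (-5) / 2 * (P.ε / ((view s).H : ℝ) ^ 2))
    (s.rarr 1) (s.nreg 6) (s.narr 3) (s.rarr 2)

/-- An iteration that emits takes 19 steps. The one that stops the scan takes 7, and the final test
takes 1 more, whence the time bound. There is one increment per scanned entry except for the last
one. -/
theorem wp_emitSegment {P : Input} {B τ S : ℕ} {s : Store} {w w₀ : Fin P.m → ℝ}
    (hT : (view s).Ok P) (hS : S < (view s).M * (view s).M)
    (h29 : s.nreg 29 = (view s).st S) (h30 : s.nreg 30 = (view s).st (S + 1))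
    (h3 : s.rreg 3 = s.rarr 5 S) (hl : (view s).Lazy (s.rarr 5) (s.rarr 4))
    (hE : EmitState P w w₀ s) (hB : s.nreg 6 + (view s).N + 1 ≤ B) :
    wp B emitSegment (fun τ' s' => s.nreg 6 ≤ s'.nreg 6 ∧ s'.nreg 6 ≤ s.nreg 6 + (view s).N ∧
      τ' ≤ τ + 19 * (s'.nreg 6 - s.nreg 6) + 8 ∧
      (view s).Lazy (s.rarr 5) (s'.rarr 4) ∧ (view s).Head (s.rarr 5) (s'.rarr 4) S ∧
      (∀ S' < (view s).M * (view s).M, (view s).Head (s.rarr 5) (s.rarr 4) S' →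
        (view s).Head (s.rarr 5) (s'.rarr 4) S') ∧
      EmitState P w w₀ s') τ s := by
  have hle := hT.entries.st_le S hS
  have hle' := hT.entries.st_le_last (S + 1) hS
  -- The scan is stopped by lowering its upper end, register 30, to the current position. The final
  -- disjunction records whether this has happened; if so, the entry at the current position is
  -- below its threshold.
  refine wp_loop (fun τ₁ s₁ => (view s).st S ≤ s₁.nreg 29 ∧ s₁.nreg 29 ≤ (view s).st (S + 1) ∧
      s₁.nreg 6 = s.nreg 6 + (s₁.nreg 29 - (view s).st S) ∧
      s₁.rarr 4 = (view s).advance S (s₁.nreg 29) (s.rarr 5 S) (s.rarr 4) ∧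
      (∀ k, (view s).st S ≤ k → k < s₁.nreg 29 →
        (view s).thr ((view s).ent k) ≤ s.rarr 5 S - s.rarr 4 k) ∧
      EmitState P w w₀ s₁ ∧
      ((s₁.nreg 30 = (view s).st (S + 1) ∧ τ₁ ≤ τ + 19 * (s₁.nreg 29 - (view s).st S)) ∨
        (s₁.nreg 30 = s₁.nreg 29 ∧ τ₁ ≤ τ + 19 * (s₁.nreg 29 - (view s).st S) + 7 ∧
          s.rarr 5 S - s.rarr 4 (s₁.nreg 29) < (view s).thr ((view s).ent (s₁.nreg 29)))))
    (fun s₁ => s₁.nreg 30 - s₁.nreg 29) ?_ ?_ ?_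
  · refine ⟨by omega, by omega, by omega, ?_, by omega, hE, Or.inl ⟨h30, by omega⟩⟩
    rw [h29, Tab.advance_start]
  · rintro τ₁ s₁ hf ⟨ha, hb, hc, hA, hot, hE₁, hor⟩ hlt
    simp only [Test.Holds] at hlt
    have v₁ : view s₁ = view s := view_eq_of_frame (c := emitSegment) (by decide) hf
    have e7 : s₁.nreg 7 = 1 := by have := hT.one_eq; rw [← v₁] at this; exact this
    have e10 : s₁.narr 10 = (view s).ent := by rw [← v₁]; rfl
    have e0 : s₁.rarr 0 = (view s).cap := by rw [← v₁]; rfl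
    have er0 : s₁.rreg 0 = P.ε := by have := hT.ε_eq; rw [← v₁] at this; exact this
    have er3 : s₁.rarr 3 = (view s).thr := by rw [← v₁]; rfl
    have e3 : s₁.rreg 3 = s.rarr 5 S := by rw [hf.rreg 3 (by decide), h3]
    have e5 : s₁.rarr 5 = s.rarr 5 := hf.rarr 5 (by decide)
    generalize hk : s₁.nreg 29 = k at *
    rcases hor with ⟨h30₁, hτ⟩ | ⟨h30₁, -⟩
    swap
    · omega
    have hAk : s₁.rarr 4 k = s.rarr 4 k := by rw [hA, Tab.advance_self]
    have hkN : k < (view s).N := by omega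
    simp only [wp_seq, wp_instr, wp_cond, wp_skip, Instr.Fits, Instr.run, Test.Holds, true_and,
      NOp.eval, ROp.eval, Store.setN_nreg, Store.setN_narr, Store.setN_rreg, Store.setN_rarr,
      Store.setR_nreg, Store.setR_narr, Store.setR_rreg, Store.setR_rarr,
      Store.putN_nreg, Store.putN_narr, Store.putN_rreg, Store.putN_rarr,
      Store.putR_nreg, Store.putR_narr, Store.putR_rreg, Store.putR_rarr, Nat.reduceEqDiff,
      reduceIte, e7, e10, e0, er0, er3, e3, hk, hAk, h30₁, OfNat.ofNat_ne_zero,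
      OfNat.zero_ne_ofNat, OfNat.ofNat_ne_one, OfNat.one_ne_ofNat, zero_ne_one, one_ne_zero]
    refine ⟨fun hcond => ⟨by omega, by omega, ⟨by omega, by omega, by omega, ?_, ?_, ?_,
      Or.inl (by omega)⟩, by omega⟩, fun hcond => ⟨⟨ha, hb, hc, hA, hot, ?_,
      Or.inr ⟨by omega, not_le.mp hcond⟩⟩, by omega⟩⟩
    · rw [hA, Tab.advance_succ _ _ _ ha]
    · intro k' h₁ h₂
      rcases Nat.lt_succ_iff_lt_or_eq.mp h₂ with h' | rfl
      · exact hot k' h₁ h'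
      · exact hcond
    · have hstep := Emitted.step (v₁.symm ▸ hT) hE₁ (by rw [v₁]) (k := k) (e := (view s).ent k)
        (g := s.rarr 5 S) (new := Real.exp (P.ε * (s.rarr 5 S - s.rarr 4 k) /
          (view s).cap ((view s).ent k)) * s₁.rarr 1 ((view s).ent k))
        (by rw [v₁]; exact hkN) (by rw [v₁]) (by rw [v₁, hAk]; exact hcond) (by rw [v₁, hAk])
      simpa [EmitState, view] using hstep
    · simpa [EmitState, view] using hE₁
  · rintro τ₁ s₁ hf ⟨ha, hb, hc, hA, hot, hE₁, hor⟩ hlt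
    simp only [Test.Holds] at hlt
    have hadv := hT.lazy_advance hl hS ha hb hot (fun hlt' => by
      rcases hor with ⟨h, -⟩ | ⟨-, -, h⟩
      · omega
      · exact h)
    rw [← hA] at hadv
    refine ⟨by omega, by omega, ?_, hadv.1, hadv.2.1, hadv.2.2, hE₁⟩
    rcases hor with ⟨-, h⟩ | ⟨-, h, -⟩ <;> omega

end LazyIncCuts

/-! ### The complete routine for `inc-cut`. -/

namespace LazyIncCuts

open RealRAM Finset

/-- Passes on the lags in all canonical cuts of the current cut. -/
def emitAll : Cmd :=
  Instr.nconst 6 0 ;; forLoop 27 26 (getSegment ;; Instr.rload 3 5 28 ;; emitSegment)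

theorem Tab.Ok.N_le_pow {P : Input} {T : Tab} (h : T.Ok P) : T.N ≤ 2 * P.n ^ 4 := by
  have h₁ : T.N ≤ 2 * T.H ^ 2 * P.m := by exact_mod_cast h.N_le
  calc T.N ≤ 2 * T.H ^ 2 * P.m := h₁
    _ ≤ 2 * P.n ^ 2 * P.n ^ 2 := Nat.mul_le_mul
        (Nat.mul_le_mul_left _ (Nat.pow_le_pow_left h.H_le 2)) P.m_le
    _ = 2 * P.n ^ 4 := by ring

/-- Raising can violate `Head` only in the canonical cuts of the current cut. The loop maintains
that each canonical cut satisfies `Head` or is still to be visited. -/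
theorem wp_emitAll {P : Input} {B τ : ℕ} {s : Store} {q : CutDesc P.n} {w w₀ : Fin P.m → ℝ}
    (h : CutReady P B s q) (hl : (view s).Lazy (s.rarr 5) (s.rarr 4))
    (hh : ∀ S < (view s).M * (view s).M, (view s).Head (s.rarr 5) (s.rarr 4) S ∨
      ∃ t < s.nreg 26, canonical s t = S)
    (hE : EmitState P w w₀ (s.setN 6 0)) :
    wp B emitAll (fun τ' s' => τ' ≤ τ + 21 * s.nreg 26 + 19 * s'.nreg 6 + 3 ∧
      (view s).Lazy (s.rarr 5) (s'.rarr 4) ∧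
      (∀ S < (view s).M * (view s).M, (view s).Head (s.rarr 5) (s'.rarr 4) S) ∧
      EmitState P w w₀ s') τ s := by
  have hT := h.ok
  have hS := h.splits
  simp only [emitAll, wp_seq, wp_instr, Instr.Fits, Instr.run]
  refine ⟨Nat.zero_le _, ?_⟩
  refine wp_forLoop (fun t τ₁ s₁ => τ₁ ≤ τ + 21 * t + 19 * s₁.nreg 6 + 2 ∧
      s₁.nreg 6 ≤ t * (view s).N ∧ (view s).Lazy (s.rarr 5) (s₁.rarr 4) ∧
      (∀ S < (view s).M * (view s).M, (view s).Head (s.rarr 5) (s₁.rarr 4) S ∨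
        ∃ t' < s.nreg 26, t ≤ t' ∧ canonical s t' = S) ∧
      EmitState P w w₀ s₁)
    (by decide) (by simp; exact hT.one_eq) (by have := h.size_le; simp; omega) ?_ ?_ ?_
  · refine ⟨by simp, by simp, by simpa using hl, ?_, by simpa [EmitState, view] using hE⟩
    intro S hS
    rcases hh S hS with h' | ⟨t, ht, h'⟩
    · exact Or.inl (by simpa using h')
    · exact Or.inr ⟨t, ht, by simp, h'⟩
  · rintro t τ₁ s₁ ht hi hf ⟨hτ, hcnt, hl₁, hh₁, hE₁⟩
    have ht : t < s.nreg 26 := by simpa using ht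
    have v₁ : view s₁ = view s := by
      rw [view_eq_of_frame (by decide) hf]; simp [view]
    have c₁ : canonical s₁ = canonical s := by
      rw [canonical_eq_of_frame hf (by decide)]; funext t; simp [canonical]
    have hcl := hS.lt t ht
    rw [wp_seq]
    refine (wp_getSegment hi (by have := h.size_le; omega) (c₁ ▸ hcl) h.sq_le
      (by have := hT.one_eq; rwa [← v₁] at this)).mono ?_
    rintro τ₂ s₂ hf₂ ⟨ht₂, h28, h29, h30⟩
    have v₂ : view s₂ = view s := by rw [view_eq_of_frame (by decide) hf₂, v₁]
    rw [c₁, v₁] at h29 h30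
    rw [c₁] at h28
    have e4 : s₂.rarr 4 = s₁.rarr 4 := hf₂.rarr 4 (by decide)
    have e5 : s₂.rarr 5 = s.rarr 5 := by
      rw [hf₂.rarr 5 (by decide), hf.rarr 5 (by decide)]; simp
    have e6 : s₂.nreg 6 = s₁.nreg 6 := hf₂.nreg 6 (by decide)
    have hE₂ : EmitState P w w₀ s₂ := by
      simp only [EmitState] at hE₁ ⊢
      rw [v₂, e4, e6, hf₂.rarr 5 (by decide), hf₂.rarr 1 (by decide), hf₂.narr 3 (by decide),
        hf₂.rarr 2 (by decide), ← v₁]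
      exact hE₁
    simp only [wp_seq, wp_instr, Instr.Fits, Instr.run, true_and, h28, e5]
    generalize hs₃ : s₂.setR 3 (s.rarr 5 (canonical s t)) = s₃
    have v₃ : view s₃ = view s := by rw [← hs₃, ← v₂]; simp [view]
    have f4 : s₃.rarr 4 = s₁.rarr 4 := by rw [← hs₃]; simp [e4]
    have f5 : s₃.rarr 5 = s.rarr 5 := by rw [← hs₃]; simp [e5]
    have f6 : s₃.nreg 6 = s₁.nreg 6 := by rw [← hs₃]; simp [e6]
    have hE₃ : EmitState P w w₀ s₃ := by rw [← hs₃]; simpa [EmitState, view] using hE₂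
    have hN := hT.N_le_pow
    -- At most 24n² canonical cuts with at most 2n⁴ entries each: a crude bound on the number of
    -- increments, used only to exclude overflow.
    have hword : s₁.nreg 6 + (view s).N + 1 ≤ B := by
      have h₁ : (t + 1) * (view s).N ≤ 24 * P.n ^ 2 * (2 * P.n ^ 4) :=
        Nat.mul_le_mul (by have := h.le; omega) hN
      have h₂ : 24 * P.n ^ 2 * (2 * P.n ^ 4) = 48 * P.n ^ 6 := by ring
      have h₃ : (t + 1) * (view s).N = t * (view s).N + (view s).N := by ring
      have := h.pow_le 6 (by norm_num)
      have := h.words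
      have := Nat.one_le_pow 8 P.n (by have := P.two_le_n; omega)
      omega
    refine (wp_emitSegment (S := canonical s t) (by rw [v₃]; exact hT) (by rw [v₃]; exact hcl)
      (by rw [v₃, ← hs₃]; simpa using h29) (by rw [v₃, ← hs₃]; simpa using h30)
      (by rw [f5, ← hs₃]; simp) (by rw [v₃, f4, f5]; exact hl₁) hE₃
      (by rw [f6, v₃]; exact hword)).mono ?_
    rintro τ₄ s₄ hf₄ ⟨g₁, g₂, g₃, g₄, g₅, g₆, g₇⟩
    rw [v₃, f5] at g₄ g₅ g₆
    rw [f4] at g₆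
    rw [f6, v₃] at g₂
    rw [f6] at g₁ g₃
    simp only [Store.setN_nreg, Store.setN_rarr, Nat.reduceEqDiff, reduceIte]
    refine ⟨by omega, by rw [Nat.succ_mul]; omega, g₄, ?_,
      by simpa [EmitState, view] using g₇⟩
    intro S hS'
    rcases hh₁ S hS' with h' | ⟨t', ht', hle, h'⟩
    · exact Or.inl (g₆ S hS' h')
    · rcases hle.lt_or_eq with hlt | rfl
      · exact Or.inr ⟨t', ht', hlt, h'⟩
      · exact Or.inl (h' ▸ g₅)
  · rintro τ₁ s₁ hf ⟨hτ, -, hl₁, hh₁, hE₁⟩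
    simp only [Store.setN_nreg, Nat.reduceEqDiff, reduceIte] at hτ hh₁
    refine ⟨by omega, hl₁, fun S hS' => ?_, hE₁⟩
    rcases hh₁ S hS' with h' | ⟨t', ht', hle, -⟩
    · exact h'
    · omega

/-- The routine for `inc-cut`. -/
def incCutCmd : Cmd := splitCut ;; findMinCap ;; raise ;; emitAll

theorem EmitState.applyIncs_eq {P : Input} {w w₀ : Fin P.m → ℝ} {s : Store}
    (h : EmitState P w w₀ s) (i : Fin P.m) : applyIncs (returned s) w₀ i = s.rarr 1 i := by
  rw [applyIncs_returned]
  exact (h.sum_eq i).symm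

/-- Raising Γ by γ on the canonical cuts of `q` multiplies the exact weights as the update demands
while the approximate weights stay; emission then restores the invariant. The costs per canonical
cut, 16 + 11 + 21, times 24H² give 1152H², and the lower-order terms fit into 1280H². -/
theorem wp_incCutCmd {P : Input} {B : ℕ} {s : Store} {w w' : Fin P.m → ℝ} {q : CutDesc P.n}
    (hR : Represents P s w w') (hB : 100 * P.n ^ 8 ≤ B) :
    wp B incCutCmd (fun τ s' => τ ≤ 1280 * (view s).H ^ 2 + 19 * s'.nreg 6 ∧
      Represents P s' (P.mwu q w) (applyIncs (returned s') w') ∧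
      ∀ p ∈ returned s', ∃ i : Fin P.m, p.1 = i ∧
        Real.exp (-5) / 2 * (P.ε / ((view s).H : ℝ) ^ 2) * P.mwu q w i ≤ p.2) 0 (pass s q) := by
  classical
  have hT := hR.ok
  have hH := hT.H_pos
  rw [incCutCmd, wp_seq]
  refine (wp_splitCut hT q hB).mono ?_
  rintro τ₁ s₁ hf₁ ⟨ht₁, hr, hsp⟩
  have v₁ : view s₁ = view s := by rw [view_eq_of_frame (by decide) hf₁, view_pass]
  have pr : (pass s q).rarr = s.rarr := by cases q <;> rfl
  have a1 : s₁.rarr 1 = s.rarr 1 := by rw [hf₁.rarr 1 (by decide), pr]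
  have a4 : s₁.rarr 4 = s.rarr 4 := by rw [hf₁.rarr 4 (by decide), pr]
  have a5 : s₁.rarr 5 = s.rarr 5 := by rw [hf₁.rarr 5 (by decide), pr]
  have a6 : s₁.rarr 6 = s.rarr 6 := by rw [hf₁.rarr 6 (by decide), pr]
  have hready : CutReady P B s₁ q := by
    refine ⟨v₁.symm ▸ hT, v₁.symm ▸ hsp, hr.trans ?_, hB⟩
    exact Nat.mul_le_mul_left _ (Nat.pow_le_pow_left hT.H_le 2)
  rw [wp_seq]
  refine (wp_findMinCap hready).mono ?_
  rintro τ₂ s₂ hf₂ ⟨ht₂, hγ0, hγ⟩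
  have hready₂ := hready.of_frame hf₂ (by decide) (by decide) (by decide)
  have v₂ : view s₂ = view s := by rw [view_eq_of_frame (by decide) hf₂, v₁]
  have e26 : s₂.nreg 26 = s₁.nreg 26 := hf₂.nreg 26 (by decide)
  rw [wp_seq]
  refine (wp_raise hready₂).mono ?_
  rintro τ₃ s₃ hf₃ ⟨ht₃, h5⟩
  have hready₃ := hready₂.of_frame hf₃ (by decide) (by decide) (by decide)
  have v₃ : view s₃ = view s := by rw [view_eq_of_frame (by decide) hf₃, v₂]
  have c₃ : canonical s₃ = canonical s₂ := canonical_eq_of_frame hf₃ (by decide)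
  have g26 : s₃.nreg 26 = s₂.nreg 26 := hf₃.nreg 26 (by decide)
  have b1 : s₃.rarr 1 = s.rarr 1 := by rw [hf₃.rarr 1 (by decide), hf₂.rarr 1 (by decide), a1]
  have b4 : s₃.rarr 4 = s.rarr 4 := by rw [hf₃.rarr 4 (by decide), hf₂.rarr 4 (by decide), a4]
  have b5 : s₂.rarr 5 = s.rarr 5 := by rw [hf₂.rarr 5 (by decide), a5]
  have b6 : s₃.rarr 6 = s.rarr 6 := by rw [hf₃.rarr 6 (by decide), hf₂.rarr 6 (by decide), a6]
  set γ := s₂.rreg 2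
  rw [b5] at h5
  have hcount : ∀ S, (0 : ℝ) ≤ ∑ t ∈ range (s₂.nreg 26), if canonical s₂ t = S then (1 : ℝ) else 0 :=
    fun S => sum_nonneg fun t _ => by split <;> norm_num
  have hpend : ∀ i : Fin P.m, (view s).pend (s₃.rarr 5) (s₃.rarr 4) i =
      (view s).pend (s.rarr 5) (s.rarr 4) i + if i ∈ P.cut q then γ else 0 := by
    intro i
    rw [h5, b4]
    have := hready₂.splits
    rw [v₂] at this
    convert this.pend_add hT (s.rarr 5) (s.rarr 4) γ i
  have hwt : ∀ i, s.rarr 1 (i : Fin P.m) = w' i := fun i => (hR.wt_eq i).symm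
  have hEmit : EmitState P (P.mwu q w) w' (s₃.setN 6 0) := by
    have vz : view (s₃.setN 6 0) = view s := by rw [← v₃]; simp [view]
    simp only [EmitState, vz, Store.setN_rarr, Store.setN_narr, Store.setN_nreg, if_true, b1]
    refine ⟨fun i => ?_, fun i => by simp [hwt], by simp, fun i => ?_, fun i => ?_⟩
    · rw [hpend, Input.mwu, hwt]
      by_cases hi : i ∈ P.cut q
      · rw [if_pos hi, if_pos hi, hR.exact_eq i, ← (hγ i hi).1, mul_assoc, ← Real.exp_add]
        congr 2
        ring
      · rw [if_neg hi, if_neg hi, hR.exact_eq i, add_zero]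
    · rw [hwt]; exact hR.wt_pos i
    · rw [hpend]
      -- The exponent is at most 4c before the call, and the update adds γ, which is at most c for
      -- an edge of the cut.
      have h₁ := hT.pend_le hR.lz hR.head i.2
      rw [hT.cap_eq] at h₁
      by_cases hi : i ∈ P.cut q
      · rw [if_pos hi]; have := (hγ i hi).2; linarith
      · rw [if_neg hi]; have := P.cap_pos i; linarith
  have hlz : (view s₃).Lazy (s₃.rarr 5) (s₃.rarr 4) := by
    rw [v₃, b4, h5]
    refine ⟨fun k hk => ?_, hR.lz.succ_le, hR.lz.sub_lt, hR.lz.eq_of_eq⟩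
    have h₁ := hR.lz.le k hk
    have h₂ := mul_nonneg hγ0 (hcount ((view s).seg k))
    linarith
  have hhead : ∀ S < (view s₃).M * (view s₃).M, (view s₃).Head (s₃.rarr 5) (s₃.rarr 4) S ∨
      ∃ t < s₃.nreg 26, canonical s₃ t = S := by
    intro S hS
    by_cases hex : ∃ t < s₃.nreg 26, canonical s₃ t = S
    · exact Or.inr hex
    · left
      rw [v₃] at hS ⊢
      have hz : ∑ t ∈ range (s₂.nreg 26), (if canonical s₂ t = S then (1 : ℝ) else 0) = 0 := by
        refine sum_eq_zero fun t ht => if_neg fun hc => hex ⟨t, ?_, by rw [c₃, hc]⟩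
        rw [g26]; exact mem_range.mp ht
      have := hR.head S hS
      intro hlt
      rw [h5, b4]
      simpa [hz] using this hlt
  refine (wp_emitAll hready₃ hlz hhead hEmit).mono ?_
  rintro τ₄ s₄ hf₄ ⟨ht₄, hl₄, hh₄, hE₄⟩
  have v₄ : view s₄ = view s := by rw [view_eq_of_frame (by decide) hf₄, v₃]
  have d5 : s₄.rarr 5 = s₃.rarr 5 := hf₄.rarr 5 (by decide)
  rw [v₃, ← d5] at hl₄ hh₄
  refine ⟨?_, ⟨v₄.symm ▸ hT, v₄.symm ▸ hl₄, v₄.symm ▸ hh₄, hE₄.applyIncs_eq, ?_, ?_, ?_⟩, ?_⟩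
  · have : (view s).H ≤ (view s).H ^ 2 := Nat.le_self_pow (by norm_num) _
    omega
  · intro i
    rw [hE₄.applyIncs_eq]
    exact hE₄.pos i
  · intro i
    rw [hE₄.applyIncs_eq]
    exact hE₄.exact_eq i
  · intro i
    rw [hf₄.rarr 6 (by decide), b6]
    exact hR.buf_zero i
  · intro p hp
    obtain ⟨j, hj, rfl⟩ := mem_returned.mp hp
    have := hE₄.large j hj
    rwa [v₄] at this

end LazyIncCuts

namespace LazyIncCuts

open RealRAM Finset

/-! ### Flushing -/

/-- Collects in the real array 6 the lags of all edges. -/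
def collectLags : Cmd :=
  forLoop 14 13
    (Instr.nload 15 10 14 ;; Instr.nload 16 11 14 ;; Instr.rload 2 5 16 ;; Instr.rload 3 4 14 ;;
      Instr.rstore 4 14 2 ;; Instr.rop .sub 2 2 3 ;; Instr.rload 3 6 15 ;; Instr.rop .add 2 2 3 ;;
      Instr.rstore 6 15 2)

/-- Passes on the collected lags. -/
def emitLags : Cmd :=
  Instr.nconst 6 0 ;; Instr.rcast 5 9 ;;
  forLoop 14 1
    (Instr.rload 2 6 14 ;;
      .cond (.rlt 5 2)
        (Instr.rload 3 0 14 ;; Instr.rop .mul 2 0 2 ;; Instr.rop .div 2 2 3 ;; Instr.rexp 2 2 ;;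
          Instr.rload 3 1 14 ;; Instr.rop .mul 2 2 3 ;; Instr.rstore 1 14 2 ;;
          Instr.rop .sub 2 2 3 ;; Instr.rstore 2 6 2 ;; Instr.nstore 3 6 14 ;;
          Instr.rstore 6 14 5 ;; Instr.nop .add 6 6 7) .skip)

/-- The routine for `flush`. -/
def flushCmd : Cmd := collectLags ;; emitLags

theorem wp_collectLags {P : Input} {B τ : ℕ} {s : Store} (hT : (view s).Ok P)
    (hX : ∀ i : Fin P.m, s.rarr 6 i = 0) (hB : (view s).N + 1 ≤ B) :
    wp B collectLags (fun τ' s' => τ' ≤ τ + 11 * (view s).N + 2 ∧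
      (∀ k < (view s).N, s'.rarr 4 k = s.rarr 5 ((view s).seg k)) ∧
      ∀ i : Fin P.m, s'.rarr 6 i = (view s).pend (s.rarr 5) (s.rarr 4) i) τ s := by
  refine wp_forLoop (fun j τ₁ s₁ => τ₁ ≤ τ + 11 * j + 1 ∧
      (∀ k, s₁.rarr 4 k = if k < j then s.rarr 5 ((view s).seg k) else s.rarr 4 k) ∧
      ∀ i : Fin P.m, s₁.rarr 6 i = ∑ k ∈ range j, if (view s).ent k = i then
        s.rarr 5 ((view s).seg k) - s.rarr 4 k else 0)
    (by decide) hT.one_eq (by change (view s).N ≤ B; omega) ⟨by omega, by simp, by simpa using hX⟩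
    ?_ ?_
  · rintro j τ₁ s₁ hj hi hf ⟨hτ, h4, h6⟩
    have hj : j < (view s).N := hj
    have e10 : s₁.narr 10 = (view s).ent := hf.narr 10 (by decide)
    have e11 : s₁.narr 11 = (view s).seg := hf.narr 11 (by decide)
    have e5 : s₁.rarr 5 = s.rarr 5 := hf.rarr 5 (by decide)
    have e4 : s₁.rarr 4 j = s.rarr 4 j := by rw [h4]; simp
    simp only [wp_seq, wp_instr, Instr.Fits, Instr.run, true_and, ROp.eval,
      Store.setN_nreg, Store.setN_narr, Store.setN_rreg, Store.setN_rarr,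
      Store.setR_nreg, Store.setR_narr, Store.setR_rreg, Store.setR_rarr,
      Store.putR_nreg, Store.putR_narr, Store.putR_rreg, Store.putR_rarr, Nat.reduceEqDiff,
      reduceIte, hi, e10, e11, e5, e4]
    refine ⟨by omega, fun k => ?_, fun i => ?_⟩
    · by_cases hk : k = j
      · subst hk; simp
      · rw [Function.update_of_ne hk, h4]
        have : k < j ↔ k < j + 1 := by omega
        simp only [this]
    · rw [sum_range_succ, ← h6 i]
      by_cases he : (view s).ent j = i
      · rw [he, Function.update_self, if_pos rfl]; ring
      · rw [Function.update_of_ne (Ne.symm he), if_neg he, add_zero]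
  · rintro τ₁ s₁ hf ⟨hτ, h4, h6⟩
    exact ⟨by change _ ≤ τ + 11 * s.nreg 13 + 2; omega,
      fun k hk => by rw [h4]; exact if_pos hk, h6⟩

/-- Lags are first added up per edge, so each edge gets at most one increment. Vanishing sums are
skipped, which makes every increment positive, and the buffer is cleared for the next flush. -/
theorem wp_emitLags {P : Input} {B τ : ℕ} {s : Store} {w w' : Fin P.m → ℝ} {x : Fin P.m → ℝ}
    (hT : (view s).Ok P) (hx : ∀ i, 0 ≤ x i) (hX : ∀ i : Fin P.m, s.rarr 6 i = x i)
    (hw' : ∀ i : Fin P.m, s.rarr 1 i = w' i) (hpos : ∀ i, 0 < w' i)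
    (hw : ∀ i, w i = w' i * Real.exp (P.ε * x i / P.cap i)) (hB : P.m + 1 ≤ B) :
    wp B emitLags (fun τ' s' => τ' ≤ τ + 16 * P.m + 4 ∧ s'.nreg 6 ≤ P.m ∧
      (∀ i : Fin P.m, s'.rarr 1 i = w i) ∧ (∀ i : Fin P.m, s'.rarr 6 i = 0) ∧
      (∀ i : Fin P.m, applyIncs (returned s') w' i = w i) ∧
      ∀ p ∈ returned s', ∃ i : Fin P.m, p.1 = i ∧ 0 < p.2) τ s := by
  have h9 : s.nreg 9 = 0 := hT.zero_eq
  have h1 : s.nreg 1 = P.m := hT.m_eq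
  simp only [emitLags, wp_seq, wp_instr, Instr.Fits, Instr.run]
  refine ⟨Nat.zero_le _, trivial, ?_⟩
  refine wp_forLoop (fun t τ₁ s₁ => τ₁ ≤ τ + 16 * t + 3 ∧ s₁.nreg 6 ≤ t ∧
      (∀ i : Fin P.m, s₁.rarr 1 i = if (i : ℕ) < t then w i else w' i) ∧
      (∀ i : Fin P.m, s₁.rarr 6 i = if (i : ℕ) < t then 0 else x i) ∧
      (∀ i : Fin P.m, s₁.rarr 1 i = w' i +
        ∑ j ∈ range (s₁.nreg 6), if s₁.narr 3 j = i then s₁.rarr 2 j else 0) ∧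
      ∀ j < s₁.nreg 6, ∃ i : Fin P.m, s₁.narr 3 j = i ∧ 0 < s₁.rarr 2 j)
    (by decide) (by simp; exact hT.one_eq) (by simp [h1]; omega) ?_ ?_ ?_
  · simp [hw', hX]
  · rintro t τ₁ s₁ ht hi hf ⟨hτ, hc, hw₁, hx₁, hs₁, hp₁⟩
    have ht : t < P.m := by simpa [h1] using ht
    set it : Fin P.m := ⟨t, ht⟩ with hit
    have e7 : s₁.nreg 7 = 1 := by rw [hf.nreg 7 (by decide)]; simp; exact hT.one_eq
    have e0 : s₁.rarr 0 = (view s).cap := by rw [hf.rarr 0 (by decide)]; rfl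
    have er0 : s₁.rreg 0 = P.ε := by rw [hf.rreg 0 (by decide)]; simp; exact hT.ε_eq
    have er5 : s₁.rreg 5 = 0 := by rw [hf.rreg 5 (by decide)]; simp [h9]
    have ex : s₁.rarr 6 t = x it := by simpa [hit] using hx₁ it
    have ew : s₁.rarr 1 t = w' it := by simpa [hit] using hw₁ it
    have ecap : (view s).cap t = P.cap it := hT.cap_eq it
    have hlt : ∀ i : Fin P.m, i ≠ it → ((i : ℕ) < t + 1 ↔ (i : ℕ) < t) ∧ (i : ℕ) ≠ t := by
      intro i hi
      have : (i : ℕ) ≠ t := fun h => hi (Fin.ext h)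
      omega
    simp only [wp_seq, wp_instr, wp_cond, wp_skip, Instr.Fits, Instr.run, Test.Holds, true_and,
      NOp.eval, ROp.eval, Store.setN_nreg, Store.setN_narr, Store.setN_rreg, Store.setN_rarr,
      Store.setR_nreg, Store.setR_narr, Store.setR_rreg, Store.setR_rarr,
      Store.putN_nreg, Store.putN_narr, Store.putN_rreg, Store.putN_rarr,
      Store.putR_nreg, Store.putR_narr, Store.putR_rreg, Store.putR_rarr, Nat.reduceEqDiff,
      reduceIte, hi, e7, e0, er0, er5, ex, ew, ecap, OfNat.ofNat_ne_zero,
      OfNat.zero_ne_ofNat, OfNat.ofNat_ne_one, OfNat.one_ne_ofNat, zero_ne_one, one_ne_zero]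
    have hnew : Real.exp (P.ε * x it / P.cap it) * w' it = w it := by rw [hw it, mul_comm]
    rw [hnew]
    refine ⟨fun hpx => ⟨by omega, by omega, by omega, fun i => ?_, fun i => ?_, fun i => ?_,
      fun j hj => ?_⟩, fun hpx => ⟨by omega, by omega, fun i => ?_, fun i => ?_, hs₁, hp₁⟩⟩
    · by_cases hi : i = it
      · subst hi; simp [hit]
      · rw [Function.update_of_ne (hlt i hi).2, hw₁]; simp only [hlt i hi]
    · by_cases hi : i = it
      · subst hi; simp [hit]
      · rw [Function.update_of_ne (hlt i hi).2, hx₁]; simp only [hlt i hi]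
    · rw [sum_update_append, ← add_assoc, ← hs₁ i]
      by_cases hi : i = it
      · subst hi; simp [hit, ew]
      · rw [Function.update_of_ne (hlt i hi).2, if_neg (hlt i hi).2.symm, add_zero]
    · rcases Nat.lt_succ_iff_lt_or_eq.mp hj with h' | rfl
      · rw [Function.update_of_ne h'.ne, Function.update_of_ne h'.ne]
        exact hp₁ j h'
      · refine ⟨it, by simp [hit], ?_⟩
        rw [Function.update_self, hw it]
        have h₁ : 0 < P.ε * x it / P.cap it := div_pos (mul_pos P.ε_pos hpx) (P.cap_pos it)
        have h₂ := Real.one_lt_exp_iff.mpr h₁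
        have h₃ := hpos it
        nlinarith
    · by_cases hi : i = it
      · have h0 : x it = 0 := le_antisymm (not_lt.mp hpx) (hx it)
        subst hi
        rw [if_pos (by simp [hit]), hw it, h0]
        simpa using ew
      · rw [hw₁]; simp only [hlt i hi]
    · by_cases hi : i = it
      · have h0 : x it = 0 := le_antisymm (not_lt.mp hpx) (hx it)
        subst hi
        rw [if_pos (by simp [hit])]
        exact ex.trans h0
      · rw [hx₁]; simp only [hlt i hi]
  · rintro τ₁ s₁ hf ⟨hτ, hc, hw₁, hx₁, hs₁, hp₁⟩
    have hb : ((s.setN 6 0).setR 5 ((s.setN 6 0).nreg 9 : ℝ)).nreg 1 = P.m := by simp [h1]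
    rw [hb] at hτ hc hw₁ hx₁
    have hw₂ : ∀ i : Fin P.m, s₁.rarr 1 i = w i := fun i => by rw [hw₁, if_pos i.2]
    refine ⟨by omega, hc, hw₂, fun i => by rw [hx₁, if_pos i.2], fun i => ?_, fun p hp => ?_⟩
    · rw [applyIncs_returned, ← hs₁ i, hw₂]
    · obtain ⟨j, hj, rfl⟩ := mem_returned.mp hp
      exact hp₁ j hj

theorem wp_flushCmd {P : Input} {B : ℕ} {s : Store} {w w' : Fin P.m → ℝ}
    (hR : Represents P s w w') (hB : 100 * P.n ^ 8 ≤ B) :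
    wp B flushCmd (fun τ s' => τ ≤ 11 * (view s).N + 16 * P.m + 6 ∧ s'.nreg 6 ≤ P.m ∧
      Represents P s' w (applyIncs (returned s') w') ∧
      (∀ i : Fin P.m, applyIncs (returned s') w' i = w i) ∧
      ∀ p ∈ returned s', ∃ i : Fin P.m, p.1 = i ∧ 0 < p.2) 0 s := by
  have hT := hR.ok
  have hpow : ∀ k ≤ 8, P.n ^ k ≤ P.n ^ 8 := fun k hk =>
    Nat.pow_le_pow_right (by have := P.two_le_n; omega) hk
  have hp2 := hpow 2 (by norm_num)
  have hp4 := hpow 4 (by norm_num)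
  have hp0 : 1 ≤ P.n ^ 8 := Nat.one_le_pow 8 P.n (by have := P.two_le_n; omega)
  have hm := P.m_le
  have hN := hT.N_le_pow
  rw [flushCmd, wp_seq]
  refine (wp_collectLags hT hR.buf_zero (by omega)).mono ?_
  rintro τ₁ s₁ hf₁ ⟨ht₁, h4, h6⟩
  have v₁ : view s₁ = view s := view_eq_of_frame (by decide) hf₁
  have e1 : s₁.rarr 1 = s.rarr 1 := hf₁.rarr 1 (by decide)
  refine (wp_emitLags (w := w) (w' := w') (v₁.symm ▸ hT) (fun i => Tab.Ok.pend_nonneg hR.lz i) h6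
    (fun i => by rw [e1, hR.wt_eq]) hR.wt_pos hR.exact_eq (by omega)).mono ?_
  rintro τ₂ s₂ hf₂ ⟨ht₂, hc, hw, hX, happ, hp⟩
  have v₂ : view s₂ = view s := by rw [view_eq_of_frame (by decide) hf₂, v₁]
  have e5 : s₂.rarr 5 = s.rarr 5 := by rw [hf₂.rarr 5 (by decide), hf₁.rarr 5 (by decide)]
  have e4 : ∀ k < (view s).N, s₂.rarr 4 k = s₂.rarr 5 ((view s).seg k) := by
    intro k hk; rw [hf₂.rarr 4 (by decide), h4 k hk, e5]
  have hthr : ∀ k < (view s).N, 0 < (view s).thr ((view s).ent k) := fun k hk =>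
    hT.thr_pos (hT.ent_lt hk)
  have hseg : ∀ S < (view s).M * (view s).M, ∀ k, (view s).st S ≤ k → k < (view s).st (S + 1) →
      s₂.rarr 4 k = s₂.rarr 5 S := by
    intro S hS k h₁ h₂
    rw [e4 k (hT.lt_N hS h₂), (hT.entries.seg S hS k h₁ h₂).1]
  -- Every entry has caught up with its canonical cut, so all lags vanish and the invariants hold
  -- trivially.
  have hpend : ∀ e, (view s).pend (s₂.rarr 5) (s₂.rarr 4) e = 0 := by
    intro e
    refine sum_eq_zero fun k hk => ?_
    rw [e4 k (mem_range.mp hk), sub_self, ite_self]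
  have hwpos : ∀ i, 0 < w i := fun i => by
    rw [hR.exact_eq i]; exact mul_pos (hR.wt_pos i) (Real.exp_pos _)
  refine ⟨by omega, hc, ⟨v₂.symm ▸ hT, ?_, ?_, ?_, ?_, ?_, hX⟩, happ, hp⟩
  · rw [v₂]
    refine ⟨fun k hk => (e4 k hk).le, fun S hS k h₁ h₂ => ?_, fun S hS k h₁ h₂ => ?_,
      fun S hS k h₁ h₂ _ => ?_⟩
    · rw [hseg S hS k h₁ (by omega), hseg S hS (k + 1) (by omega) h₂]
    · rw [hseg S hS k h₁ (by omega), hseg S hS (k + 1) (by omega) h₂, sub_self]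
      exact hthr _ (hT.lt_N hS h₂)
    · rw [hseg S hS k h₁ (by omega), hseg S hS (k + 1) (by omega) h₂]
  · rw [v₂]
    intro S hS hlt
    rw [hseg S hS _ le_rfl hlt, sub_self]
    exact hthr _ (hT.lt_N hS hlt)
  · intro i; rw [happ, hw]
  · intro i; rw [happ]; exact hwpos i
  · intro i; rw [happ, v₂, hpend]; simp

/-! ### The main theorem -/

/-- Absorbs the additive constant in the running time of `flush`. -/
theorem Input.m_pos (P : Input) : 1 ≤ P.m := by
  have hn := P.two_le_n
  have : Nontrivial (Fin P.n) := Fin.nontrivial_iff_two_le.mpr hn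
  obtain ⟨v, hv⟩ := exists_ne P.root
  have hadj : P.G.Adj v (P.parent v) := P.T_le (P.parent_adj v hv)
  obtain ⟨i, -, -⟩ := P.edges.surjOn (show s(v, P.parent v) ∈ P.G.edgeSet from hadj)
  exact Nat.one_le_iff_ne_zero.mpr fun h => (h ▸ i).elim0

/-- From 2^(H-1) ≤ n and 2 ≤ n one gets H log 2 ≤ 2 log n, and 2 / log 2 < 3. -/
theorem Tab.Ok.H_le_log {P : Input} {T : Tab} (h : T.Ok P) : (T.H : ℝ) ≤ 3 * Real.log P.n := by
  have hH := h.H_pos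
  have hpow : 2 ^ (T.H - 1) ≤ P.n := (h.lt_H_iff _).mp (by omega)
  have hn : (2 : ℝ) ≤ P.n := by exact_mod_cast P.two_le_n
  have h₁ : ((T.H - 1 : ℕ) : ℝ) * Real.log 2 ≤ Real.log P.n := by
    rw [← Real.log_pow]
    exact Real.log_le_log (by positivity) (by exact_mod_cast hpow)
  have h₂ : Real.log 2 ≤ Real.log P.n := Real.log_le_log (by norm_num) hn
  have h₃ := Real.log_two_gt_d9
  rw [Nat.cast_sub hH] at h₁
  push_cast at h₁
  nlinarith

theorem Tab.Ok.H_sq_le_log {P : Input} {T : Tab} (h : T.Ok P) :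
    (T.H : ℝ) ^ 2 ≤ 9 * Real.log P.n ^ 2 := by
  have h₁ := h.H_le_log
  have h₂ : (0 : ℝ) ≤ T.H := Nat.cast_nonneg _
  nlinarith

/-- The exponent `y` lies between 0 and 4ε because the pending exponent is at most 4c. -/
theorem Represents.approx {P : Input} {s : Store} {w w' : Fin P.m → ℝ}
    (h : Represents P s w w') (i : Fin P.m) :
    w' i ≤ w i ∧ w i ≤ (1 + 4 * Real.exp 4 * P.ε) * w' i := by
  have hw := h.exact_eq i
  have hpos := h.wt_pos i
  have hc := P.cap_pos i
  have hε := P.ε_pos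
  have hε1 := P.ε_le_one
  have h0 := Tab.Ok.pend_nonneg h.lz i
  have h4 := h.ok.pend_le h.lz h.head i.2
  rw [h.ok.cap_eq] at h4
  set y := P.ε * (view s).pend (s.rarr 5) (s.rarr 4) i / P.cap i
  have hy0 : 0 ≤ y := by positivity
  have hy4 : y ≤ 4 * P.ε := by
    rw [div_le_iff₀ hc]; nlinarith
  have he1 : 1 ≤ Real.exp y := Real.one_le_exp hy0
  have he2 : Real.exp y ≤ 1 + 4 * Real.exp 4 * P.ε := by
    -- From 1 − y ≤ e^(−y) follows e^y ≤ 1 + y e^y, and y e^y ≤ 4ε e⁴ since ε ≤ 1.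
    have h₁ := Real.add_one_le_exp (-y)
    have h₂ : Real.exp (-y) * Real.exp y = 1 := by rw [← Real.exp_add]; simp
    have h₃ : Real.exp y ≤ Real.exp 4 := Real.exp_le_exp.mpr (by linarith)
    have h₄ : (-y + 1) * Real.exp y ≤ 1 :=
      (mul_le_mul_of_nonneg_right h₁ (Real.exp_pos _).le).trans h₂.le
    have h₅ : y * Real.exp y ≤ 4 * P.ε * Real.exp 4 :=
      mul_le_mul hy4 h₃ (Real.exp_pos _).le (by positivity)
    nlinarith
  rw [hw]
  exact ⟨by nlinarith, by nlinarith⟩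

/-- The data structure. -/
def impl : Impl := ⟨initCmd, incCutCmd, flushCmd⟩

theorem Reaches.represents {P : Input} {B : ℕ} (hB : 100 * P.n ^ 8 ≤ B) {s : Store}
    {w w' : Fin P.m → ℝ} (h : Reaches impl B P s w w') : Represents P s w w' := by
  induction h with
  | init h =>
    obtain ⟨t', s', he, hR⟩ := wp_initCmd (τ := 0) hB
    obtain ⟨-, rfl⟩ := h.deterministic he
    exact hR
  | incCut _ q _ h ih =>
    obtain ⟨t', s', he, -, hR, -⟩ := wp_incCutCmd (q := q) ih hB
    obtain ⟨-, rfl⟩ := h.deterministic he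
    exact hR
  | flush _ h ih =>
    obtain ⟨t', s', he, -, -, hR, -⟩ := wp_flushCmd ih hB
    obtain ⟨-, rfl⟩ := h.deterministic he
    exact hR

end LazyIncCuts

/-- There are fixed programs and constants such that on every input, in a machine with words up to
`n ^ K`: initialization halts, and after any sequence of calls, the next call to `inc-cut` or to
`flush` halts within the stated number of steps and returns increments with the stated
properties. -/
theorem mainTheorem3 :
    ∃ (D : LazyIncCuts.Impl) (K : ℕ) (C ρ κ : ℝ), 0 < C ∧ 0 < ρ ∧ 0 < κ ∧
      ∀ P : LazyIncCuts.Input,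
        (∃ (t : ℕ) (s : RealRAM.Store), RealRAM.Exec (P.n ^ K) D.init P.store t s) ∧
        ∀ (s : RealRAM.Store) (w w' : Fin P.m → ℝ), LazyIncCuts.Reaches D (P.n ^ K) P s w w' →
          (∀ q : LazyIncCuts.CutDesc P.n, P.Valid q →
            ∃ (t : ℕ) (s' : RealRAM.Store),
              RealRAM.Exec (P.n ^ K) D.incCut (LazyIncCuts.pass s q) t s' ∧
              (t : ℝ) ≤ C * (Real.log P.n ^ 2 + ((LazyIncCuts.returned s').length : ℝ)) ∧
              (∀ i : Fin P.m,
                LazyIncCuts.applyIncs (LazyIncCuts.returned s') w' i ≤ P.mwu q w i ∧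
                P.mwu q w i ≤
                  (1 + ρ * P.ε) * LazyIncCuts.applyIncs (LazyIncCuts.returned s') w' i) ∧
              (∀ p ∈ LazyIncCuts.returned s', ∃ i : Fin P.m, p.1 = (i : ℕ) ∧
                κ * (P.ε / Real.log P.n ^ 2) * P.mwu q w i ≤ p.2)) ∧
          (∃ (t : ℕ) (s' : RealRAM.Store),
              RealRAM.Exec (P.n ^ K) D.flush s t s' ∧
              (t : ℝ) ≤ C * ((P.m : ℝ) * Real.log P.n ^ 2) ∧
              (LazyIncCuts.returned s').length ≤ P.m ∧
              (∀ p ∈ LazyIncCuts.returned s', ∃ i : Fin P.m, p.1 = (i : ℕ) ∧ 0 < p.2) ∧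
              (∀ i : Fin P.m,
                LazyIncCuts.applyIncs (LazyIncCuts.returned s') w' i = w i)) := by
  open LazyIncCuts in
  -- Word size: n⁷ ≥ 2⁷ > 100, so 100n⁸ ≤ n¹⁵. Time: H² ≤ 9 log² n turns 1280H² into 11520 log² n.
  -- The denominator 18 is the 2 from rounded thresholds times the same 9.
  refine ⟨impl, 15, 12000, 4 * Real.exp 4, Real.exp (-5) / 18, by norm_num, by positivity,
    by positivity, fun P => ?_⟩
  have hn := P.two_le_n
  have hB : 100 * P.n ^ 8 ≤ P.n ^ 15 := by
    have : 2 ^ 7 ≤ P.n ^ 7 := Nat.pow_le_pow_left hn 7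
    calc 100 * P.n ^ 8 ≤ P.n ^ 7 * P.n ^ 8 := Nat.mul_le_mul_right _ (by omega)
      _ = P.n ^ 15 := by ring
  refine ⟨?_, fun s w w' hreach => ?_⟩
  · obtain ⟨t, s, he, -⟩ := wp_initCmd (τ := 0) hB
    exact ⟨t, s, he⟩
  have hR := hreach.represents hB
  have hT := hR.ok
  have hHlog := hT.H_sq_le_log
  refine ⟨fun q _ => ?_, ?_⟩
  · obtain ⟨t, s', he, ht, hR', hp⟩ := wp_incCutCmd (q := q) hR hB
    refine ⟨t, s', he, ?_, hR'.approx, fun p hpm => ?_⟩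
    · rw [length_returned]
      have ht' : ((0 + t : ℕ) : ℝ) ≤ ((1280 * (view s).H ^ 2 + 19 * s'.nreg 6 : ℕ) : ℝ) := by
        exact_mod_cast ht
      push_cast at ht'
      have : (0 : ℝ) ≤ s'.nreg 6 := Nat.cast_nonneg _
      nlinarith
    · obtain ⟨i, hi, hle⟩ := hp p hpm
      refine ⟨i, hi, le_trans ?_ hle⟩
      have hmw : 0 ≤ P.mwu q w i := (hR'.wt_pos i).le.trans (hR'.approx i).1
      refine mul_le_mul_of_nonneg_right ?_ hmw
      have hH := hT.H_sq_pos
      have hlog : 0 < Real.log P.n ^ 2 := by linarith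
      have hε := P.ε_pos
      calc Real.exp (-5) / 18 * (P.ε / Real.log P.n ^ 2)
          = Real.exp (-5) / 2 * (P.ε / (9 * Real.log P.n ^ 2)) := by field_simp; norm_num
        _ ≤ Real.exp (-5) / 2 * (P.ε / ((view s).H : ℝ) ^ 2) := by gcongr
  · obtain ⟨t, s', he, ht, hc, -, happ, hp⟩ := wp_flushCmd hR hB
    refine ⟨t, s', he, ?_, by rw [length_returned]; exact hc, hp, happ⟩
    have ht' : ((0 + t : ℕ) : ℝ) ≤ ((11 * (view s).N + 16 * P.m + 6 : ℕ) : ℝ) := by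
      exact_mod_cast ht
    push_cast at ht'
    have hN := hT.N_le
    have hm : (1 : ℝ) ≤ P.m := by exact_mod_cast P.m_pos
    have hH : (1 : ℝ) ≤ ((view s).H : ℝ) ^ 2 := by
      have : (1 : ℝ) ≤ (view s).H := by exact_mod_cast hT.H_pos
      nlinarith
    have h₁ : (P.m : ℝ) ≤ P.m * ((view s).H : ℝ) ^ 2 := by nlinarith
    have h₂ : (P.m : ℝ) * ((view s).H : ℝ) ^ 2 ≤ P.m * (9 * Real.log P.n ^ 2) := by gcongr
    nlinarith
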